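/- **Setting.** Let $N$ be a natural number, $y_1,\dots,y_N\in\mathbb R$ distinct points, $Y=\{y_1,\dots,y_N\}$, and $\alpha=(\alpha_1,\dots,\alpha_N)\in\mathbb R^N$. Let $\mathbb S_N=(\mathbb C^2)^{\otimes N}$ with orthonormal basis $\mathcal X_\sigma=\chi_{\sigma_1}\otimes\dots\otimes\chi_{\sigma_N}$, $\sigma\in\{\pm1\}^N$, where $\chi_{\pm1}$ are the normalized eigenvectors of the first Pauli matrix. Vectors of $\mathcal H=L^2(\mathbb R)\otimes\mathbb S_N$ are written $\Psi=\sum_\sigma\psi_\sigma\otimes\mathcal X_\sigma$ with $\psi_\sigma\in L^2(\mathbb R)$, and $\langle\Psi,\Phi\rangle=\sum_\sigma(\psi_\sigma,\phi_\sigma)_{L^2}$ (antilinear in the first argument). Put $\alpha\sigma=\sum_j\alpha_j\sigma_j$. The free Hamiltonian $H$ has domain $H^2(\mathbb R)\otimes\mathbb S_N$ and acts as $H\Psi=\sum_\sigma(-\Delta+\alpha\sigma)\psi_\sigma\otimes\mathcal X_\sigma$; the symmetric operator $H_0$ is given by the same expression on $C_0^\infty(\mathbb R\setminus Y)\otimes\mathbb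 S_N$. For a closed operator $T$, $\rho(T)$ is its resolvent set; write $R(z)=(H-z)^{-1}$ for $z\in\rho(H)$. For $w\in\mathbb C\setminus[0,\infty)$ let $\sqrt w$ be the square root with $\operatorname{Im}\sqrt w>0$, and $$G^w(x)=\frac{i\,e^{i\sqrt w|x|}}{2\sqrt w},\qquad (G^w)'(x)=-\operatorname{sgn}(x)\,\frac{e^{i\sqrt w|x|}}{2}.$$ Multi-indices are $\mu=(p,j,\sigma)$ with $p\in\{0,1\}$, $1\le j\le N$, $\sigma\in\{\pm1\}^N$; there are $N2^{N+1}$ of them. For $z$ with $z-\alpha\sigma\notin[0,\infty)$ for all $\sigma$, put $\Phi^z_{0j\sigma}=G^{z-\alpha\sigma}(\cdot-y_j)\otimes\mathcal X_\sigma$, $\Phi^z_{1j\sigma}=(G^{z-\alpha\sigma})'(\cdot-y_j)\otimes\mathcal X_\sigma$, and let $\Gamma(z)$ be the $N2^{N+1}\times N2^{N+1}$ matrix with $$\begin{aligned} &\Gamma(z)_{pj\sigma,p'j'\sigma'}=0\quad(\sigma\ne\sigma'),\qquad \Gamma(z)_{pj\sigma,p'j\sigma}=0\quad(p\neq p'),\\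 &\Gamma(z)_{0j\sigma,0j'\sigma}=-G^{z-\alpha\sigma}(y_j-y_{j'}),\qquad \Gamma(z)_{1j\sigma,1j'\sigma}=-(z-\alpha\sigma)\,G^{z-\alpha\sigma}(y_j-y_{j'}),\\ &\Gamma(z)_{1j\sigma,0j'\sigma}=(G^{z-\alpha\sigma})'(y_j-y_{j'}),\qquad \Gamma(z)_{0j\sigma,1j'\sigma}=-(G^{z-\alpha\sigma})'(y_j-y_{j'})\qquad(j\ne j'). \end{aligned}$$ For $N2^{N+1}\times N2^{N+1}$ complex matrices $A,B$, let $H^{AB}$ be the operator whose domain consists of all $\Psi\in\mathcal H$ with $\psi_\sigma\in H^2(\mathbb R\setminus Y)$ for every $\sigma$ and $$\sum_{\mu'}A_{\mu\mu'}q_{\mu'}=\sum_{\mu'}B_{\mu\mu'}f_{\mu'}\quad\text{for all }\mu,$$ where $$q_{0j\sigma}=\psi_\sigma'(y_j^-)-\psi_\sigma'(y_j^+),\qquad q_{1j\sigma}=\psi_\sigma(y_j^-)-\psi_\sigma(y_j^+),\qquad f_{pj\sigma}=(-1)^p\,\frac{\psi_\sigma^{(p)}(y_j^+)+\psi_\sigma^{(p)}(y_j^-)}2,$$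 and which acts as $H^{AB}\Psi=\sum_\sigma(-\Delta+\alpha\sigma)\psi_\sigma\otimes\mathcal X_\sigma$ on $\mathbb R\setminus Y$. Call $(A,B)$ admissible if $AB^*=BA^*$ and the block matrix $(A|B)$ has maximal rank $N2^{N+1}$. **Theorem.** 1. For every admissible $(A,B)$ the operator $H^{AB}$ is a self-adjoint extension of $H_0$. 2. For every admissible $(A,B)$ and every $z\in\rho(H^{AB})$: one has $z\in\rho(H)$ and $z-\alpha\sigma\notin[0,\infty)$ for all $\sigma$, the matrix $\Gamma^{AB}(z)=B\Gamma(z)+A$ is invertible, and $$(H^{AB}-z)^{-1}=R(z)+\sum_{\mu,\mu',\mu''}\big((\Gamma^{AB}(z))^{-1}\big)_{\mu\mu'}\,B_{\mu'\mu''}\,\langle\Phi^{\bar z}_{\mu''},\cdot\,\rangle\,\Phi^z_\mu .$$ 3. Every self-adjoint extension of $H_0$ is equal to $H^{AB}$ for some admissible $(A,B)$. -/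

import Mathlib

open MeasureTheory Set Filter Topology
open scoped ContDiff ENNReal ComplexConjugate InnerProductSpace

noncomputable section

namespace PointSpin

/-! ### Unbounded operators: resolvent set and resolvent -/

section Resolvent

variable {E : Type*} [NormedAddCommGroup E] [NormedSpace ℂ E]

/-- `R` is a bounded everywhere defined two-sided inverse of `T - z : D(T) → E`. -/
def IsResolventAt (T : E →ₗ.[ℂ] E) (z : ℂ) (R : E →L[ℂ] E) : Prop :=
  (∀ v : E, ∃ h : R v ∈ T.domain, T ⟨R v, h⟩ - z • R v = v) ∧
    ∀ u : T.domain, R (T u - z • (u : E)) = u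

/-- The resolvent set `ρ(T)`. -/
def rho (T : E →ₗ.[ℂ] E) : Set ℂ := {z | ∃ R, IsResolventAt T z R}

open scoped Classical in
/-- The resolvent `(T - z)⁻¹` for `z ∈ ρ(T)` (and `0` for other `z`). -/
def resolventOp (T : E →ₗ.[ℂ] E) (z : ℂ) : E →L[ℂ] E :=
  if h : ∃ R, IsResolventAt T z R then h.choose else 0

theorem resolventOp_spec {T : E →ₗ.[ℂ] E} {z : ℂ} (hz : z ∈ rho T) :
    IsResolventAt T z (resolventOp T z) := by
  have h : ∃ R, IsResolventAt T z R := hz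
  rw [resolventOp, dif_pos h]
  exact h.choose_spec

theorem IsResolventAt.unique {T : E →ₗ.[ℂ] E} {z : ℂ} {R R' : E →L[ℂ] E}
    (h : IsResolventAt T z R) (h' : IsResolventAt T z R') : R = R' := by
  ext v
  obtain ⟨hv, hv'⟩ := h.1 v
  have := h'.2 ⟨R v, hv⟩
  rw [hv'] at this
  exact this.symm

end Resolvent

/-! ### Weak derivatives and second order Sobolev spaces on the line minus a finite set -/

/-- The space `L²(ℝ)` of complex valued functions. -/
abbrev L2 : Type := Lp ℂ 2 (volume : Measure ℝ)

/-- `g` is the weak (generalized) derivative of `f` on the open set `ℝ ∖ Y`. -/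
def IsWeakDeriv (Y : Set ℝ) (f g : L2) : Prop :=
  ∀ φ : ℝ → ℂ, ContDiff ℝ ∞ φ → HasCompactSupport φ → tsupport φ ⊆ Yᶜ →
    ∫ x, f x * deriv φ x = - ∫ x, g x * φ x

theorem integrable_mul_test (f : L2) {φ : ℝ → ℂ} (hφ : Continuous φ)
    (hc : HasCompactSupport φ) : Integrable fun x => f x * φ x :=
  (Lp.memLp f).integrable_mul (hφ.memLp_of_hasCompactSupport (p := 2) hc)

theorem IsWeakDeriv.add {Y : Set ℝ} {f g f' g' : L2} (h : IsWeakDeriv Y f g)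
    (h' : IsWeakDeriv Y f' g') : IsWeakDeriv Y (f + f') (g + g') := by
  intro φ h1 h2 h3
  have hd : Continuous (deriv φ) := h1.continuous_deriv (by simp)
  have e1 : ∫ x, (f + f') x * deriv φ x = ∫ x, (f x * deriv φ x + f' x * deriv φ x) := by
    apply integral_congr_ae
    filter_upwards [Lp.coeFn_add f f'] with x hx
    rw [hx, Pi.add_apply, add_mul]
  have e2 : ∫ x, (g + g') x * φ x = ∫ x, (g x * φ x + g' x * φ x) := by
    apply integral_congr_ae
    filter_upwards [Lp.coeFn_add g g'] with x hx
    rw [hx, Pi.add_apply, add_mul]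
  rw [e1, e2, integral_add (integrable_mul_test f hd h2.deriv) (integrable_mul_test f' hd h2.deriv),
    integral_add (integrable_mul_test g h1.continuous h2)
      (integrable_mul_test g' h1.continuous h2), h φ h1 h2 h3, h' φ h1 h2 h3]
  ring

theorem IsWeakDeriv.smul {Y : Set ℝ} {f g : L2} (c : ℂ) (h : IsWeakDeriv Y f g) :
    IsWeakDeriv Y (c • f) (c • g) := by
  intro φ h1 h2 h3
  have e1 : ∫ x, (c • f) x * deriv φ x = ∫ x, c * (f x * deriv φ x) := by
    apply integral_congr_ae
    filter_upwards [Lp.coeFn_smul c f] with x hx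
    simp [hx, mul_assoc]
  have e2 : ∫ x, (c • g) x * φ x = ∫ x, c * (g x * φ x) := by
    apply integral_congr_ae
    filter_upwards [Lp.coeFn_smul c g] with x hx
    simp [hx, mul_assoc]
  rw [e1, e2, integral_const_mul, integral_const_mul, h φ h1 h2 h3]
  ring

theorem isWeakDeriv_zero (Y : Set ℝ) : IsWeakDeriv Y 0 0 := by
  intro φ _ _ _
  have e : ∀ ψ : ℝ → ℂ, ∫ x, (0 : L2) x * ψ x = 0 := fun ψ => by
    apply integral_eq_zero_of_ae
    filter_upwards [Lp.coeFn_zero ℂ 2 (volume : Measure ℝ)] with x hx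
    rw [hx]
    simp
  rw [e, e, neg_zero]

theorem IsWeakDeriv.unique {Y : Set ℝ} (hY : Y.Finite) {f g g' : L2} (h : IsWeakDeriv Y f g)
    (h' : IsWeakDeriv Y f g') : g = g' := by
  have hint : LocallyIntegrable (fun x => g x - g' x) (volume : Measure ℝ) :=
    ((Lp.memLp g).locallyIntegrable one_le_two).sub ((Lp.memLp g').locallyIntegrable one_le_two)
  have key := hY.isClosed.isOpen_compl.ae_eq_zero_of_integral_contDiff_smul_eq_zero
    (hint.locallyIntegrableOn Yᶜ) (fun φ h1 h2 h3 => by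
      have hφ : ContDiff ℝ ∞ (fun x => (φ x : ℂ)) := Complex.ofRealCLM.contDiff.comp h1
      have hc : HasCompactSupport (fun x => (φ x : ℂ)) :=
        h2.comp_left (g := fun r : ℝ => (r : ℂ)) (by simp)
      have hs : tsupport (fun x => (φ x : ℂ)) ⊆ Yᶜ :=
        (closure_mono (Function.support_comp_subset (g := fun r : ℝ => (r : ℂ)) (by simp) φ)).trans h3
      have e := (h _ hφ hc hs).symm.trans (h' _ hφ hc hs)
      have e2 : ∫ x, φ x • (g x - g' x) = ∫ x, (g x * (φ x : ℂ) - g' x * (φ x : ℂ)) := by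
        congr 1
        ext x
        simp
        ring
      rw [e2, integral_sub (integrable_mul_test g hφ.continuous hc)
        (integrable_mul_test g' hφ.continuous hc), neg_injective e, sub_self])
  apply Lp.ext
  have hn : ∀ᵐ x ∂(volume : Measure ℝ), x ∈ Yᶜ := compl_mem_ae_iff.mpr (hY.measure_zero volume)
  filter_upwards [key, hn] with x hx hx'
  exact sub_eq_zero.mp (hx hx')

open scoped Classical in
/-- The weak derivative on `ℝ ∖ Y` of `f`, if it exists in `L²`
(it is unique when `Y` is finite), and `0` otherwise. -/
def wderiv (Y : Set ℝ) (f : L2) : L2 := if h : ∃ g, IsWeakDeriv Y f g then h.choose else 0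

theorem IsWeakDeriv.wderiv_eq {Y : Set ℝ} (hY : Y.Finite) {f g : L2} (h : IsWeakDeriv Y f g) :
    wderiv Y f = g := by
  have h' : ∃ g, IsWeakDeriv Y f g := ⟨g, h⟩
  rw [wderiv, dif_pos h']
  exact h'.choose_spec.unique hY h

/-- The Sobolev space `H²(ℝ ∖ Y)`: functions in `L²` whose first and second weak derivatives
on `ℝ ∖ Y` are in `L²`.  For `Y = ∅` it is `H²(ℝ)`. -/
def H2 (Y : Set ℝ) : Submodule ℂ L2 where
  carrier := {f | ∃ g k, IsWeakDeriv Y f g ∧ IsWeakDeriv Y g k}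
  zero_mem' := ⟨0, 0, isWeakDeriv_zero Y, isWeakDeriv_zero Y⟩
  add_mem' := by
    rintro a b ⟨g, k, h1, h2⟩ ⟨g', k', h1', h2'⟩
    exact ⟨g + g', k + k', h1.add h1', h2.add h2'⟩
  smul_mem' := by
    rintro c a ⟨g, k, h1, h2⟩
    exact ⟨c • g, c • k, h1.smul c, h2.smul c⟩

theorem wderiv_add {Y : Set ℝ} (hY : Y.Finite) {f f' : L2} (hf : f ∈ H2 Y) (hf' : f' ∈ H2 Y) :
    wderiv Y (f + f') = wderiv Y f + wderiv Y f' ∧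
      wderiv Y (wderiv Y (f + f')) = wderiv Y (wderiv Y f) + wderiv Y (wderiv Y f') := by
  obtain ⟨g, k, h1, h2⟩ := hf
  obtain ⟨g', k', h1', h2'⟩ := hf'
  rw [(h1.add h1').wderiv_eq hY, h1.wderiv_eq hY, h1'.wderiv_eq hY, (h2.add h2').wderiv_eq hY,
    h2.wderiv_eq hY, h2'.wderiv_eq hY]
  exact ⟨rfl, rfl⟩

theorem wderiv_smul {Y : Set ℝ} (hY : Y.Finite) (c : ℂ) {f : L2} (hf : f ∈ H2 Y) :
    wderiv Y (c • f) = c • wderiv Y f ∧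
      wderiv Y (wderiv Y (c • f)) = c • wderiv Y (wderiv Y f) := by
  obtain ⟨g, k, h1, h2⟩ := hf
  rw [(h1.smul c).wderiv_eq hY, h1.wderiv_eq hY, (h2.smul c).wderiv_eq hY, h2.wderiv_eq hY]
  exact ⟨rfl, rfl⟩

/-- `C₀^∞(ℝ ∖ Y)` as a subspace of `L²(ℝ)`. -/
def testSpace (Y : Set ℝ) : Submodule ℂ L2 where
  carrier := {f | ∃ φ : ℝ → ℂ, ContDiff ℝ ∞ φ ∧ HasCompactSupport φ ∧ tsupport φ ⊆ Yᶜ ∧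
    f =ᵐ[volume] φ}
  zero_mem' := ⟨0, contDiff_const, HasCompactSupport.zero, by simp [tsupport],
    Lp.coeFn_zero ℂ 2 _⟩
  add_mem' := by
    rintro a b ⟨φ, h1, h2, h3, h4⟩ ⟨ψ, k1, k2, k3, k4⟩
    exact ⟨φ + ψ, h1.add k1, h2.add k2, (tsupport_add φ ψ).trans (union_subset h3 k3),
      (Lp.coeFn_add a b).trans (h4.add k4)⟩
  smul_mem' := by
    rintro c a ⟨φ, h1, h2, h3, h4⟩
    refine ⟨c • φ, contDiff_const.smul h1, h2.smul_left (f := fun _ => c),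
      (tsupport_smul_subset_right (fun _ => c) φ).trans h3, ?_⟩
    filter_upwards [Lp.coeFn_smul c a, h4] with x hx hx'
    simp [hx, hx']

/-- The weak derivative of a test function is its classical derivative. -/
theorem isWeakDeriv_of_test (Y : Set ℝ) {f g : L2} {φ : ℝ → ℂ} (h1 : ContDiff ℝ ∞ φ)
    (h2 : HasCompactSupport φ) (hf : f =ᵐ[volume] φ) (hg : g =ᵐ[volume] deriv φ) :
    IsWeakDeriv Y f g := by
  intro ψ k1 k2 _
  have e1 : ∫ x, f x * deriv ψ x = ∫ x, φ x * deriv ψ x := by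
    apply integral_congr_ae
    filter_upwards [hf] with x hx
    rw [hx]
  have e2 : ∫ x, g x * ψ x = ∫ x, deriv φ x * ψ x := by
    apply integral_congr_ae
    filter_upwards [hg] with x hx
    rw [hx]
  rw [e1, e2]
  have hd : Continuous (deriv φ) := h1.continuous_deriv (by simp)
  have kd : Continuous (deriv ψ) := k1.continuous_deriv (by simp)
  exact integral_mul_deriv_eq_deriv_mul_of_integrable
    (fun x _ => (h1.differentiable (by simp) x).hasDerivAt)
    (fun x _ => (k1.differentiable (by simp) x).hasDerivAt)
    ((h1.continuous.mul kd).integrable_of_hasCompactSupport h2.mul_right)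
    ((hd.mul k1.continuous).integrable_of_hasCompactSupport k2.mul_left)
    ((h1.continuous.mul k1.continuous).integrable_of_hasCompactSupport h2.mul_right)

theorem testSpace_le_H2 (Y : Set ℝ) : testSpace Y ≤ H2 Y := by
  rintro f ⟨φ, h1, h2, -, hf⟩
  have k1 : ContDiff ℝ ∞ (deriv φ) := (contDiff_infty_iff_deriv.mp h1).2
  have l1 : ContDiff ℝ ∞ (deriv (deriv φ)) := (contDiff_infty_iff_deriv.mp k1).2
  have m1 : MemLp (deriv φ) 2 (volume : Measure ℝ) :=
    k1.continuous.memLp_of_hasCompactSupport h2.deriv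
  have m2 : MemLp (deriv (deriv φ)) 2 (volume : Measure ℝ) :=
    l1.continuous.memLp_of_hasCompactSupport h2.deriv.deriv
  exact ⟨m1.toLp _, m2.toLp _, isWeakDeriv_of_test Y h1 h2 hf m1.coeFn_toLp,
    isWeakDeriv_of_test Y k1 h2.deriv m1.coeFn_toLp m2.coeFn_toLp⟩

/-- The one-sided limit `f(y⁻)` of the almost everywhere defined function `f` is `c`:
convergence from the left along the complements of null sets. -/
def HasLeftTrace (f : L2) (y : ℝ) (c : ℂ) : Prop :=
  Tendsto f (𝓝[<] y ⊓ ae volume) (𝓝 c)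

/-- The one-sided limit `f(y⁺)` of the almost everywhere defined function `f` is `c`:
convergence from the right along the complements of null sets. -/
def HasRightTrace (f : L2) (y : ℝ) (c : ℂ) : Prop :=
  Tendsto f (𝓝[>] y ⊓ ae volume) (𝓝 c)

/-! ### The Hilbert space of the particle and the spins -/

/-- Spin configurations `σ = (σ₁, …, σ_N)`, `σ_j = ±1`. -/
abbrev Config (N : ℕ) : Type := Fin N → ℤˣ

/-- Multi-indices `μ = (p, j, σ)`. -/
abbrev Idx (N : ℕ) : Type := Fin 2 × Fin N × Config N

/-- The Hilbert space `L²(ℝ) ⊗ (ℂ²)^{⊗ N}`, a vector `Ψ = ∑_σ ψ_σ ⊗ X_σ` being given by its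
components `ψ_σ ∈ L²(ℝ)` in the orthonormal basis `X_σ` of joint eigenvectors of the spin
operators `S_j` (`S_j X_σ = σ_j X_σ`); the inner product is `∑_σ (ψ_σ, φ_σ)`. -/
abbrev State (N : ℕ) : Type := PiLp 2 fun _ : Config N => L2

/-- `α · σ = ∑_j α_j σ_j`. -/
def dotSpin {N : ℕ} (α : Fin N → ℝ) (σ : Config N) : ℝ := ∑ j, α j * ((σ j : ℤ) : ℝ)

/-- The subspace `V ⊗ (ℂ²)^{⊗ N}`: all components belong to `V`. -/
def components (N : ℕ) (V : Submodule ℂ L2) : Submodule ℂ (State N) where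
  carrier := {Ψ | ∀ σ, Ψ σ ∈ V}
  zero_mem' := fun _ => V.zero_mem
  add_mem' := fun ha hb σ => V.add_mem (ha σ) (hb σ)
  smul_mem' := fun c _ ha σ => V.smul_mem c (ha σ)

/-- The operator `∑_σ ψ_σ ⊗ X_σ ↦ ∑_σ (-Δ + α·σ) ψ_σ ⊗ X_σ`, where `-Δ` is minus the second weak
derivative on `ℝ ∖ Y`, with domain `D ⊆ H²(ℝ ∖ Y) ⊗ (ℂ²)^{⊗ N}`. -/
def spinLaplacian {N : ℕ} (α : Fin N → ℝ) {Y : Set ℝ} (hY : Y.Finite)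
    (D : Submodule ℂ (State N)) (hD : D ≤ components N (H2 Y)) : State N →ₗ.[ℂ] State N where
  domain := D
  toFun :=
    { toFun := fun Ψ => WithLp.toLp 2 fun σ =>
        -wderiv Y (wderiv Y ((Ψ : State N) σ)) + (dotSpin α σ : ℂ) • (Ψ : State N) σ
      map_add' := fun Ψ Φ => by
        ext1 σ
        have := (wderiv_add hY (hD Ψ.2 σ) (hD Φ.2 σ)).2
        simp only [Submodule.coe_add, PiLp.add_apply, this, smul_add]
        abel
      map_smul' := fun c Ψ => by
        ext1 σ
        have := (wderiv_smul hY c (hD Ψ.2 σ)).2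
        simp only [Submodule.coe_smul, PiLp.smul_apply, this, RingHom.id_apply, smul_add, smul_neg,
          smul_comm c] }

/-- The free Hamiltonian `H`, with domain `H²(ℝ) ⊗ (ℂ²)^{⊗ N}`. -/
def freeH {N : ℕ} (α : Fin N → ℝ) : State N →ₗ.[ℂ] State N :=
  spinLaplacian α finite_empty (components N (H2 ∅)) le_rfl

/-- The symmetric operator `H₀`: the free expression on `C₀^∞(ℝ ∖ Y) ⊗ (ℂ²)^{⊗ N}`,
`Y = {y₁, …, y_N}`. -/
def minimalH {N : ℕ} (α y : Fin N → ℝ) : State N →ₗ.[ℂ] State N :=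
  spinLaplacian α (finite_range y) (components N (testSpace (range y)))
    fun _ h σ => testSpace_le_H2 _ (h σ)

/-- `L (p, j, σ) = ψ_σ^{(p)}(y_j⁻)` and `R (p, j, σ) = ψ_σ^{(p)}(y_j⁺)` for `p = 0, 1`. -/
def HasBoundaryValues {N : ℕ} (y : Fin N → ℝ) (Ψ : State N) (L R : Idx N → ℂ) : Prop :=
  ∀ (p : Fin 2) (j : Fin N) (σ : Config N),
    HasLeftTrace ((wderiv (range y))^[p] (Ψ σ)) (y j) (L (p, j, σ)) ∧
      HasRightTrace ((wderiv (range y))^[p] (Ψ σ)) (y j) (R (p, j, σ))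

/-- The charges: `q_{0jσ} = ψ_σ'(y_j⁻) - ψ_σ'(y_j⁺)` and `q_{1jσ} = ψ_σ(y_j⁻) - ψ_σ(y_j⁺)`. -/
def charge {N : ℕ} (L R : Idx N → ℂ) : Idx N → ℂ
  | (0, j, σ) => L (1, j, σ) - R (1, j, σ)
  | (1, j, σ) => L (0, j, σ) - R (0, j, σ)

/-- The averages: `f_{pjσ} = (-1)^p (ψ_σ^{(p)}(y_j⁺) + ψ_σ^{(p)}(y_j⁻)) / 2`. -/
def average {N : ℕ} (L R : Idx N → ℂ) : Idx N → ℂ :=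
  fun μ => (-1) ^ (μ.1 : ℕ) * ((R μ + L μ) / 2)

theorem charge_add {N : ℕ} (L R L' R' : Idx N → ℂ) :
    charge (L + L') (R + R') = charge L R + charge L' R' := by
  ext ⟨p, j, σ⟩
  fin_cases p <;> simp [charge] <;> ring

theorem charge_smul {N : ℕ} (c : ℂ) (L R : Idx N → ℂ) :
    charge (c • L) (c • R) = c • charge L R := by
  ext ⟨p, j, σ⟩
  fin_cases p <;> simp [charge] <;> ring

theorem average_add {N : ℕ} (L R L' R' : Idx N → ℂ) :
    average (L + L') (R + R') = average L R + average L' R' := by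
  ext μ
  simp [average]
  ring

theorem average_smul {N : ℕ} (c : ℂ) (L R : Idx N → ℂ) :
    average (c • L) (c • R) = c • average L R := by
  ext μ
  simp [average]
  ring

theorem tendsto_trace_add {l : Filter ℝ} {f g : L2} {a b : ℂ}
    (hf : Tendsto f (l ⊓ ae volume) (𝓝 a)) (hg : Tendsto g (l ⊓ ae volume) (𝓝 b)) :
    Tendsto (f + g : L2) (l ⊓ ae volume) (𝓝 (a + b)) :=
  (hf.add hg).congr' ((Lp.coeFn_add f g).symm.filter_mono inf_le_right)

theorem tendsto_trace_smul {l : Filter ℝ} {f : L2} {a : ℂ} (c : ℂ)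
    (hf : Tendsto f (l ⊓ ae volume) (𝓝 a)) :
    Tendsto (c • f : L2) (l ⊓ ae volume) (𝓝 (c • a)) :=
  (hf.const_smul c).congr' ((Lp.coeFn_smul c f).symm.filter_mono inf_le_right)

theorem tendsto_trace_zero (l : Filter ℝ) :
    Tendsto (0 : L2) (l ⊓ ae volume) (𝓝 (0 : ℂ)) :=
  (tendsto_const_nhds (x := (0 : ℂ))).congr'
    ((Lp.coeFn_zero ℂ 2 (volume : Measure ℝ)).symm.filter_mono inf_le_right)

theorem iterate_wderiv_add {Y : Set ℝ} (hY : Y.Finite) {f f' : L2} (hf : f ∈ H2 Y)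
    (hf' : f' ∈ H2 Y) (p : Fin 2) :
    (wderiv Y)^[p] (f + f') = (wderiv Y)^[p] f + (wderiv Y)^[p] f' := by
  fin_cases p
  · rfl
  · exact (wderiv_add hY hf hf').1

theorem iterate_wderiv_smul {Y : Set ℝ} (hY : Y.Finite) (c : ℂ) {f : L2} (hf : f ∈ H2 Y)
    (p : Fin 2) : (wderiv Y)^[p] (c • f) = c • (wderiv Y)^[p] f := by
  fin_cases p
  · rfl
  · exact (wderiv_smul hY c hf).1

theorem iterate_wderiv_zero {Y : Set ℝ} (hY : Y.Finite) (p : Fin 2) :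
    (wderiv Y)^[p] 0 = 0 := by
  fin_cases p
  · rfl
  · exact (isWeakDeriv_zero Y).wderiv_eq hY

/-- The domain of `H^{AB}`: all `Ψ ∈ H²(ℝ ∖ Y) ⊗ (ℂ²)^{⊗ N}` whose charges `q` and averages `f`
satisfy `A q = B f`. -/
def domainAB {N : ℕ} (y : Fin N → ℝ) (A B : Matrix (Idx N) (Idx N) ℂ) :
    Submodule ℂ (State N) where
  carrier := {Ψ | Ψ ∈ components N (H2 (range y)) ∧ ∃ L R : Idx N → ℂ,
    HasBoundaryValues y Ψ L R ∧ A.mulVec (charge L R) = B.mulVec (average L R)}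
  zero_mem' := by
    refine ⟨Submodule.zero_mem _, 0, 0, fun p j σ => ?_, ?_⟩
    · rw [PiLp.zero_apply, iterate_wderiv_zero (finite_range y)]
      exact ⟨tendsto_trace_zero _, tendsto_trace_zero _⟩
    · have h1 := charge_smul (0 : ℂ) (0 : Idx N → ℂ) 0
      have h2 := average_smul (0 : ℂ) (0 : Idx N → ℂ) 0
      rw [zero_smul, zero_smul] at h1 h2
      rw [h1, h2, Matrix.mulVec_zero, Matrix.mulVec_zero]
  add_mem' := by
    rintro Ψ Ψ' ⟨h, L, R, hb, he⟩ ⟨h', L', R', hb', he'⟩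
    refine ⟨Submodule.add_mem _ h h', L + L', R + R', fun p j σ => ?_, ?_⟩
    · rw [PiLp.add_apply, iterate_wderiv_add (finite_range y) (h σ) (h' σ)]
      exact ⟨tendsto_trace_add (hb p j σ).1 (hb' p j σ).1,
        tendsto_trace_add (hb p j σ).2 (hb' p j σ).2⟩
    · rw [charge_add, average_add, Matrix.mulVec_add, Matrix.mulVec_add, he, he']
  smul_mem' := by
    rintro c Ψ ⟨h, L, R, hb, he⟩
    refine ⟨Submodule.smul_mem _ c h, c • L, c • R, fun p j σ => ?_, ?_⟩
    · rw [PiLp.smul_apply, iterate_wderiv_smul (finite_range y) c (h σ)]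
      exact ⟨tendsto_trace_smul c (hb p j σ).1, tendsto_trace_smul c (hb p j σ).2⟩
    · rw [charge_smul, average_smul, Matrix.mulVec_smul, Matrix.mulVec_smul, he]

/-- The point perturbation `H^{AB}`. -/
def hamAB {N : ℕ} (α y : Fin N → ℝ) (A B : Matrix (Idx N) (Idx N) ℂ) :
    State N →ₗ.[ℂ] State N :=
  spinLaplacian α (finite_range y) (domainAB y A B) fun _ h => h.1

/-! ### Green's function and the matrix `Γ(z)` -/

/-- The square root of `w` with positive imaginary part, for `w ∉ [0, ∞)`. -/
def sqrtUp (w : ℂ) : ℂ := Complex.I * (-w) ^ (1 / 2 : ℂ)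

theorem sqrtUp_sq (w : ℂ) : sqrtUp w ^ 2 = w := by
  have h : ((-w) ^ (1 / 2 : ℂ)) ^ 2 = -w := by
    have := Complex.cpow_nat_inv_pow (-w) (n := 2) two_ne_zero
    simpa using this
  rw [sqrtUp, mul_pow, h, Complex.I_sq]
  ring

theorem sqrtUp_im_pos {w : ℂ} (hw : ∀ r : ℝ, 0 ≤ r → w ≠ r) : 0 < (sqrtUp w).im := by
  have h0 : -w ≠ 0 := fun h => hw 0 le_rfl (by simpa using h)
  have harg : Complex.arg (-w) ≠ Real.pi := by
    intro h
    obtain ⟨h1, h2⟩ := Complex.arg_eq_pi_iff.mp h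
    simp only [Complex.neg_re, Complex.neg_im] at h1 h2
    exact hw w.re (by linarith) (Complex.ext (by simp) (by simp; linarith))
  have hre : 0 < ((-w) ^ (1 / 2 : ℂ)).re := by
    rw [Complex.cpow_def_of_ne_zero h0, Complex.exp_re]
    apply mul_pos (Real.exp_pos _)
    apply Real.cos_pos_of_mem_Ioo
    have him : (Complex.log (-w) * (1 / 2 : ℂ)).im = Complex.arg (-w) / 2 := by
      rw [Complex.mul_im, Complex.log_im]
      norm_num
      ring
    rw [him]
    have h1 := Complex.neg_pi_lt_arg (-w)
    have h2 := lt_of_le_of_ne (Complex.arg_le_pi (-w)) harg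
    constructor <;> linarith
  simp only [sqrtUp, Complex.mul_im, Complex.I_re, Complex.I_im, zero_mul, one_mul, zero_add]
  exact hre

/-- Green's function `G^w(x) = i e^{i √w |x|} / (2 √w)`. -/
def green (w : ℂ) (x : ℝ) : ℂ :=
  Complex.I * Complex.exp (Complex.I * sqrtUp w * |x|) / (2 * sqrtUp w)

/-- Its derivative `(G^w)'(x) = - sgn(x) e^{i √w |x|} / 2`. -/
def greenDeriv (w : ℂ) (x : ℝ) : ℂ :=
  -(Real.sign x : ℂ) * Complex.exp (Complex.I * sqrtUp w * |x|) / 2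

/-- The functions `(G^w)^{(p)}` for `p = 0, 1`. -/
def greenP (p : Fin 2) (w : ℂ) (x : ℝ) : ℂ := if p = 0 then green w x else greenDeriv w x

theorem norm_exp_sqrtUp (w : ℂ) (x : ℝ) :
    ‖Complex.exp (Complex.I * sqrtUp w * |x|)‖ = Real.exp (-(sqrtUp w).im * |x|) := by
  rw [Complex.norm_exp]
  simp

theorem memLp_exp_sqrtUp {w : ℂ} (hw : ∀ r : ℝ, 0 ≤ r → w ≠ r) :
    MemLp (fun x : ℝ => Complex.exp (Complex.I * sqrtUp w * |x|)) 2 volume := by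
  have hc : Continuous fun x : ℝ => Complex.exp (Complex.I * sqrtUp w * |x|) := by fun_prop
  rw [memLp_two_iff_integrable_sq_norm hc.aestronglyMeasurable]
  have e : (fun x : ℝ => ‖Complex.exp (Complex.I * sqrtUp w * |x|)‖ ^ 2) =
      fun x : ℝ => (fun t => Real.exp (-(2 * (sqrtUp w).im) * t)) |x| := by
    ext x
    rw [norm_exp_sqrtUp, ← Real.exp_nat_mul]
    congr 1
    push_cast
    ring
  rw [e]
  have hb := sqrtUp_im_pos hw
  rw [← integrableOn_univ, ← Iic_union_Ioi (a := (0 : ℝ))]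
  refine IntegrableOn.union ?_ ?_
  · refine (integrableOn_exp_mul_Iic (a := 2 * (sqrtUp w).im) (by linarith) 0).congr_fun
      (fun x hx => ?_) measurableSet_Iic
    simp only [abs_of_nonpos (mem_Iic.mp hx)]
    congr 1
    ring
  · refine (integrableOn_exp_mul_Ioi (a := -(2 * (sqrtUp w).im)) (by linarith) 0).congr_fun
      (fun x hx => ?_) measurableSet_Ioi
    simp only [abs_of_pos (mem_Ioi.mp hx)]

/-- `(G^w)^{(p)}(· - c)` is square integrable for `w ∉ [0, ∞)`. -/
theorem memLp_greenP {w : ℂ} (hw : ∀ r : ℝ, 0 ≤ r → w ≠ r) (p : Fin 2) (c : ℝ) :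
    MemLp (fun x : ℝ => greenP p w (x - c)) 2 volume := by
  suffices h : MemLp (greenP p w) 2 (volume : Measure ℝ) from
    h.comp_measurePreserving (measurePreserving_sub_right volume c)
  have hs : Measurable Real.sign := by
    unfold Real.sign
    exact Measurable.ite measurableSet_Iio measurable_const
      (Measurable.ite measurableSet_Ioi measurable_const measurable_const)
  have h0 := memLp_exp_sqrtUp hw
  fin_cases p
  · have := h0.const_mul (Complex.I / (2 * sqrtUp w))
    convert this using 2 with x
    simp only [greenP, green, Fin.zero_eta, if_true]
    ring
  · refine h0.mono ?_ (Eventually.of_forall fun x => ?_)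
    · have : Continuous fun x : ℝ => Complex.exp (Complex.I * sqrtUp w * |x|) := by fun_prop
      have hm : Measurable fun x : ℝ =>
          -(Real.sign x : ℂ) * Complex.exp (Complex.I * sqrtUp w * |x|) / 2 :=
        (((Complex.measurable_ofReal.comp hs).neg).mul this.measurable).div_const 2
      exact hm.aestronglyMeasurable
    · have hb : ‖(Real.sign x : ℂ)‖ ≤ 1 := by
        rcases Real.sign_apply_eq x with h | h | h <;> simp [h]
      have e : greenP ⟨1, by norm_num⟩ w x =
          -(Real.sign x : ℂ) * Complex.exp (Complex.I * sqrtUp w * |x|) / 2 := rfl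
      rw [show ((fun i => i) (⟨1, by norm_num⟩ : Fin 2)) = ⟨1, by norm_num⟩ from rfl, e, norm_div,
        norm_mul, norm_neg]
      have := norm_nonneg (Complex.exp (Complex.I * sqrtUp w * |x|))
      have h2 : ‖(2 : ℂ)‖ = 2 := by simp
      rw [h2]
      nlinarith

open scoped Classical in
/-- The class in `L²(ℝ)` of a square integrable function (and `0` for other functions). -/
def toL2 (g : ℝ → ℂ) : L2 := if h : MemLp g 2 (volume : Measure ℝ) then h.toLp g else 0

/-- The vectors `Φ^z_{pjσ} = (G^{z - α·σ})^{(p)}(· - y_j) ⊗ X_σ`. -/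
def defectVec {N : ℕ} (α y : Fin N → ℝ) (z : ℂ) (μ : Idx N) : State N :=
  WithLp.toLp 2 fun σ =>
    if σ = μ.2.2 then toL2 fun x => greenP μ.1 (z - dotSpin α σ) (x - y μ.2.1) else 0

/-- The matrix `Γ(z)`. -/
def gammaMat {N : ℕ} (α y : Fin N → ℝ) (z : ℂ) : Matrix (Idx N) (Idx N) ℂ :=
  Matrix.of fun μ ν =>
    if μ.2.2 ≠ ν.2.2 then 0
    else
      let w : ℂ := z - dotSpin α μ.2.2
      let j := μ.2.1
      let j' := ν.2.1
      match μ.1, ν.1 with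
      | 0, 0 => -green w (y j - y j')
      | 1, 1 => -w * green w (y j - y j')
      | 1, 0 => if j = j' then 0 else greenDeriv w (y j - y j')
      | 0, 1 => if j = j' then 0 else -greenDeriv w (y j - y j')

/-- `Γ^{AB}(z) = B Γ(z) + A`. -/
def gammaAB {N : ℕ} (α y : Fin N → ℝ) (A B : Matrix (Idx N) (Idx N) ℂ) (z : ℂ) :
    Matrix (Idx N) (Idx N) ℂ := B * gammaMat α y z + A

/-- `A B* = B A*` and `(A|B)` has maximal rank `N 2^{N+1}`. -/
def Admissible {N : ℕ} (A B : Matrix (Idx N) (Idx N) ℂ) : Prop :=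
  A * B.conjTranspose = B * A.conjTranspose ∧ (Matrix.fromCols A B).rank = N * 2 ^ (N + 1)

end PointSpin

end

open PointSpin

/-!
# Point perturbations of the Laplacian with spins: extensions and resolvents

Off the points `y_j` the equation `-u'' = w u`, `w ∉ [0, ∞)`, is solved in `L²(ℝ)` exactly by the
combinations of Green's function `G^w(· - y_j)` and its derivative (`mem_span_greenL`). Hence every
vector of the maximal domain `H²(ℝ ∖ Y) ⊗ (ℂ²)^{⊗ N}` has, for each `z` such that
`z - α·σ ∉ [0, ∞)` for all `σ`, the form `u = R(z) g + ∑ c_μ Φ^z_μ` with `g = (-Δ + α·σ - z) u` (`eq_kreinVec`). For such a vector everything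
is explicit: its charges are `q = c` and its averages are `f = τ - Γ(z) c`, where
`τ_μ = ⟨Φ^{z̄}_μ, g⟩` (`exists_boundary_kreinVec`).

Together with `R(z)* = R(z̄)` and `Γ(z)* = Γ(z̄)` this representation, at `z = i` and `z = -i`, gives
Green's identity `⟨T u, v⟩ - ⟨u, T v⟩ = ⟨f(u), q(v)⟩ - ⟨q(u), f(v)⟩` for the maximal operator `T`
without integrating by parts, and shows that `(q, f)` takes all values. As `T` is the adjoint of the
minimal operator, `(q, f)` is a boundary triple (`isBoundaryMap`): self-adjoint extensions correspond
to the Lagrangian subspaces of the space of boundary data, and these are exactly the solution spaces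
of `A q = B f` with `A B* = B A*` and `(A|B)` of maximal rank (`isLagrangian_boundarySpace`,
`IsLagrangian.exists_eq_boundarySpace`).

For the resolvent, `u = R(z) g + ∑ c_μ Φ^z_μ` satisfies `A q = B f` if and only if
`(B Γ(z) + A) c = B τ`, which is Krein's formula; a kernel vector of `B Γ(z) + A` would give an
eigenvector of `H^{AB}` (`isUnit_gammaAB`, `resolvent_eq`). That a resolvent point `z` of `H^{AB}`
has `z - α·σ ∉ [0, ∞)` follows from wave packets supported far away from the points
(`exists_testFun_norm_lt`).
-/

noncomputable section

namespace PointSpin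

/-! ### Convolution with exponentially decaying kernels -/

theorem integrable_exp_neg_mul_abs {b : ℝ} (hb : 0 < b) :
    Integrable fun x : ℝ => Real.exp (-b * |x|) := by
  rw [← integrableOn_univ, ← Iic_union_Ioi (a := (0 : ℝ))]
  refine IntegrableOn.union ?_ ?_
  · refine (integrableOn_exp_mul_Iic (a := b) hb 0).congr_fun
      (fun x hx => ?_) measurableSet_Iic
    simp only [abs_of_nonpos (mem_Iic.mp hx)]
    congr 1
    ring
  · refine (integrableOn_exp_mul_Ioi (a := -b) (by linarith) 0).congr_fun
      (fun x hx => ?_) measurableSet_Ioi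
    simp only [abs_of_pos (mem_Ioi.mp hx)]

/-- A convolution kernel that decays exponentially and is continuous except possibly at `0`. -/
structure IsExpKernel (k : ℝ → ℂ) : Prop where
  measurable : Measurable k
  continuousAt : ∀ x ≠ 0, ContinuousAt k x
  bound : ∃ C b : ℝ, 0 < b ∧ 0 ≤ C ∧ ∀ x, ‖k x‖ ≤ C * Real.exp (-b * |x|)

namespace IsExpKernel

variable {k : ℝ → ℂ} (hk : IsExpKernel k)
include hk

theorem integrable : Integrable k := by
  obtain ⟨C, b, hb, -, h⟩ := hk.bound
  exact ((integrable_exp_neg_mul_abs hb).const_mul C).mono' hk.measurable.aestronglyMeasurable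
    (Eventually.of_forall h)

theorem bounded : ∃ C : ℝ, 0 ≤ C ∧ ∀ x, ‖k x‖ ≤ C := by
  obtain ⟨C, b, hb, hC, h⟩ := hk.bound
  refine ⟨C, hC, fun x => (h x).trans (mul_le_of_le_one_right hC ?_)⟩
  rw [Real.exp_le_one_iff]
  nlinarith [abs_nonneg x]

theorem memLp : MemLp k 2 (volume : Measure ℝ) := by
  obtain ⟨C, hC, h⟩ := hk.bounded
  rw [memLp_two_iff_integrable_sq_norm hk.measurable.aestronglyMeasurable]
  refine (hk.integrable.norm.const_mul C).mono' (by
    exact (hk.measurable.norm.pow_const 2).aestronglyMeasurable) (Eventually.of_forall fun x => ?_)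
  rw [Real.norm_of_nonneg (by positivity), sq]
  exact mul_le_mul_of_nonneg_right (h x) (norm_nonneg _)

theorem memLp_comp_sub_left (x : ℝ) : MemLp (fun t => k (x - t)) 2 (volume : Measure ℝ) :=
  hk.memLp.comp_measurePreserving (Measure.measurePreserving_sub_left volume x)

theorem integrable_sub_mul {g : ℝ → ℂ} (hg : MemLp g 2 (volume : Measure ℝ)) (x : ℝ) :
    Integrable fun t => k (x - t) * g t :=
  (hk.memLp_comp_sub_left x).integrable_mul hg

theorem neg : IsExpKernel fun x => k (-x) := by
  refine ⟨hk.measurable.comp measurable_neg, fun x hx => ?_, ?_⟩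
  · exact ContinuousAt.comp (f := fun x : ℝ => -x) (hk.continuousAt (-x) (neg_ne_zero.mpr hx))
      continuousAt_id.neg
  · obtain ⟨C, b, hb, hC, h⟩ := hk.bound
    exact ⟨C, b, hb, hC, fun x => by simpa using h (-x)⟩

/-- By the inequality `|f g| ≤ |f|² + |g|²` this reduces to convolutions of integrable
functions. -/
theorem integrable_prod {f g : ℝ → ℂ} (hf : MemLp f 2 (volume : Measure ℝ))
    (hg : MemLp g 2 (volume : Measure ℝ)) :
    Integrable (fun p : ℝ × ℝ => k (p.1 - p.2) * g p.2 * f p.1) (volume.prod volume) := by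
  have hg2 := (memLp_two_iff_integrable_sq_norm hg.1).mp hg
  have hf2 := (memLp_two_iff_integrable_sq_norm hf.1).mp hf
  have h1 := hg2.convolution_integrand (ContinuousLinearMap.mul ℝ ℝ) hk.integrable.norm
  have h2 := (hf2.convolution_integrand (ContinuousLinearMap.mul ℝ ℝ) hk.neg.integrable.norm).swap
  refine (h1.add h2).mono' ?_ (Eventually.of_forall fun p => ?_)
  · refine AEStronglyMeasurable.mul (AEStronglyMeasurable.mul ?_ ?_) ?_
    · exact (hk.measurable.comp (measurable_fst.sub measurable_snd)).aestronglyMeasurable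
    · exact hg.1.comp_quasiMeasurePreserving Measure.quasiMeasurePreserving_snd
    · exact hf.1.comp_quasiMeasurePreserving Measure.quasiMeasurePreserving_fst
  · simp only [Pi.add_apply, ContinuousLinearMap.mul_apply', Function.comp_apply, Prod.fst_swap,
      Prod.snd_swap, neg_sub, norm_mul]
    have := norm_nonneg (k (p.1 - p.2))
    nlinarith [sq_nonneg (‖g p.2‖ - ‖f p.1‖), sq_nonneg ‖g p.2‖, sq_nonneg ‖f p.1‖,
      mul_nonneg this (sq_nonneg (‖g p.2‖ - ‖f p.1‖)), mul_nonneg this (sq_nonneg ‖g p.2‖),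
      mul_nonneg this (sq_nonneg ‖f p.1‖)]

end IsExpKernel

theorem integral_norm_comp_sub_left (k : ℝ → ℂ) (x : ℝ) : ∫ t, ‖k (x - t)‖ = ∫ t, ‖k t‖ :=
  integral_sub_left_eq_self (fun t => ‖k t‖) volume x

/-- The convolution `x ↦ ∫ k (x - t) g(t) dt`. -/
def conv (k g : ℝ → ℂ) (x : ℝ) : ℂ := ∫ t, k (x - t) * g t

namespace IsExpKernel

variable {k : ℝ → ℂ} (hk : IsExpKernel k)
include hk

theorem integral_conv_mul {f g : ℝ → ℂ} (hf : MemLp f 2 (volume : Measure ℝ))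
    (hg : MemLp g 2 (volume : Measure ℝ)) :
    ∫ x, conv k g x * f x = ∫ t, g t * ∫ x, k (x - t) * f x := by
  have h := integral_integral_swap (μ := (volume : Measure ℝ)) (ν := (volume : Measure ℝ))
    (f := fun x t => k (x - t) * g t * f x) (hk.integrable_prod hf hg)
  simp only [conv, ← integral_mul_const, ← integral_const_mul]
  rw [h]
  congr 1
  ext t
  congr 1
  ext x
  ring

theorem continuous_conv {g : ℝ → ℂ} (hg : MemLp g 2 (volume : Measure ℝ)) :
    Continuous (conv k g) := by
  rw [continuous_iff_continuousAt]
  intro x₀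
  obtain ⟨C, b, hb, hC, h⟩ := hk.bound
  have hE : IsExpKernel fun x => ((C * Real.exp b * Real.exp (-b * |x|) : ℝ) : ℂ) := by
    refine ⟨by fun_prop, fun x _ => by fun_prop, C * Real.exp b, b, hb, by positivity, fun x => ?_⟩
    rw [Complex.norm_real, Real.norm_of_nonneg (by positivity)]
  refine continuousAt_of_dominated (bound := fun t =>
    ‖((C * Real.exp b * Real.exp (-b * |x₀ - t|) : ℝ) : ℂ) * g t‖) ?_ ?_
    (hE.integrable_sub_mul hg x₀).norm ?_
  · exact Eventually.of_forall fun x => (hk.integrable_sub_mul hg x).aestronglyMeasurable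
  · filter_upwards [Metric.ball_mem_nhds x₀ one_pos] with x hx
    refine Eventually.of_forall fun t => ?_
    rw [norm_mul, norm_mul, Complex.norm_real, Real.norm_of_nonneg (by positivity)]
    refine mul_le_mul_of_nonneg_right ((h _).trans ?_) (norm_nonneg _)
    rw [mul_assoc, ← Real.exp_add]
    refine mul_le_mul_of_nonneg_left (Real.exp_le_exp.mpr ?_) hC
    have h1 : |x - x₀| < 1 := hx
    have h2 : |x₀ - t| ≤ |x - t| + |x - x₀| := by
      rw [abs_sub_comm x x₀, add_comm]
      exact abs_sub_le x₀ x t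
    nlinarith
  · filter_upwards [compl_mem_ae_iff.mpr (measure_singleton (μ := (volume : Measure ℝ)) x₀)]
      with t ht
    have ht' : x₀ - t ≠ 0 := sub_ne_zero.mpr fun e => ht e.symm
    have : ContinuousAt (fun x => k (x - t)) x₀ :=
      ContinuousAt.comp (f := fun x : ℝ => x - t) (hk.continuousAt _ ht') (by fun_prop)
    exact this.mul continuousAt_const

theorem integrable_norm_mul_sq {g : ℝ → ℂ} (hg : MemLp g 2 (volume : Measure ℝ)) (x : ℝ) :
    Integrable fun t => ‖k (x - t)‖ * ‖g t‖ ^ 2 := by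
  obtain ⟨C, -, h⟩ := hk.bounded
  refine (((memLp_two_iff_integrable_sq_norm hg.1).mp hg).const_mul C).mono' ?_
    (Eventually.of_forall fun t => ?_)
  · exact (hk.measurable.comp (measurable_const.sub measurable_id)).norm.aestronglyMeasurable.mul
      (hg.1.norm.pow 2)
  · rw [Real.norm_of_nonneg (by positivity)]
    exact mul_le_mul_of_nonneg_right (h _) (by positivity)

/-- The Cauchy–Schwarz inequality with respect to the measure `|k(x - t)| dt`. -/
theorem norm_conv_sq_le {g : ℝ → ℂ} (hg : MemLp g 2 (volume : Measure ℝ)) (x : ℝ) :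
    ‖conv k g x‖ ^ 2 ≤ (∫ t, ‖k t‖) * ∫ t, ‖k (x - t)‖ * ‖g t‖ ^ 2 := by
  set M := ∫ t, ‖k t‖
  set S := ∫ t, ‖k (x - t)‖ * ‖g t‖ ^ 2
  set P := ∫ t, ‖k (x - t) * g t‖
  have hP : ‖conv k g x‖ ≤ P := norm_integral_le_integral_norm _
  have i1 := hk.integrable_norm_mul_sq hg x
  have i2 := (hk.integrable_sub_mul hg x).norm
  have i3 : Integrable fun t => ‖k (x - t)‖ := (hk.integrable.comp_sub_left x).norm
  have key : ∀ s : ℝ, 0 ≤ M * (s * s) + (-2 * P) * s + S := fun s => by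
    have e : ∫ t, ‖k (x - t)‖ * (‖g t‖ - s) ^ 2 = M * (s * s) + (-2 * P) * s + S := by
      have : (fun t => ‖k (x - t)‖ * (‖g t‖ - s) ^ 2) = fun t =>
          (s * s) * ‖k (x - t)‖ + (-2 * s) * ‖k (x - t) * g t‖ + ‖k (x - t)‖ * ‖g t‖ ^ 2 := by
        ext t
        rw [norm_mul]
        ring
      have i4 : Integrable fun t => (s * s) * ‖k (x - t)‖ + (-2 * s) * ‖k (x - t) * g t‖ :=
        (i3.const_mul _).add (i2.const_mul _)
      rw [this, integral_add i4 i1, integral_add (i3.const_mul _) (i2.const_mul _),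
        integral_const_mul, integral_const_mul, integral_norm_comp_sub_left]
      ring
    rw [← e]
    exact integral_nonneg fun t => by positivity
  have hd := discrim_le_zero key
  rw [discrim] at hd
  have : ‖conv k g x‖ ^ 2 ≤ P ^ 2 := pow_le_pow_left₀ (norm_nonneg _) hP 2
  nlinarith

theorem integrable_norm_conv_sq {g : ℝ → ℂ} (hg : MemLp g 2 (volume : Measure ℝ)) :
    Integrable (fun x => ‖conv k g x‖ ^ 2) ∧
      ∫ x, ‖conv k g x‖ ^ 2 ≤ (∫ t, ‖k t‖) ^ 2 * ∫ t, ‖g t‖ ^ 2 := by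
  have hg2 := (memLp_two_iff_integrable_sq_norm hg.1).mp hg
  have hp := hg2.convolution_integrand (μ := (volume : Measure ℝ)) (ContinuousLinearMap.mul ℝ ℝ)
    hk.integrable.norm
  have h1 : Integrable fun x => (∫ t, ‖k t‖) * ∫ t, ‖k (x - t)‖ * ‖g t‖ ^ 2 := by
    refine (hp.integral_prod_left.const_mul (∫ t, ‖k t‖)).congr (Eventually.of_forall fun x => ?_)
    simp [mul_comm]
  have h2 : Integrable (fun x => ‖conv k g x‖ ^ 2) :=
    h1.mono' ((hk.continuous_conv hg).norm.pow 2).aestronglyMeasurable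
      (Eventually.of_forall fun x => by
        rw [Real.norm_of_nonneg (by positivity)]
        exact hk.norm_conv_sq_le hg x)
  refine ⟨h2, (integral_mono h2 h1 fun x => hk.norm_conv_sq_le hg x).trans (le_of_eq ?_)⟩
  have h3 := integral_convolution (μ := (volume : Measure ℝ)) (ContinuousLinearMap.mul ℝ ℝ) hg2
    hk.integrable.norm
  simp only [convolution, ContinuousLinearMap.mul_apply'] at h3
  rw [integral_const_mul, sq, mul_assoc, mul_comm (∫ t, ‖k t‖) (∫ t, ‖g t‖ ^ 2), ← h3]
  congr 3
  ext x
  congr 1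
  ext t
  ring

theorem memLp_conv {g : ℝ → ℂ} (hg : MemLp g 2 (volume : Measure ℝ)) :
    MemLp (conv k g) 2 (volume : Measure ℝ) :=
  (memLp_two_iff_integrable_sq_norm (hk.continuous_conv hg).aestronglyMeasurable).mpr
    (hk.integrable_norm_conv_sq hg).1

end IsExpKernel

theorem norm_sq_eq_integral (f : L2) : ‖f‖ ^ 2 = ∫ x, ‖f x‖ ^ 2 := by
  have h := inner_self_eq_norm_sq_to_K (𝕜 := ℂ) f
  rw [L2.inner_def] at h
  simp only [inner_self_eq_norm_sq_to_K] at h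
  have h2 : ((∫ x, ‖f x‖ ^ 2 : ℝ) : ℂ) = ((‖f‖ ^ 2 : ℝ) : ℂ) := by
    rw [← integral_complex_ofReal]
    simpa using h
  exact_mod_cast h2.symm

/-- Convolution with an exponentially decaying kernel, as a bounded operator of `L²(ℝ)`. -/
def convL {k : ℝ → ℂ} (hk : IsExpKernel k) : L2 →L[ℂ] L2 :=
  LinearMap.mkContinuous
    { toFun := fun g => (hk.memLp_conv (Lp.memLp g)).toLp _
      map_add' := fun f g => by
        rw [← MemLp.toLp_add]
        congr 1
        ext x
        rw [Pi.add_apply, conv, conv, conv, ← integral_add (hk.integrable_sub_mul (Lp.memLp f) x)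
          (hk.integrable_sub_mul (Lp.memLp g) x)]
        apply integral_congr_ae
        filter_upwards [Lp.coeFn_add f g] with t ht
        rw [ht, Pi.add_apply, mul_add]
      map_smul' := fun c g => by
        rw [RingHom.id_apply, ← MemLp.toLp_const_smul]
        congr 1
        ext x
        rw [Pi.smul_apply, smul_eq_mul, conv, conv, ← integral_const_mul]
        apply integral_congr_ae
        filter_upwards [Lp.coeFn_smul c g] with t ht
        rw [ht, Pi.smul_apply, smul_eq_mul]
        ring }
    (∫ t, ‖k t‖) fun g => by
      have h0 : 0 ≤ ∫ t, ‖k t‖ := integral_nonneg fun _ => norm_nonneg _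
      refine (pow_le_pow_iff_left₀ (norm_nonneg _) (by positivity) two_ne_zero).mp ?_
      rw [mul_pow, norm_sq_eq_integral, norm_sq_eq_integral]
      refine le_trans (le_of_eq (integral_congr_ae ?_))
        (hk.integrable_norm_conv_sq (Lp.memLp g)).2
      filter_upwards [(hk.memLp_conv (Lp.memLp g)).coeFn_toLp] with x hx
      simp [hx]

theorem convL_coeFn {k : ℝ → ℂ} (hk : IsExpKernel k) (g : L2) :
    convL hk g =ᵐ[volume] conv k g :=
  (hk.memLp_conv (Lp.memLp g)).coeFn_toLp

/-! ### Green's function: derivatives, symmetries and jumps -/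

theorem sqrtUp_conj {w : ℂ} (hw : ∀ r : ℝ, 0 ≤ r → w ≠ r) :
    sqrtUp (conj w) = -conj (sqrtUp w) := by
  have harg : Complex.arg (-w) ≠ Real.pi := by
    intro h
    obtain ⟨h1, h2⟩ := Complex.arg_eq_pi_iff.mp h
    simp only [Complex.neg_re, Complex.neg_im] at h1 h2
    exact hw w.re (by linarith) (Complex.ext (by simp) (by simp; linarith))
  have h := Complex.cpow_conj (-w) (1 / 2) harg
  have h2 : conj (1 / 2 : ℂ) = 1 / 2 := by rw [map_div₀, map_one, map_ofNat]
  rw [h2, map_neg] at h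
  simp only [sqrtUp]
  rw [h, map_mul, Complex.conj_I, Complex.conj_conj]
  ring

theorem conj_notMem {w : ℂ} (hw : ∀ r : ℝ, 0 ≤ r → w ≠ r) (r : ℝ) (hr : 0 ≤ r) : conj w ≠ r :=
  fun h => hw r hr (by rw [← Complex.conj_conj w, h, Complex.conj_ofReal])

theorem sqrtUp_ne_zero {w : ℂ} (hw : ∀ r : ℝ, 0 ≤ r → w ≠ r) : sqrtUp w ≠ 0 := fun h => by
  have := sqrtUp_im_pos hw
  simp [h] at this

theorem conj_exp_sqrtUp {w : ℂ} (hw : ∀ r : ℝ, 0 ≤ r → w ≠ r) (x : ℝ) :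
    conj (Complex.exp (Complex.I * sqrtUp w * x)) =
      Complex.exp (Complex.I * sqrtUp (conj w) * x) := by
  rw [← Complex.exp_conj, sqrtUp_conj hw]
  simp

theorem greenP_conj {w : ℂ} (hw : ∀ r : ℝ, 0 ≤ r → w ≠ r) (p : Fin 2) (x : ℝ) :
    conj (greenP p w x) = greenP p (conj w) x := by
  fin_cases p
  · simp only [greenP, Fin.zero_eta, if_true, green]
    rw [map_div₀, map_mul, map_mul, conj_exp_sqrtUp hw, sqrtUp_conj hw, Complex.conj_I]
    simp only [map_ofNat, neg_mul, mul_neg, div_neg, neg_div]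
  · simp only [greenP, Fin.mk_one, one_ne_zero, if_false, greenDeriv]
    rw [map_div₀, map_mul, conj_exp_sqrtUp hw, map_ofNat]
    simp

theorem green_neg (w : ℂ) (x : ℝ) : green w (-x) = green w x := by simp [green]

theorem greenDeriv_neg (w : ℂ) (x : ℝ) : greenDeriv w (-x) = -greenDeriv w x := by
  simp only [greenDeriv, abs_neg, Real.sign_neg, Complex.ofReal_neg]
  ring

theorem greenP_neg (p : Fin 2) (w : ℂ) (x : ℝ) :
    greenP p w (-x) = (-1) ^ (p : ℕ) * greenP p w x := by
  fin_cases p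
  · simp [greenP, green_neg]
  · simp [greenP, greenDeriv_neg]

theorem hasDerivAt_exp_mul (c : ℂ) (x : ℝ) :
    HasDerivAt (fun x : ℝ => Complex.exp (c * x)) (c * Complex.exp (c * x)) x := by
  have h : HasDerivAt (fun x : ℝ => c * (x : ℂ)) c x := by
    simpa using (Complex.ofRealCLM.hasDerivAt (x := x)).const_mul c
  simpa [mul_comm] using h.cexp

theorem green_eventuallyEq_pos (w : ℂ) {x : ℝ} (hx : 0 < x) :
    (green w =ᶠ[𝓝 x] fun x => Complex.I / (2 * sqrtUp w) * Complex.exp (Complex.I * sqrtUp w * x)) ∧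
      greenDeriv w =ᶠ[𝓝 x] fun x => -1 / 2 * Complex.exp (Complex.I * sqrtUp w * x) := by
  constructor <;> filter_upwards [lt_mem_nhds hx] with t ht
  · rw [green, abs_of_pos ht]
    ring
  · rw [greenDeriv, abs_of_pos ht, Real.sign_of_pos ht]
    push_cast
    ring

theorem green_eventuallyEq_neg (w : ℂ) {x : ℝ} (hx : x < 0) :
    (green w =ᶠ[𝓝 x] fun x =>
      Complex.I / (2 * sqrtUp w) * Complex.exp (-(Complex.I * sqrtUp w) * x)) ∧
      greenDeriv w =ᶠ[𝓝 x] fun x => 1 / 2 * Complex.exp (-(Complex.I * sqrtUp w) * x) := by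
  constructor <;> filter_upwards [gt_mem_nhds hx] with t ht
  · rw [green, abs_of_neg ht]
    push_cast
    ring_nf
  · rw [greenDeriv, abs_of_neg ht, Real.sign_of_neg ht]
    push_cast
    ring_nf

theorem hasDerivAt_green {w : ℂ} (hw : ∀ r : ℝ, 0 ≤ r → w ≠ r) {x : ℝ} (hx : x ≠ 0) :
    HasDerivAt (green w) (greenDeriv w x) x := by
  have h0 := sqrtUp_ne_zero hw
  have hI := Complex.I_mul_I
  rcases lt_or_gt_of_ne hx with h | h
  · obtain ⟨h1, h2⟩ := green_eventuallyEq_neg w h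
    refine (((hasDerivAt_exp_mul _ x).const_mul _).congr_of_eventuallyEq h1).congr_deriv ?_
    rw [h2.self_of_nhds]
    field_simp
    linear_combination (-1) * hI
  · obtain ⟨h1, h2⟩ := green_eventuallyEq_pos w h
    refine (((hasDerivAt_exp_mul _ x).const_mul _).congr_of_eventuallyEq h1).congr_deriv ?_
    rw [h2.self_of_nhds]
    field_simp
    linear_combination hI

theorem hasDerivAt_greenDeriv {w : ℂ} (hw : ∀ r : ℝ, 0 ≤ r → w ≠ r) {x : ℝ} (hx : x ≠ 0) :
    HasDerivAt (greenDeriv w) (-w * green w x) x := by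
  have h0 := sqrtUp_ne_zero hw
  have hs := sqrtUp_sq w
  rcases lt_or_gt_of_ne hx with h | h
  · obtain ⟨h1, h2⟩ := green_eventuallyEq_neg w h
    refine (((hasDerivAt_exp_mul _ x).const_mul _).congr_of_eventuallyEq h2).congr_deriv ?_
    rw [h1.self_of_nhds]
    field_simp
    linear_combination (-1) * hs
  · obtain ⟨h1, h2⟩ := green_eventuallyEq_pos w h
    refine (((hasDerivAt_exp_mul _ x).const_mul _).congr_of_eventuallyEq h2).congr_deriv ?_
    rw [h1.self_of_nhds]
    field_simp
    linear_combination (-1) * hs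

theorem continuous_green (w : ℂ) : Continuous (green w) := by
  unfold green
  fun_prop

theorem isExpKernel_greenP {w : ℂ} (hw : ∀ r : ℝ, 0 ≤ r → w ≠ r) (p : Fin 2) :
    IsExpKernel (greenP p w) := by
  have hs : Measurable Real.sign := by
    unfold Real.sign
    exact Measurable.ite measurableSet_Iio measurable_const
      (Measurable.ite measurableSet_Ioi measurable_const measurable_const)
  have hc : Continuous fun x : ℝ => Complex.exp (Complex.I * sqrtUp w * |x|) := by fun_prop
  have hb := sqrtUp_im_pos hw
  fin_cases p
  · refine ⟨(continuous_green w).measurable, fun x _ => (continuous_green w).continuousAt,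
      ‖Complex.I / (2 * sqrtUp w)‖, (sqrtUp w).im, hb, norm_nonneg _, fun x => le_of_eq ?_⟩
    rw [← norm_exp_sqrtUp, ← norm_mul]
    congr 1
    simp only [greenP, Fin.zero_eta, if_true, green]
    ring
  · refine ⟨((Complex.measurable_ofReal.comp hs).neg.mul hc.measurable).div_const 2,
      fun x hx => (hasDerivAt_greenDeriv hw hx).continuousAt, 1, (sqrtUp w).im, hb, zero_le_one,
      fun x => ?_⟩
    have h1 : ‖(Real.sign x : ℂ)‖ ≤ 1 := by
      rcases Real.sign_apply_eq x with h | h | h <;> simp [h]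
    simp only [greenP, Fin.mk_one, one_ne_zero, if_false, greenDeriv]
    rw [norm_div, norm_mul, norm_neg, norm_exp_sqrtUp, one_mul, Complex.norm_ofNat]
    have := Real.exp_pos (-(sqrtUp w).im * |x|)
    nlinarith

theorem isExpKernel_green {w : ℂ} (hw : ∀ r : ℝ, 0 ≤ r → w ≠ r) : IsExpKernel (green w) :=
  isExpKernel_greenP hw 0

theorem isExpKernel_greenDeriv {w : ℂ} (hw : ∀ r : ℝ, 0 ≤ r → w ≠ r) :
    IsExpKernel (greenDeriv w) :=
  isExpKernel_greenP hw 1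

theorem tendsto_greenDeriv_left (w : ℂ) : Tendsto (greenDeriv w) (𝓝[<] 0) (𝓝 (1 / 2)) := by
  have h : Tendsto (fun x : ℝ => 1 / 2 * Complex.exp (-(Complex.I * sqrtUp w) * x)) (𝓝[<] 0)
      (𝓝 (1 / 2)) := by
    have : Continuous fun x : ℝ => 1 / 2 * Complex.exp (-(Complex.I * sqrtUp w) * x) := by fun_prop
    simpa using (this.tendsto 0).mono_left nhdsWithin_le_nhds
  refine h.congr' ?_
  filter_upwards [self_mem_nhdsWithin] with x hx
  exact (green_eventuallyEq_neg w hx).2.self_of_nhds.symm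

theorem tendsto_greenDeriv_right (w : ℂ) : Tendsto (greenDeriv w) (𝓝[>] 0) (𝓝 (-1 / 2)) := by
  have h : Tendsto (fun x : ℝ => -1 / 2 * Complex.exp (Complex.I * sqrtUp w * x)) (𝓝[>] 0)
      (𝓝 (-1 / 2)) := by
    have : Continuous fun x : ℝ => -1 / 2 * Complex.exp (Complex.I * sqrtUp w * x) := by fun_prop
    simpa using (this.tendsto 0).mono_left nhdsWithin_le_nhds
  refine h.congr' ?_
  filter_upwards [self_mem_nhdsWithin] with x hx
  exact (green_eventuallyEq_pos w hx).2.self_of_nhds.symm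

/-- Integration by parts against a kernel with a jump at `0`. -/
theorem integral_kernel_mul_deriv {u u' : ℝ → ℂ} (hu : IsExpKernel u) (hu' : IsExpKernel u')
    (hd : ∀ x ≠ 0, HasDerivAt u (u' x) x) {a b : ℂ} (ha : Tendsto u (𝓝[<] 0) (𝓝 a))
    (hb : Tendsto u (𝓝[>] 0) (𝓝 b)) {φ : ℝ → ℂ} (h1 : ContDiff ℝ 1 φ) (h2 : HasCompactSupport φ)
    (t : ℝ) :
    ∫ x, u (x - t) * deriv φ x = (a - b) * φ t - ∫ x, u' (x - t) * φ x := by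
  set ψ : ℝ → ℂ := fun x => φ (x + t) with hψ
  have hψd : ∀ x, HasDerivAt ψ (deriv φ (x + t)) x := fun x =>
    (h1.differentiable one_ne_zero (x + t)).hasDerivAt.comp_add_const x t
  have hψc : HasCompactSupport ψ := h2.comp_homeomorph (Homeomorph.addRight t)
  have hψ' : HasCompactSupport fun x => deriv φ (x + t) :=
    h2.deriv.comp_homeomorph (Homeomorph.addRight t)
  have hdc : Continuous fun x => deriv φ (x + t) :=
    (h1.continuous_deriv le_rfl).comp (continuous_add_const t)
  have hc : Continuous ψ := h1.continuous.comp (continuous_add_const t)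
  have i1 : Integrable (u * fun x => deriv φ (x + t)) :=
    hu.memLp.integrable_mul (hdc.memLp_of_hasCompactSupport (p := 2) hψ')
  have i2 : Integrable (u' * ψ) :=
    hu'.memLp.integrable_mul (hc.memLp_of_hasCompactSupport (p := 2) hψc)
  have z : u * ψ =ᶠ[coclosedCompact ℝ] 0 := by
    filter_upwards [hasCompactSupport_iff_eventuallyEq.mp hψc] with x hx
    simp [hx]
  rw [coclosedCompact_eq_cocompact] at z
  have zT : Tendsto (u * ψ) atTop (𝓝 0) :=
    (tendsto_const_nhds (x := (0 : ℂ))).congr' ((z.filter_mono atTop_le_cocompact).symm)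
  have zB : Tendsto (u * ψ) atBot (𝓝 0) :=
    (tendsto_const_nhds (x := (0 : ℂ))).congr' ((z.filter_mono atBot_le_cocompact).symm)
  have e0 : ψ 0 = φ t := by simp [hψ]
  have p1 := integral_Ioi_mul_deriv_eq_deriv_mul (a := (0 : ℝ)) (u := u) (v := ψ) (u' := u')
    (fun x hx => hd x (ne_of_gt hx)) (fun x _ => hψd x) i1.integrableOn i2.integrableOn
    (hb.mul ((hc.tendsto 0).mono_left nhdsWithin_le_nhds)) zT
  have p2 := integral_Iic_mul_deriv_eq_deriv_mul (a := (0 : ℝ)) (u := u) (v := ψ) (u' := u')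
    (fun x hx => hd x (ne_of_lt hx)) (fun x _ => hψd x) i1.integrableOn i2.integrableOn
    (ha.mul ((hc.tendsto 0).mono_left nhdsWithin_le_nhds)) zB
  have q1 := integral_add_right_eq_self (μ := (volume : Measure ℝ))
    (fun x => u (x - t) * deriv φ x) t
  have q2 := integral_add_right_eq_self (μ := (volume : Measure ℝ)) (fun x => u' (x - t) * φ x) t
  simp only [add_sub_cancel_right] at q1 q2
  have s1 := intervalIntegral.integral_Iic_add_Ioi (b := (0 : ℝ)) i1.integrableOn i1.integrableOn
  have s2 := intervalIntegral.integral_Iic_add_Ioi (b := (0 : ℝ)) i2.integrableOn i2.integrableOn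
  simp only [Pi.mul_apply] at s1 s2
  rw [← q1, ← q2, ← s1, ← s2, p1, p2, e0]
  ring

theorem integral_green_mul_deriv {w : ℂ} (hw : ∀ r : ℝ, 0 ≤ r → w ≠ r) {φ : ℝ → ℂ}
    (h1 : ContDiff ℝ 1 φ) (h2 : HasCompactSupport φ) (t : ℝ) :
    ∫ x, green w (x - t) * deriv φ x = -∫ x, greenDeriv w (x - t) * φ x := by
  have hc := (continuous_green w).tendsto 0
  rw [integral_kernel_mul_deriv (isExpKernel_green hw) (isExpKernel_greenDeriv hw)
    (fun x hx => hasDerivAt_green hw hx) (hc.mono_left nhdsWithin_le_nhds)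
    (hc.mono_left nhdsWithin_le_nhds) h1 h2]
  ring

theorem integral_greenDeriv_mul_deriv {w : ℂ} (hw : ∀ r : ℝ, 0 ≤ r → w ≠ r) {φ : ℝ → ℂ}
    (h1 : ContDiff ℝ 1 φ) (h2 : HasCompactSupport φ) (t : ℝ) :
    ∫ x, greenDeriv w (x - t) * deriv φ x = φ t + w * ∫ x, green w (x - t) * φ x := by
  have hk : IsExpKernel fun x => -w * green w x := by
    obtain ⟨hm, hc, C, b, hb, hC, h⟩ := isExpKernel_green hw
    refine ⟨hm.const_mul _, fun x hx => (hc x hx).const_mul _, ‖w‖ * C, b, hb, by positivity,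
      fun x => ?_⟩
    rw [norm_mul, norm_neg, mul_assoc]
    exact mul_le_mul_of_nonneg_left (h x) (norm_nonneg _)
  rw [integral_kernel_mul_deriv (isExpKernel_greenDeriv hw) hk
    (fun x hx => hasDerivAt_greenDeriv hw hx) (tendsto_greenDeriv_left w)
    (tendsto_greenDeriv_right w) h1 h2, ← integral_const_mul, sub_eq_add_neg, ← integral_neg]
  congr 1
  · ring
  · congr 1
    ext x
    ring

/-! ### The free resolvent on the line -/

theorem IsWeakDeriv.mono {Y Y' : Set ℝ} (h : Y ⊆ Y') {f g : L2} (hf : IsWeakDeriv Y f g) :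
    IsWeakDeriv Y' f g :=
  fun φ h1 h2 h3 => hf φ h1 h2 (h3.trans (compl_subset_compl.mpr h))

theorem isWeakDeriv_conv_green {w : ℂ} (hw : ∀ r : ℝ, 0 ≤ r → w ≠ r) (g : L2) :
    IsWeakDeriv ∅ (convL (isExpKernel_green hw) g) (convL (isExpKernel_greenDeriv hw) g) := by
  intro φ h1 h2 _
  have hφ : MemLp φ 2 (volume : Measure ℝ) := h1.continuous.memLp_of_hasCompactSupport h2
  have hφ' : MemLp (deriv φ) 2 (volume : Measure ℝ) :=
    (h1.continuous_deriv (by simp)).memLp_of_hasCompactSupport h2.deriv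
  have e1 : ∫ x, convL (isExpKernel_green hw) g x * deriv φ x =
      ∫ x, conv (green w) g x * deriv φ x := by
    apply integral_congr_ae
    filter_upwards [convL_coeFn (isExpKernel_green hw) g] with x hx
    rw [hx]
  have e2 : ∫ x, convL (isExpKernel_greenDeriv hw) g x * φ x =
      ∫ x, conv (greenDeriv w) g x * φ x := by
    apply integral_congr_ae
    filter_upwards [convL_coeFn (isExpKernel_greenDeriv hw) g] with x hx
    rw [hx]
  rw [e1, e2, (isExpKernel_green hw).integral_conv_mul hφ' (Lp.memLp g),
    (isExpKernel_greenDeriv hw).integral_conv_mul hφ (Lp.memLp g), ← integral_neg]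
  congr 1
  ext t
  rw [integral_green_mul_deriv hw (h1.of_le (by simp)) h2]
  ring

theorem isWeakDeriv_conv_greenDeriv {w : ℂ} (hw : ∀ r : ℝ, 0 ≤ r → w ≠ r) (g : L2) :
    IsWeakDeriv ∅ (convL (isExpKernel_greenDeriv hw) g)
      (-g - w • convL (isExpKernel_green hw) g) := by
  intro φ h1 h2 _
  have hφ : MemLp φ 2 (volume : Measure ℝ) := h1.continuous.memLp_of_hasCompactSupport h2
  have hφ' : MemLp (deriv φ) 2 (volume : Measure ℝ) :=
    (h1.continuous_deriv (by simp)).memLp_of_hasCompactSupport h2.deriv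
  have hk := isExpKernel_green hw
  have e1 : ∫ x, convL (isExpKernel_greenDeriv hw) g x * deriv φ x =
      ∫ x, conv (greenDeriv w) g x * deriv φ x := by
    apply integral_congr_ae
    filter_upwards [convL_coeFn (isExpKernel_greenDeriv hw) g] with x hx
    rw [hx]
  have e2 : ∫ x, (-g - w • convL hk g) x * φ x =
      ∫ x, (-(g x * φ x) - w * (conv (green w) g x * φ x)) := by
    apply integral_congr_ae
    filter_upwards [convL_coeFn hk g, Lp.coeFn_sub (-g) (w • convL hk g), Lp.coeFn_neg g,
      Lp.coeFn_smul w (convL hk g)] with x hx h3 h4 h5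
    rw [h3, Pi.sub_apply, h4, h5, Pi.neg_apply, Pi.smul_apply, hx, smul_eq_mul]
    ring
  have i1 : Integrable fun x => g x * φ x := (Lp.memLp g).integrable_mul hφ
  have i1' : Integrable fun x => -(g x * φ x) := i1.neg
  have i2 : Integrable fun x => conv (green w) g x * φ x :=
    (hk.memLp_conv (Lp.memLp g)).integrable_mul hφ
  have i3 : Integrable fun t => g t * ∫ x, green w (x - t) * φ x := by
    refine (Lp.memLp g).integrable_mul ((hk.memLp_conv hφ).congr_norm ?_ ?_)
    · refine ((hk.continuous_conv hφ).congr fun t => ?_).aestronglyMeasurable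
      simp only [conv]
      congr 1
      ext x
      rw [← green_neg, neg_sub]
    · refine Eventually.of_forall fun t => ?_
      simp only [conv]
      congr 2
      ext x
      rw [← green_neg, neg_sub]
  rw [e1, e2, (isExpKernel_greenDeriv hw).integral_conv_mul hφ' (Lp.memLp g),
    integral_sub i1' (i2.const_mul w), integral_const_mul, integral_neg,
    hk.integral_conv_mul hφ (Lp.memLp g), neg_sub, sub_neg_eq_add, ← integral_const_mul,
    ← integral_add (i3.const_mul w) i1]
  congr 1
  ext t
  rw [integral_greenDeriv_mul_deriv hw (h1.of_le (by simp)) h2]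
  ring

theorem toL2_coeFn {g : ℝ → ℂ} (h : MemLp g 2 (volume : Measure ℝ)) : toL2 g =ᵐ[volume] g := by
  rw [toL2, dif_pos h]
  exact h.coeFn_toLp

/-- The functions `(G^w)^{(p)}(· - c)` as elements of `L²(ℝ)`. -/
def greenL (p : Fin 2) (w : ℂ) (c : ℝ) : L2 := toL2 fun x => greenP p w (x - c)

theorem greenL_coeFn {w : ℂ} (hw : ∀ r : ℝ, 0 ≤ r → w ≠ r) (p : Fin 2) (c : ℝ) :
    greenL p w c =ᵐ[volume] fun x => greenP p w (x - c) :=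
  toL2_coeFn (memLp_greenP hw p c)

theorem isWeakDeriv_greenL_zero {w : ℂ} (hw : ∀ r : ℝ, 0 ≤ r → w ≠ r) (Y : Set ℝ) (c : ℝ) :
    IsWeakDeriv Y (greenL 0 w c) (greenL 1 w c) := by
  intro φ h1 h2 _
  have h := integral_green_mul_deriv hw (h1.of_le (by simp)) h2 c
  refine Eq.trans (integral_congr_ae ?_) (h.trans (congrArg _ (integral_congr_ae ?_)))
  · filter_upwards [greenL_coeFn hw 0 c] with x hx
    rw [hx]
    rfl
  · filter_upwards [greenL_coeFn hw 1 c] with x hx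
    rw [hx]
    rfl

theorem isWeakDeriv_greenL_one {w : ℂ} (hw : ∀ r : ℝ, 0 ≤ r → w ≠ r) {Y : Set ℝ} {c : ℝ}
    (hc : c ∈ Y) : IsWeakDeriv Y (greenL 1 w c) (-w • greenL 0 w c) := by
  intro φ h1 h2 h3
  have h := integral_greenDeriv_mul_deriv hw (h1.of_le (by simp)) h2 c
  have h0 : φ c = 0 := image_eq_zero_of_notMem_tsupport fun hm => h3 hm hc
  rw [h0, zero_add, ← integral_const_mul] at h
  rw [← integral_neg]
  refine Eq.trans (integral_congr_ae ?_) (h.trans (integral_congr_ae ?_))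
  · filter_upwards [greenL_coeFn hw 1 c] with x hx
    rw [hx]
    rfl
  · filter_upwards [greenL_coeFn hw 0 c, Lp.coeFn_smul (-w) (greenL 0 w c)] with x hx hx'
    rw [hx', Pi.smul_apply, hx]
    simp only [greenP, if_true, smul_eq_mul]
    ring

/-! ### The defect space of the Laplacian on the line minus a finite set -/

/-- The space of test functions on `ℝ ∖ Y`, as a space of functions. -/
def testFun (Y : Set ℝ) : Submodule ℂ (ℝ → ℂ) where
  carrier := {φ | ContDiff ℝ ∞ φ ∧ HasCompactSupport φ ∧ tsupport φ ⊆ Yᶜ}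
  zero_mem' := ⟨contDiff_const, HasCompactSupport.zero, by simp [tsupport]⟩
  add_mem' := by
    rintro φ ψ ⟨h1, h2, h3⟩ ⟨k1, k2, k3⟩
    exact ⟨h1.add k1, h2.add k2, (tsupport_add φ ψ).trans (union_subset h3 k3)⟩
  smul_mem' := by
    rintro c φ ⟨h1, h2, h3⟩
    exact ⟨contDiff_const.smul h1, h2.smul_left (f := fun _ => c),
      (tsupport_smul_subset_right (fun _ => c) φ).trans h3⟩

/-- The distribution on `ℝ ∖ Y` given by a square integrable function. -/
def distrib (Y : Set ℝ) : L2 →ₗ[ℂ] Module.Dual ℂ (testFun Y) where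
  toFun f :=
    { toFun := fun φ => ∫ x, f x * (φ : ℝ → ℂ) x
      map_add' := fun φ ψ => by
        rw [← integral_add (integrable_mul_test f φ.2.1.continuous φ.2.2.1)
          (integrable_mul_test f ψ.2.1.continuous ψ.2.2.1)]
        congr 1
        ext x
        simp [mul_add]
      map_smul' := fun c φ => by
        rw [RingHom.id_apply, smul_eq_mul, ← integral_const_mul]
        congr 1
        ext x
        simp
        ring }
  map_add' f g := by
    ext φ
    simp only [LinearMap.coe_mk, AddHom.coe_mk, LinearMap.add_apply]
    rw [← integral_add (integrable_mul_test f φ.2.1.continuous φ.2.2.1)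
      (integrable_mul_test g φ.2.1.continuous φ.2.2.1)]
    apply integral_congr_ae
    filter_upwards [Lp.coeFn_add f g] with x hx
    rw [hx, Pi.add_apply, add_mul]
  map_smul' c f := by
    ext φ
    simp only [LinearMap.coe_mk, AddHom.coe_mk, LinearMap.smul_apply, RingHom.id_apply, smul_eq_mul]
    rw [← integral_const_mul]
    apply integral_congr_ae
    filter_upwards [Lp.coeFn_smul c f] with x hx
    rw [hx, Pi.smul_apply, smul_eq_mul, mul_assoc]

theorem distrib_apply {Y : Set ℝ} (f : L2) (φ : testFun Y) :
    distrib Y f φ = ∫ x, f x * (φ : ℝ → ℂ) x := rfl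

theorem distrib_injective {Y : Set ℝ} (hY : Y.Finite) : Function.Injective (distrib Y) := by
  rw [injective_iff_map_eq_zero]
  intro f hf
  have key := hY.isClosed.isOpen_compl.ae_eq_zero_of_integral_contDiff_smul_eq_zero
    (((Lp.memLp f).locallyIntegrable one_le_two).locallyIntegrableOn Yᶜ) (fun φ h1 h2 h3 => by
      have hφ : ContDiff ℝ ∞ (fun x => (φ x : ℂ)) := Complex.ofRealCLM.contDiff.comp h1
      have hc : HasCompactSupport (fun x => (φ x : ℂ)) :=
        h2.comp_left (g := fun r : ℝ => (r : ℂ)) (by simp)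
      have hs : tsupport (fun x => (φ x : ℂ)) ⊆ Yᶜ :=
        (closure_mono (Function.support_comp_subset (g := fun r : ℝ => (r : ℂ)) (by simp) φ)).trans
          h3
      have e := LinearMap.congr_fun hf ⟨_, hφ, hc, hs⟩
      rw [distrib_apply] at e
      refine Eq.trans (congrArg _ (funext fun x => ?_)) e
      simp [mul_comm])
  apply Lp.ext
  have hn : ∀ᵐ x ∂(volume : Measure ℝ), x ∈ Yᶜ := compl_mem_ae_iff.mpr (hY.measure_zero volume)
  filter_upwards [key, hn, Lp.coeFn_zero ℂ 2 (volume : Measure ℝ)] with x hx hx' h0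
  rw [hx hx', h0, Pi.zero_apply]

theorem conv_green_eq (w : ℂ) (θ : ℝ → ℂ) (x : ℝ) :
    conv (green w) θ x = ∫ t, green w (t - x) * θ t := by
  unfold conv
  congr 1
  ext t
  rw [← green_neg, neg_sub]

theorem conv_greenDeriv_eq (w : ℂ) (θ : ℝ → ℂ) (x : ℝ) :
    conv (greenDeriv w) θ x = -∫ t, greenDeriv w (t - x) * θ t := by
  rw [← integral_neg, conv]
  congr 1
  ext t
  rw [← neg_sub, greenDeriv_neg, neg_mul]

theorem conv_green_eq_convolution (w : ℂ) (θ : ℝ → ℂ) :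
    conv (green w) θ = convolution (green w) θ (ContinuousLinearMap.mul ℝ ℂ) volume := by
  ext x
  rw [conv, convolution, ← integral_sub_left_eq_self _ volume x]
  simp

section Smooth

variable {w : ℂ} (hw : ∀ r : ℝ, 0 ≤ r → w ≠ r) {θ : ℝ → ℂ} (h1 : ContDiff ℝ ∞ θ)
  (h2 : HasCompactSupport θ)
include hw h1 h2

theorem contDiff_conv_green : ContDiff ℝ ∞ (conv (green w) θ) := by
  rw [conv_green_eq_convolution]
  exact h2.contDiff_convolution_right (n := ⊤) _ (isExpKernel_green hw).integrable.locallyIntegrable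
    h1

theorem hasDerivAt_conv_green (x : ℝ) :
    HasDerivAt (conv (green w) θ) (conv (greenDeriv w) θ x) x := by
  have h := h2.hasDerivAt_convolution_right (ContinuousLinearMap.mul ℝ ℂ)
    (isExpKernel_green hw).integrable.locallyIntegrable (μ := volume) (h1.of_le (by simp)) x
  rw [← conv_green_eq_convolution, ← conv_green_eq_convolution, conv_green_eq,
    integral_green_mul_deriv hw (h1.of_le (by simp)) h2, ← conv_greenDeriv_eq] at h
  exact h

theorem hasDerivAt_conv_greenDeriv (x : ℝ) :
    HasDerivAt (conv (greenDeriv w) θ) (-θ x - w * conv (green w) θ x) x := by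
  have e : conv (greenDeriv w) θ = conv (green w) (deriv θ) := by
    ext x
    rw [conv_green_eq, integral_green_mul_deriv hw (h1.of_le (by simp)) h2, conv_greenDeriv_eq]
  have h := hasDerivAt_conv_green hw (contDiff_infty_iff_deriv.mp h1).2 h2.deriv x
  rw [← e, conv_greenDeriv_eq, integral_greenDeriv_mul_deriv hw (h1.of_le (by simp)) h2,
    ← conv_green_eq] at h
  exact h.congr_deriv (by ring)

end Smooth

/-- Uniqueness for the equation `U'' = -k² U`, by factorization into first order equations. -/
theorem eq_zero_of_second_order {U U' : ℝ → ℂ} {k : ℂ} {y ε : ℝ} (hε : 0 < ε)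
    (hU : ∀ x ∈ Metric.ball y ε, HasDerivAt U (U' x) x)
    (hU' : ∀ x ∈ Metric.ball y ε, HasDerivAt U' (-k ^ 2 * U x) x) (h0 : U y = 0) (h0' : U' y = 0) :
    ∀ x ∈ Metric.ball y ε, U x = 0 := by
  have hy : y ∈ Metric.ball y ε := Metric.mem_ball_self hε
  have hc : IsPreconnected (Metric.ball y ε) := (convex_ball y ε).isPreconnected
  have hI := Complex.I_sq
  have const : ∀ F : ℝ → ℂ, (∀ x ∈ Metric.ball y ε, HasDerivAt F 0 x) → F y = 0 →
      ∀ x ∈ Metric.ball y ε, F x = 0 := fun F hF hF0 x hx => by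
    rw [← hF0]
    exact Metric.isOpen_ball.is_const_of_deriv_eq_zero hc
      (fun t ht => (hF t ht).differentiableAt.differentiableWithinAt)
      (fun t ht => (hF t ht).deriv) hx hy
  have first : ∀ x ∈ Metric.ball y ε, U' x = Complex.I * k * U x := fun x hx => by
    have hF : ∀ t ∈ Metric.ball y ε,
        HasDerivAt (fun x => (U' x - Complex.I * k * U x) * Complex.exp (Complex.I * k * x)) 0 t :=
      fun t ht => by
        have h1 : HasDerivAt (fun x => U' x - Complex.I * k * U x)
          (-k ^ 2 * U t - Complex.I * k * U' t) t := (hU' t ht).sub ((hU t ht).const_mul _)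
        refine (h1.mul (hasDerivAt_exp_mul _ t)).congr_deriv ?_
        linear_combination (-k ^ 2 * U t * Complex.exp (Complex.I * k * t)) * hI
    have := const _ hF (by simp [h0, h0']) x hx
    rcases mul_eq_zero.mp this with h | h
    · exact sub_eq_zero.mp h
    · exact absurd h (Complex.exp_ne_zero _)
  intro x hx
  have := const (fun x => U x * Complex.exp (-(Complex.I * k) * x))
    (fun t ht => ((hU t ht).mul (hasDerivAt_exp_mul _ t)).congr_deriv (by
      rw [first t ht]
      ring)) (by simp [h0]) x hx
  exact (mul_eq_zero.mp this).resolve_right (Complex.exp_ne_zero _)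

/-- If `φ` is smooth, vanishes near `Y`, and is square integrable together with its first two
derivatives, then it may be used as a test function in the equation `h'' + w h = 0`. -/
theorem integral_mul_eq_zero_of_cutoff {Y : Set ℝ} {w : ℂ} {h : L2}
    (hh : ∀ φ ∈ testFun Y, ∫ x, h x * (deriv (deriv φ) x + w * φ x) = 0)
    {φ φ' φ'' : ℝ → ℂ} (hφ : ContDiff ℝ ∞ φ) (hd : ∀ x, HasDerivAt φ (φ' x) x)
    (hd' : ∀ x, HasDerivAt φ' (φ'' x) x) (hY : tsupport φ ⊆ Yᶜ)
    (m : MemLp φ 2 (volume : Measure ℝ)) (m' : MemLp φ' 2 (volume : Measure ℝ))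
    (m'' : MemLp φ'' 2 (volume : Measure ℝ)) :
    ∫ x, h x * (φ'' x + w * φ x) = 0 := by
  let χ : ContDiffBump (0 : ℝ) := ⟨1, 2, one_pos, one_lt_two⟩
  let c : ℝ → ℂ := fun x => (χ x : ℂ)
  have c1 : ContDiff ℝ ∞ c := Complex.ofRealCLM.contDiff.comp χ.contDiff
  have c2 : HasCompactSupport c := χ.hasCompactSupport.comp_left (g := fun r : ℝ => (r : ℂ)) (by simp)
  have c1' : ContDiff ℝ ∞ (deriv c) := (contDiff_infty_iff_deriv.mp c1).2
  have c1'' : ContDiff ℝ ∞ (deriv (deriv c)) := (contDiff_infty_iff_deriv.mp c1').2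
  obtain ⟨C0, hC0⟩ := c2.exists_bound_of_continuous c1.continuous
  obtain ⟨C1, hC1⟩ := c2.deriv.exists_bound_of_continuous c1'.continuous
  obtain ⟨C2, hC2⟩ := c2.deriv.deriv.exists_bound_of_continuous c1''.continuous
  have hc0 : c 0 = 1 := by
    have : χ 0 = 1 := χ.one_of_mem_closedBall (by simp [χ.rIn_pos.le])
    simp [c, this]
  have hsc : ∀ {f : ℝ → ℂ}, ContDiff ℝ ∞ f → ∀ ε x : ℝ,
      HasDerivAt (fun x => f (ε * x)) ((ε : ℂ) * deriv f (ε * x)) x := fun {f} hf ε x => by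
    have h1 : HasDerivAt (fun x : ℝ => ε * x) ε x := by simpa using (hasDerivAt_id x).const_mul ε
    have h2 := (hf.differentiable (by simp) (ε * x)).hasDerivAt.scomp x h1
    rw [Complex.real_smul] at h2
    exact h2
  let ψ : ℝ → ℝ → ℂ := fun ε x => c (ε * x) * φ x
  have dψ : ∀ ε, deriv (ψ ε) = fun x => ε * deriv c (ε * x) * φ x + c (ε * x) * φ' x :=
    fun ε => funext fun x => ((hsc c1 ε x).mul (hd x)).deriv
  have ddψ : ∀ ε, deriv (deriv (ψ ε)) = fun x => ε ^ 2 * deriv (deriv c) (ε * x) * φ x +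
      2 * ε * deriv c (ε * x) * φ' x + c (ε * x) * φ'' x := fun ε => by
    rw [dψ]
    refine funext fun x => HasDerivAt.deriv ?_
    refine (((((hsc c1' ε x).const_mul (ε : ℂ)).mul (hd x))).add
      ((hsc c1 ε x).mul (hd' x))).congr_deriv ?_
    ring
  let F : ℝ → ℝ → ℂ := fun ε x => h x * (deriv (deriv (ψ ε)) x + w * ψ ε x)
  have hF : ∀ ε ≠ 0, ∫ x, F ε x = 0 := fun ε hε => by
    refine hh (ψ ε) ⟨?_, ?_, ?_⟩
    · exact (c1.comp (contDiff_const.mul contDiff_id)).mul hφ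
    · exact HasCompactSupport.mul_right
        (c2.comp_homeomorph (Homeomorph.mulLeft₀ ε hε))
    · exact (tsupport_mul_subset_right).trans hY
  have hb : Integrable fun x => ‖h x‖ * (C2 * ‖φ x‖ + 2 * C1 * ‖φ' x‖ + C0 * ‖φ'' x‖ +
      ‖w‖ * C0 * ‖φ x‖) := by
    have n := (Lp.memLp h).norm
    have : MemLp (fun x => C2 * ‖φ x‖ + 2 * C1 * ‖φ' x‖ + C0 * ‖φ'' x‖ +
      ‖w‖ * C0 * ‖φ x‖) 2 (volume : Measure ℝ) :=
      (((m.norm.const_mul C2).add (m'.norm.const_mul (2 * C1))).add (m''.norm.const_mul C0)).add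
        (m.norm.const_mul (‖w‖ * C0))
    exact n.integrable_mul this
  have lim : Tendsto (fun ε => ∫ x, F ε x) (𝓝[>] 0) (𝓝 (∫ x, h x * (φ'' x + w * φ x))) := by
    refine tendsto_integral_filter_of_dominated_convergence _ ?_ ?_ hb ?_
    · refine Eventually.of_forall fun ε => (Lp.aestronglyMeasurable h).mul ?_
      simp only [ddψ, ψ]
      have q0 : Continuous fun x => c (ε * x) := c1.continuous.comp (continuous_const_mul ε)
      have q1 : Continuous fun x => deriv c (ε * x) := c1'.continuous.comp (continuous_const_mul ε)
      have q2 : Continuous fun x => deriv (deriv c) (ε * x) :=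
        c1''.continuous.comp (continuous_const_mul ε)
      exact ((((continuous_const.mul q2).aestronglyMeasurable.mul m.1).add
        ((continuous_const.mul q1).aestronglyMeasurable.mul m'.1)).add
        (q0.aestronglyMeasurable.mul m''.1)).add
        (aestronglyMeasurable_const.mul (q0.aestronglyMeasurable.mul m.1))
    · have : Ioo (0 : ℝ) 1 ∈ 𝓝[>] (0 : ℝ) := Ioo_mem_nhdsGT one_pos
      filter_upwards [this] with ε hε
      refine Eventually.of_forall fun x => ?_
      simp only [F, ddψ, ψ]
      rw [norm_mul]
      refine mul_le_mul_of_nonneg_left ?_ (norm_nonneg _)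
      refine (norm_add_le _ _).trans (add_le_add ((norm_add_le _ _).trans (add_le_add
        ((norm_add_le _ _).trans (add_le_add ?_ ?_)) ?_)) ?_)
      · rw [norm_mul, norm_mul]
        refine mul_le_mul_of_nonneg_right ?_ (norm_nonneg _)
        rw [norm_pow, Complex.norm_real, Real.norm_of_nonneg hε.1.le]
        exact (mul_le_of_le_one_left (norm_nonneg _) (pow_le_one₀ hε.1.le hε.2.le)).trans (hC2 _)
      · rw [norm_mul, norm_mul, norm_mul, Complex.norm_real, Real.norm_of_nonneg hε.1.le,
          Complex.norm_ofNat]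
        refine mul_le_mul_of_nonneg_right ?_ (norm_nonneg _)
        have := hC1 (ε * x)
        have h0 := norm_nonneg (deriv c (ε * x))
        nlinarith [hε.1, hε.2]
      · rw [norm_mul]
        exact mul_le_mul_of_nonneg_right (hC0 _) (norm_nonneg _)
      · rw [norm_mul, norm_mul, mul_assoc]
        exact mul_le_mul_of_nonneg_left (mul_le_mul_of_nonneg_right (hC0 _) (norm_nonneg _))
          (norm_nonneg _)
    · refine Eventually.of_forall fun x => ?_
      have q0 := c1.continuous
      have q1 := c1'.continuous
      have q2 := c1''.continuous
      have : Continuous fun ε : ℝ => F ε x := by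
        simp only [F, ddψ, ψ]
        fun_prop
      have ht := (this.tendsto 0).mono_left (nhdsWithin_le_nhds (s := Ioi 0))
      convert ht using 2
      simp [F, ddψ, ψ, hc0]
  refine tendsto_nhds_unique lim ((tendsto_const_nhds (x := (0 : ℂ))).congr' ?_)
  filter_upwards [self_mem_nhdsWithin] with ε hε
  exact (hF ε (ne_of_gt hε)).symm

/-- Square integrable solutions of `-h'' = w h` on `ℝ ∖ {y₁, …, y_N}` are combinations of Green's
functions and their derivatives with poles at the `y_j`. A test function `θ` annihilated by these
has the form `φ'' + w φ` where `φ = -G^w * θ` vanishes near every `y_j`, so `h` annihilates `θ`. -/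
theorem mem_span_greenL {ι : Type*} [Finite ι] (y : ι → ℝ) {w : ℂ}
    (hw : ∀ r : ℝ, 0 ≤ r → w ≠ r) {h : L2}
    (hh : ∀ φ ∈ testFun (range y), ∫ x, h x * (deriv (deriv φ) x + w * φ x) = 0) :
    h ∈ Submodule.span ℂ (range fun i : Fin 2 × ι => greenL i.1 w (y i.2)) := by
  have hY := finite_range y
  rw [← Submodule.apply_mem_span_image_iff_mem_span (distrib_injective hY), ← range_comp]
  refine mem_span_of_iInf_ker_le_ker fun θ hθ => ?_
  obtain ⟨θ, h1, h2, h3⟩ := θ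
  have hθ' : ∀ (p : Fin 2) (j : ι), ∫ x, greenP p w (x - y j) * θ x = 0 := fun p j => by
    have := (Submodule.mem_iInf _).mp hθ (p, j)
    rw [LinearMap.mem_ker, Function.comp_apply, distrib_apply] at this
    rw [← this]
    apply integral_congr_ae
    filter_upwards [greenL_coeFn hw p (y j)] with x hx
    rw [hx]
  have k0 := isExpKernel_green hw
  have k1 := isExpKernel_greenDeriv hw
  have hm : MemLp θ 2 (volume : Measure ℝ) := h1.continuous.memLp_of_hasCompactSupport h2
  have d1 := hasDerivAt_conv_green hw h1 h2
  have d2 := hasDerivAt_conv_greenDeriv hw h1 h2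
  have hs : tsupport (conv (green w) θ) ⊆ (range y)ᶜ := by
    rintro x hx ⟨j, rfl⟩
    have : ∀ᶠ x in 𝓝 (y j), θ x = 0 :=
      notMem_tsupport_iff_eventuallyEq.mp fun hm => h3 hm (mem_range_self j)
    obtain ⟨ε, hε, hb⟩ := Metric.eventually_nhds_iff_ball.mp this
    refine notMem_tsupport_iff_eventuallyEq.mpr ?_ hx
    filter_upwards [Metric.ball_mem_nhds (y j) hε] with x hx
    refine eq_zero_of_second_order (k := sqrtUp w) hε (fun x _ => d1 x) (fun x hx => ?_) ?_ ?_ x hx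
    · refine (d2 x).congr_deriv ?_
      rw [hb x hx, sqrtUp_sq]
      ring
    · rw [conv_green_eq]
      exact hθ' 0 j
    · rw [conv_greenDeriv_eq, neg_eq_zero]
      exact hθ' 1 j
  have m0 := k0.memLp_conv hm
  have key := integral_mul_eq_zero_of_cutoff hh (contDiff_conv_green hw h1 h2) d1 d2 hs m0
    (k1.memLp_conv hm) (hm.neg.sub (m0.const_mul w))
  rw [LinearMap.mem_ker, distrib_apply, ← neg_eq_zero, ← integral_neg, ← key]
  congr 1
  ext x
  ring

/-! ### One-sided traces -/

theorem nhdsLT_inf_ae_neBot (y : ℝ) : (𝓝[<] y ⊓ ae (volume : Measure ℝ)).NeBot := by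
  rw [inf_neBot_iff]
  intro s hs t ht
  obtain ⟨a, ha, h⟩ := mem_nhdsLT_iff_exists_Ioo_subset.mp hs
  by_contra hne
  have hsub : Ioo a y ⊆ tᶜ := fun x hx hxt => hne ⟨x, h hx, hxt⟩
  have := measure_mono_null hsub (mem_ae_iff.mp ht)
  rw [Real.volume_Ioo, ENNReal.ofReal_eq_zero] at this
  exact absurd (mem_Iio.mp ha) (by linarith)

theorem nhdsGT_inf_ae_neBot (y : ℝ) : (𝓝[>] y ⊓ ae (volume : Measure ℝ)).NeBot := by
  rw [inf_neBot_iff]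
  intro s hs t ht
  obtain ⟨a, ha, h⟩ := mem_nhdsGT_iff_exists_Ioo_subset.mp hs
  by_contra hne
  have hsub : Ioo y a ⊆ tᶜ := fun x hx hxt => hne ⟨x, h hx, hxt⟩
  have := measure_mono_null hsub (mem_ae_iff.mp ht)
  rw [Real.volume_Ioo, ENNReal.ofReal_eq_zero] at this
  exact absurd (mem_Ioi.mp ha) (by linarith)

/-- Limits along `𝓝[<] y_j ⊓ ae volume` are unique because one-sided neighbourhoods have positive
measure. -/
theorem HasBoundaryValues.unique {N : ℕ} {y : Fin N → ℝ} {Ψ : State N} {L R L' R' : Idx N → ℂ}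
    (h : HasBoundaryValues y Ψ L R) (h' : HasBoundaryValues y Ψ L' R') : L = L' ∧ R = R' := by
  constructor <;> ext ⟨p, j, σ⟩
  · have := nhdsLT_inf_ae_neBot (y j)
    exact tendsto_nhds_unique (h p j σ).1 (h' p j σ).1
  · have := nhdsGT_inf_ae_neBot (y j)
    exact tendsto_nhds_unique (h p j σ).2 (h' p j σ).2

theorem tendsto_trace_of_ae_eq {l : Filter ℝ} {f : L2} {U : ℝ → ℂ} {a : ℂ}
    (hf : f =ᵐ[volume] U) (hU : Tendsto U l (𝓝 a)) : Tendsto f (l ⊓ ae volume) (𝓝 a) :=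
  (hU.mono_left inf_le_left).congr' (hf.symm.filter_mono inf_le_right)

theorem tendsto_trace_sum {ι : Type*} (s : Finset ι) {l : Filter ℝ} {f : ι → L2} {a : ι → ℂ}
    (hf : ∀ i ∈ s, Tendsto (f i) (l ⊓ ae volume) (𝓝 (a i))) :
    Tendsto (∑ i ∈ s, f i : L2) (l ⊓ ae volume) (𝓝 (∑ i ∈ s, a i)) := by
  classical
  induction s using Finset.induction_on with
  | empty => simpa using tendsto_trace_zero l
  | insert i s hi ih =>
    rw [Finset.sum_insert hi, Finset.sum_insert hi]
    exact tendsto_trace_add (hf i (Finset.mem_insert_self i s))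
      (ih fun j hj => hf j (Finset.mem_insert_of_mem hj))

theorem IsWeakDeriv.sum {Y : Set ℝ} {ι : Type*} (s : Finset ι) {f g : ι → L2}
    (h : ∀ i ∈ s, IsWeakDeriv Y (f i) (g i)) : IsWeakDeriv Y (∑ i ∈ s, f i) (∑ i ∈ s, g i) := by
  classical
  induction s using Finset.induction_on with
  | empty => simpa using isWeakDeriv_zero Y
  | insert i s hi ih =>
    rw [Finset.sum_insert hi, Finset.sum_insert hi]
    exact (h i (Finset.mem_insert_self i s)).add (ih fun j hj => h j (Finset.mem_insert_of_mem hj))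

theorem hasTrace_convL {k : ℝ → ℂ} (hk : IsExpKernel k) (g : L2) (y : ℝ) :
    HasLeftTrace (convL hk g) y (conv k g y) ∧ HasRightTrace (convL hk g) y (conv k g y) := by
  have hc := (hk.continuous_conv (Lp.memLp g)).tendsto y
  exact ⟨tendsto_trace_of_ae_eq (convL_coeFn hk g) (hc.mono_left nhdsWithin_le_nhds),
    tendsto_trace_of_ae_eq (convL_coeFn hk g) (hc.mono_left nhdsWithin_le_nhds)⟩

theorem hasTrace_greenL_zero {w : ℂ} (hw : ∀ r : ℝ, 0 ≤ r → w ≠ r) (c y : ℝ) :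
    HasLeftTrace (greenL 0 w c) y (green w (y - c)) ∧
      HasRightTrace (greenL 0 w c) y (green w (y - c)) := by
  have hc := ((continuous_green w).comp (continuous_sub_right c)).tendsto y
  exact ⟨tendsto_trace_of_ae_eq (greenL_coeFn hw 0 c) (hc.mono_left nhdsWithin_le_nhds),
    tendsto_trace_of_ae_eq (greenL_coeFn hw 0 c) (hc.mono_left nhdsWithin_le_nhds)⟩

theorem greenDeriv_zero (w : ℂ) : greenDeriv w 0 = 0 := by simp [greenDeriv]

/-- The unit jump at the pole is split symmetrically, `greenDeriv w 0 = 0` being the mean of the two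
one-sided limits. -/
theorem hasTrace_greenL_one {w : ℂ} (hw : ∀ r : ℝ, 0 ≤ r → w ≠ r) (c y : ℝ) :
    HasLeftTrace (greenL 1 w c) y (greenDeriv w (y - c) + if y = c then 1 / 2 else 0) ∧
      HasRightTrace (greenL 1 w c) y (greenDeriv w (y - c) + if y = c then -1 / 2 else 0) := by
  by_cases h : y = c
  · subst h
    simp only [sub_self, greenDeriv_zero, if_true, zero_add]
    have hs : Tendsto (fun x => x - y) (𝓝 y) (𝓝 0) := by
      simpa using (continuous_sub_right y).tendsto y
    constructor
    · refine tendsto_trace_of_ae_eq (greenL_coeFn hw 1 y) ((tendsto_greenDeriv_left w).comp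
        (tendsto_nhdsWithin_iff.mpr ⟨hs.mono_left nhdsWithin_le_nhds, ?_⟩))
      filter_upwards [self_mem_nhdsWithin] with x hx
      exact sub_neg.mpr (mem_Iio.mp hx)
    · refine tendsto_trace_of_ae_eq (greenL_coeFn hw 1 y) ((tendsto_greenDeriv_right w).comp
        (tendsto_nhdsWithin_iff.mpr ⟨hs.mono_left nhdsWithin_le_nhds, ?_⟩))
      filter_upwards [self_mem_nhdsWithin] with x hx
      exact sub_pos.mpr (mem_Ioi.mp hx)
  · simp only [h, if_false, add_zero]
    have hc : Tendsto (fun x => greenDeriv w (x - c)) (𝓝 y) (𝓝 (greenDeriv w (y - c))) :=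
      ContinuousAt.comp (f := fun x : ℝ => x - c)
        (hasDerivAt_greenDeriv hw (sub_ne_zero.mpr h)).continuousAt (by fun_prop)
    exact ⟨tendsto_trace_of_ae_eq (greenL_coeFn hw 1 c) (hc.mono_left nhdsWithin_le_nhds),
      tendsto_trace_of_ae_eq (greenL_coeFn hw 1 c) (hc.mono_left nhdsWithin_le_nhds)⟩

/-! ### Functions of the form `(-Δ - w)⁻¹ g + ∑ c_{pj} (G^w)^{(p)}(· - y_j)` -/

section Scalar

variable {N : ℕ} {y : Fin N → ℝ} {w : ℂ} (hw : ∀ r : ℝ, 0 ≤ r → w ≠ r)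

variable (y) in
/-- The function `(-Δ - w)⁻¹ g + ∑ c_{pj} (G^w)^{(p)}(· - y_j)`. -/
def kreinFun (c : Fin 2 → Fin N → ℂ) (g : L2) : L2 :=
  convL (isExpKernel_green hw) g +
    ∑ j, (c 0 j • greenL 0 w (y j) + c 1 j • greenL 1 w (y j))

variable (y) in
/-- The first weak derivative of `kreinFun` off the poles. -/
def kreinFunDeriv (c : Fin 2 → Fin N → ℂ) (g : L2) : L2 :=
  convL (isExpKernel_greenDeriv hw) g +
    ∑ j, (c 1 j • (-w • greenL 0 w (y j)) + c 0 j • greenL 1 w (y j))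

theorem isWeakDeriv_kreinFun (c : Fin 2 → Fin N → ℂ) (g : L2) :
    IsWeakDeriv (range y) (kreinFun y hw c g) (kreinFunDeriv y hw c g) := by
  refine ((isWeakDeriv_conv_green hw g).mono (empty_subset _)).add (IsWeakDeriv.sum _ fun j _ => ?_)
  rw [add_comm (c 1 j • _)]
  exact ((isWeakDeriv_greenL_zero hw _ (y j)).smul _).add
    ((isWeakDeriv_greenL_one hw (mem_range_self j)).smul _)

theorem isWeakDeriv_kreinFunDeriv (c : Fin 2 → Fin N → ℂ) (g : L2) :
    IsWeakDeriv (range y) (kreinFunDeriv y hw c g) (-g - w • kreinFun y hw c g) := by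
  have h : -g - w • kreinFun y hw c g = (-g - w • convL (isExpKernel_green hw) g) +
      ∑ j, (c 1 j • (-w • greenL 1 w (y j)) + c 0 j • (-w • greenL 0 w (y j))) := by
    simp only [kreinFun, smul_add, Finset.smul_sum, neg_smul, smul_neg]
    rw [sub_add_eq_sub_sub, sub_eq_add_neg _ (Finset.sum _ _), ← Finset.sum_neg_distrib]
    congr 1
    refine Finset.sum_congr rfl fun j _ => ?_
    rw [neg_add_rev, smul_comm w, smul_comm w]
  rw [h]
  exact ((isWeakDeriv_conv_greenDeriv hw g).mono (empty_subset _)).add (IsWeakDeriv.sum _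
    fun j _ => (((isWeakDeriv_greenL_zero hw _ (y j)).smul _).smul _).add
      ((isWeakDeriv_greenL_one hw (mem_range_self j)).smul _))

variable (y w) in
/-- The mean of the two one-sided limits at `y_j` of `kreinFun` (`p = 0`) and of its derivative
(`p = 1`). -/
def kreinMean (c : Fin 2 → Fin N → ℂ) (g : L2) (p : Fin 2) (j : Fin N) : ℂ :=
  if p = 0 then
    conv (green w) g (y j) +
      ∑ i, (c 0 i * green w (y j - y i) + c 1 i * greenDeriv w (y j - y i))
  else
    conv (greenDeriv w) g (y j) +
      ∑ i, (c 1 i * (-w * green w (y j - y i)) + c 0 i * greenDeriv w (y j - y i))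

theorem sum_add_mul_jump (hy : Function.Injective y) (s : ℂ) (j : Fin N) (a b d : Fin N → ℂ) :
    ∑ i, (a i + b i * (d i + if y j = y i then s else 0)) =
      ∑ i, (a i + b i * d i) + b j * s := by
  simp only [mul_add, ← add_assoc, hy.eq_iff, mul_ite, mul_zero]
  rw [Finset.sum_add_distrib (g := fun i => ite _ _ _), Finset.sum_ite_eq]
  simp

theorem hasTrace_kreinFun (hy : Function.Injective y) (c : Fin 2 → Fin N → ℂ) (g : L2)
    (j : Fin N) :
    HasLeftTrace (kreinFun y hw c g) (y j) (kreinMean y w c g 0 j + c 1 j / 2) ∧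
      HasRightTrace (kreinFun y hw c g) (y j) (kreinMean y w c g 0 j - c 1 j / 2) := by
  have e (s : ℂ) : kreinMean y w c g 0 j + c 1 j * s = conv (green w) g (y j) +
      ∑ i, (c 0 i • green w (y j - y i) +
        c 1 i • (greenDeriv w (y j - y i) + if y j = y i then s else 0)) := by
    simp only [kreinMean, if_true, smul_eq_mul, sum_add_mul_jump hy, add_assoc]
  rw [show c 1 j / 2 = c 1 j * (1 / 2) by ring, sub_eq_add_neg,
    show -(c 1 j * (1 / 2)) = c 1 j * (-1 / 2) by ring, e, e]
  exact ⟨tendsto_trace_add (hasTrace_convL _ g _).1 (tendsto_trace_sum _ fun i _ =>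
      tendsto_trace_add (tendsto_trace_smul _ (hasTrace_greenL_zero hw _ _).1)
        (tendsto_trace_smul _ (hasTrace_greenL_one hw _ _).1)),
    tendsto_trace_add (hasTrace_convL _ g _).2 (tendsto_trace_sum _ fun i _ =>
      tendsto_trace_add (tendsto_trace_smul _ (hasTrace_greenL_zero hw _ _).2)
        (tendsto_trace_smul _ (hasTrace_greenL_one hw _ _).2))⟩

theorem hasTrace_kreinFunDeriv (hy : Function.Injective y) (c : Fin 2 → Fin N → ℂ) (g : L2)
    (j : Fin N) :
    HasLeftTrace (kreinFunDeriv y hw c g) (y j) (kreinMean y w c g 1 j + c 0 j / 2) ∧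
      HasRightTrace (kreinFunDeriv y hw c g) (y j) (kreinMean y w c g 1 j - c 0 j / 2) := by
  have e (s : ℂ) : kreinMean y w c g 1 j + c 0 j * s = conv (greenDeriv w) g (y j) +
      ∑ i, (c 1 i • (-w • green w (y j - y i)) +
        c 0 i • (greenDeriv w (y j - y i) + if y j = y i then s else 0)) := by
    simp only [kreinMean, one_ne_zero, if_false, smul_eq_mul, sum_add_mul_jump hy, add_assoc]
  rw [show c 0 j / 2 = c 0 j * (1 / 2) by ring, sub_eq_add_neg,
    show -(c 0 j * (1 / 2)) = c 0 j * (-1 / 2) by ring, e, e]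
  exact ⟨tendsto_trace_add (hasTrace_convL _ g _).1 (tendsto_trace_sum _ fun i _ =>
      tendsto_trace_add (tendsto_trace_smul _ (tendsto_trace_smul _ (hasTrace_greenL_zero hw _ _).1))
        (tendsto_trace_smul _ (hasTrace_greenL_one hw _ _).1)),
    tendsto_trace_add (hasTrace_convL _ g _).2 (tendsto_trace_sum _ fun i _ =>
      tendsto_trace_add (tendsto_trace_smul _ (tendsto_trace_smul _ (hasTrace_greenL_zero hw _ _).2))
        (tendsto_trace_smul _ (hasTrace_greenL_one hw _ _).2))⟩

/-- A square integrable `u` with square integrable second distributional derivative `v` on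
`ℝ ∖ Y` is given by Green's functions; in particular its first derivative is square integrable. -/
theorem exists_eq_kreinFun {u v : L2}
    (h : ∀ φ ∈ testFun (range y), ∫ x, u x * deriv (deriv φ) x = ∫ x, v x * φ x) :
    ∃ c, u = kreinFun y hw c (-v - w • u) := by
  set g := -v - w • u with hg
  have key := mem_span_greenL y hw (h := u - convL (isExpKernel_green hw) g) fun φ hφ => by
    obtain ⟨h1, h2, h3⟩ := hφ
    have k1 : ContDiff ℝ ∞ (deriv φ) := (contDiff_infty_iff_deriv.mp h1).2
    have k2 : ContDiff ℝ ∞ (deriv (deriv φ)) := (contDiff_infty_iff_deriv.mp k1).2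
    set U := convL (isExpKernel_green hw) g
    have a1 := isWeakDeriv_conv_green hw g _ k1 h2.deriv (by simp)
    have a2 := isWeakDeriv_conv_greenDeriv hw g _ h1 h2 (by simp)
    rw [a2, neg_neg] at a1
    have b1 := integrable_mul_test u k2.continuous h2.deriv.deriv
    have b2 := integrable_mul_test U k2.continuous h2.deriv.deriv
    have b3 := integrable_mul_test u h1.continuous h2
    have b4 := integrable_mul_test U h1.continuous h2
    have b5 := integrable_mul_test v h1.continuous h2
    have e1 : ∫ x, (u - U) x * (deriv (deriv φ) x + w * φ x) =
        ∫ x, ((u x * deriv (deriv φ) x - U x * deriv (deriv φ) x) +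
          w * (u x * φ x - U x * φ x)) := by
      apply integral_congr_ae
      filter_upwards [Lp.coeFn_sub u U] with x hx
      rw [hx, Pi.sub_apply]
      ring
    have e2 : ∫ x, (-g - w • U) x * φ x = ∫ x, (v x * φ x + w * (u x * φ x - U x * φ x)) := by
      have : -g - w • U = v + w • (u - U) := by
        rw [hg, smul_sub]
        abel
      rw [this]
      apply integral_congr_ae
      filter_upwards [Lp.coeFn_sub u U, Lp.coeFn_add v (w • (u - U)),
        Lp.coeFn_smul w (u - U)] with x hx h3 h4
      rw [h3, Pi.add_apply, h4, Pi.smul_apply, hx, Pi.sub_apply, smul_eq_mul]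
      ring
    have b6 : Integrable fun x => u x * deriv (deriv φ) x - U x * deriv (deriv φ) x := b1.sub b2
    have b7 : Integrable fun x => w * (u x * φ x - U x * φ x) := (b3.sub b4).const_mul w
    rw [e1, integral_add b6 b7, integral_sub b1 b2, h φ ⟨h1, h2, h3⟩, a1, e2, integral_add b5 b7]
    ring
  obtain ⟨c, hc⟩ := (Submodule.mem_span_range_iff_exists_fun ℂ).mp key
  refine ⟨fun p j => c (p, j), ?_⟩
  rw [kreinFun, ← sub_eq_iff_eq_add', ← hc, Fintype.sum_prod_type, Fin.sum_univ_two,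
    ← Finset.sum_add_distrib]

end Scalar

/-! ### Second order Sobolev functions from second distributional derivatives -/

/-- Elliptic regularity, with every point of `range y` a possible singularity: solving
`-u'' - w u = -v - w u` at the arbitrary regular value `w = -1` represents `u` by Green's functions. -/
theorem mem_H2_of_second_derivative {N : ℕ} {y : Fin N → ℝ} {u v : L2}
    (h : ∀ φ ∈ testFun (range y), ∫ x, u x * deriv (deriv φ) x = ∫ x, v x * φ x) :
    u ∈ H2 (range y) ∧ wderiv (range y) (wderiv (range y) u) = v := by
  have hw : ∀ r : ℝ, 0 ≤ r → (-1 : ℂ) ≠ r := fun r hr h => by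
    have := congrArg Complex.re h
    simp only [Complex.neg_re, Complex.one_re, Complex.ofReal_re] at this
    linarith
  obtain ⟨c, hc⟩ := exists_eq_kreinFun hw h
  have h1 := isWeakDeriv_kreinFun (y := y) hw c (-v - (-1 : ℂ) • u)
  have h2 := isWeakDeriv_kreinFunDeriv (y := y) hw c (-v - (-1 : ℂ) • u)
  rw [← hc] at h1 h2
  have e : -(-v - (-1 : ℂ) • u) - (-1 : ℂ) • u = v := by
    abel
  rw [e] at h2
  refine ⟨⟨_, _, h1, h2⟩, ?_⟩
  rw [h1.wderiv_eq (finite_range y), h2.wderiv_eq (finite_range y)]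

theorem integral_mul_second_derivative {Y : Set ℝ} (hY : Y.Finite) {u : L2} (hu : u ∈ H2 Y)
    {φ : ℝ → ℂ} (hφ : φ ∈ testFun Y) :
    ∫ x, u x * deriv (deriv φ) x = ∫ x, wderiv Y (wderiv Y u) x * φ x := by
  obtain ⟨g, k, h1, h2⟩ := hu
  obtain ⟨k1, k2, k3⟩ := hφ
  rw [h1.wderiv_eq hY, h2.wderiv_eq hY]
  have k4 : tsupport (deriv φ) ⊆ Yᶜ := tsupport_deriv_subset.trans k3
  rw [h1 _ (contDiff_infty_iff_deriv.mp k1).2 k2.deriv k4, h2 φ k1 k2 k3, neg_neg]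

theorem deriv_conj_comp (φ : ℝ → ℂ) (x : ℝ) :
    deriv (fun x => conj (φ x)) x = conj (deriv φ x) := by
  exact deriv.star (f := φ) (x := x)

/-! ### Adjointness relations -/

theorem inner_convL_green {w w' : ℂ} (hw : ∀ r : ℝ, 0 ≤ r → w ≠ r)
    (hw' : ∀ r : ℝ, 0 ≤ r → w' ≠ r) (h : w' = conj w) (f g : L2) :
    inner ℂ (convL (isExpKernel_green hw) f) g = inner ℂ f (convL (isExpKernel_green hw') g) := by
  subst h
  have hk := isExpKernel_green hw'
  have hf : MemLp (fun x => conj (f x)) 2 (volume : Measure ℝ) := (Lp.memLp f).star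
  have e : ∀ x, conj (conv (green w) f x) = conv (green (conj w)) (fun x => conj (f x)) x :=
    fun x => by
      rw [conv, conv, ← integral_conj]
      congr 1
      ext t
      rw [map_mul]
      congr 1
      exact greenP_conj hw 0 _
  rw [L2.inner_def, L2.inner_def]
  calc ∫ x, inner ℂ (convL (isExpKernel_green hw) f x) (g x)
      = ∫ x, conv (green (conj w)) (fun x => conj (f x)) x * g x := by
        apply integral_congr_ae
        filter_upwards [convL_coeFn (isExpKernel_green hw) f] with x hx
        rw [hx, RCLike.inner_apply, e, mul_comm]
    _ = ∫ x, inner ℂ (f x) (convL hk g x) := by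
        rw [hk.integral_conv_mul (Lp.memLp g) hf]
        apply integral_congr_ae
        filter_upwards [convL_coeFn hk g] with x hx
        rw [hx, RCLike.inner_apply, conv_green_eq, mul_comm]

theorem inner_greenL {w w' : ℂ} (hw : ∀ r : ℝ, 0 ≤ r → w ≠ r) (h : w' = conj w)
    (p : Fin 2) (c : ℝ) (g : L2) :
    inner ℂ (greenL p w' c) g = (-1) ^ (p : ℕ) * conv (greenP p w) g c := by
  subst h
  have e : ∫ x, inner ℂ (greenL p (conj w) c x) (g x) =
      ∫ x, (-1) ^ (p : ℕ) * (greenP p w (c - x) * g x) := by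
    apply integral_congr_ae
    filter_upwards [greenL_coeFn (conj_notMem hw) p c] with x hx
    rw [hx, RCLike.inner_apply, greenP_conj (conj_notMem hw), Complex.conj_conj, ← neg_sub,
      greenP_neg]
    ring
  rw [L2.inner_def, e, integral_const_mul, conv]

section Matrix

variable {N : ℕ} (α y : Fin N → ℝ) (z : ℂ)

/-- As `sgn 0 = 0` makes `greenDeriv w 0 = 0`, the diagonal entries `j = j'` need no separate
case. -/
theorem gammaMat_apply (p p' : Fin 2) (j j' : Fin N) (σ σ' : Config N) :
    gammaMat α y z (p, j, σ) (p', j', σ') = if σ = σ' then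
      (if p = 0 then if p' = 0 then -green (z - dotSpin α σ) (y j - y j')
          else -greenDeriv (z - dotSpin α σ) (y j - y j')
        else if p' = 0 then greenDeriv (z - dotSpin α σ) (y j - y j')
          else -(z - dotSpin α σ) * green (z - dotSpin α σ) (y j - y j')) else 0 := by
  by_cases h : σ = σ'
  · fin_cases p <;> fin_cases p' <;> by_cases hj : j = j' <;>
      simp [gammaMat, h, hj, greenDeriv_zero]
  · simp [gammaMat, h]

theorem conjTranspose_gammaMat
    (hz : ∀ (σ : Config N) (r : ℝ), 0 ≤ r → z - dotSpin α σ ≠ r) :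
    (gammaMat α y z).conjTranspose = gammaMat α y (conj z) := by
  ext ⟨p, j, σ⟩ ⟨p', j', σ'⟩
  rw [Matrix.conjTranspose_apply, gammaMat_apply, gammaMat_apply]
  by_cases h : σ = σ'
  · subst h
    have hc : conj z - dotSpin α σ = conj (z - dotSpin α σ) := by simp
    have g0 : ∀ x, conj (green (z - dotSpin α σ) x) = green (conj (z - dotSpin α σ)) x :=
      greenP_conj (hz σ) 0
    have g1 : ∀ x, conj (greenDeriv (z - dotSpin α σ) x) =
      greenDeriv (conj (z - dotSpin α σ)) x := greenP_conj (hz σ) 1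
    rw [hc]
    simp only [if_true, RCLike.star_def]
    rw [← neg_sub (y j), green_neg, greenDeriv_neg]
    fin_cases p <;> fin_cases p' <;> simp [-map_sub, -neg_sub, g0, g1]
  · simp [h, Ne.symm h]

end Matrix

/-! ### The vectors `R(z) Ψ + ∑ c_μ Φ^z_μ` -/

section Krein

variable {N : ℕ} {α : Fin N → ℝ} (y : Fin N → ℝ) {z : ℂ}
  (hz : ∀ (σ : Config N) (r : ℝ), 0 ≤ r → z - dotSpin α σ ≠ r)

/-- The free resolvent, acting in each spin component by convolution with Green's function. -/
def freeR : State N →L[ℂ] State N :=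
  ((PiLp.continuousLinearEquiv 2 ℂ fun _ : Config N => L2).symm :
      (Config N → L2) →L[ℂ] State N).comp
    (ContinuousLinearMap.pi fun σ =>
      (convL (isExpKernel_green (hz σ))).comp (PiLp.proj 2 (fun _ : Config N => L2) σ))

theorem freeR_apply (Ψ : State N) (σ : Config N) :
    freeR hz Ψ σ = convL (isExpKernel_green (hz σ)) (Ψ σ) := rfl

theorem inner_freeR {z' : ℂ} (hz' : ∀ (σ : Config N) (r : ℝ), 0 ≤ r → z' - dotSpin α σ ≠ r)
    (h : z' = conj z) (Ψ Φ : State N) : inner ℂ (freeR hz Ψ) Φ = inner ℂ Ψ (freeR hz' Φ) := by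
  rw [PiLp.inner_apply, PiLp.inner_apply]
  refine Finset.sum_congr rfl fun σ _ => ?_
  exact inner_convL_green (hz σ) (hz' σ) (by simp [h]) _ _

/-- The vector `R(z) Ψ + ∑ c_μ Φ^z_μ`, by components. -/
def kreinVec (c : Idx N → ℂ) (Ψ : State N) : State N :=
  WithLp.toLp 2 fun σ => kreinFun y (hz σ) (fun p j => c (p, j, σ)) (Ψ σ)

theorem defectVec_apply (μ : Idx N) (σ : Config N) :
    defectVec α y z μ σ = if σ = μ.2.2 then greenL μ.1 (z - dotSpin α σ) (y μ.2.1) else 0 := rfl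

theorem kreinVec_eq (c : Idx N → ℂ) (Ψ : State N) :
    kreinVec y hz c Ψ = freeR hz Ψ + ∑ μ, c μ • defectVec α y z μ := by
  ext1 σ
  rw [PiLp.add_apply, freeR_apply, WithLp.ofLp_sum, Finset.sum_apply]
  simp only [PiLp.smul_apply, defectVec_apply, Fintype.sum_prod_type, Fin.sum_univ_two, smul_ite,
    smul_zero, Finset.sum_ite_eq, Finset.mem_univ, if_true]
  rw [← Finset.sum_add_distrib]
  rfl

theorem kreinVec_apply (c : Idx N → ℂ) (Ψ : State N) (σ : Config N) :
    kreinVec y hz c Ψ σ = kreinFun y (hz σ) (fun p j => c (p, j, σ)) (Ψ σ) := rfl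

theorem kreinFun_mem_H2 {w : ℂ} (hw : ∀ r : ℝ, 0 ≤ r → w ≠ r) (c : Fin 2 → Fin N → ℂ) (g : L2) :
    kreinFun y hw c g ∈ H2 (range y) :=
  ⟨_, _, isWeakDeriv_kreinFun hw c g, isWeakDeriv_kreinFunDeriv hw c g⟩

theorem kreinVec_mem (c : Idx N → ℂ) (Ψ : State N) :
    kreinVec y hz c Ψ ∈ components N (H2 (range y)) := fun σ => by
  rw [kreinVec_apply]
  exact kreinFun_mem_H2 _ _ _ _

theorem wderiv_kreinFun {w : ℂ} (hw : ∀ r : ℝ, 0 ≤ r → w ≠ r) (c : Fin 2 → Fin N → ℂ) (g : L2) :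
    wderiv (range y) (kreinFun y hw c g) = kreinFunDeriv y hw c g ∧
      wderiv (range y) (wderiv (range y) (kreinFun y hw c g)) = -g - w • kreinFun y hw c g := by
  rw [(isWeakDeriv_kreinFun hw c g).wderiv_eq (finite_range y),
    (isWeakDeriv_kreinFunDeriv hw c g).wderiv_eq (finite_range y)]
  exact ⟨rfl, rfl⟩

variable (α) in
theorem spinLaplacian_apply {Y : Set ℝ} (hY : Y.Finite) {D : Submodule ℂ (State N)}
    (hD : D ≤ components N (H2 Y)) (Ψ : (spinLaplacian α hY D hD).domain) (σ : Config N) :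
    spinLaplacian α hY D hD Ψ σ =
      -wderiv Y (wderiv Y ((Ψ : State N) σ)) + (dotSpin α σ : ℂ) • (Ψ : State N) σ := rfl

theorem spinLaplacian_kreinVec {D : Submodule ℂ (State N)} (hD : D ≤ components N (H2 (range y)))
    (c : Idx N → ℂ) (Ψ : State N) 
    (h : kreinVec y hz c Ψ ∈ (spinLaplacian α (finite_range y) D hD).domain) :
    spinLaplacian α (finite_range y) D hD ⟨kreinVec y hz c Ψ, h⟩ = Ψ + z • kreinVec y hz c Ψ := by
  ext1 σ
  rw [PiLp.add_apply, PiLp.smul_apply, spinLaplacian_apply]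
  simp only [kreinVec_apply]
  rw [(wderiv_kreinFun y (hz σ) _ _).2, sub_smul]
  abel

/-- Every vector of the maximal domain has this form. -/
theorem eq_kreinVec {D : Submodule ℂ (State N)} (hD : D ≤ components N (H2 (range y)))
    (Ψ : (spinLaplacian α (finite_range y) D hD).domain) : ∃ c, (Ψ : State N) =
      kreinVec y hz c (spinLaplacian α (finite_range y) D hD Ψ - z • (Ψ : State N)) := by
  have h := fun σ => exists_eq_kreinFun (hz σ) fun φ hφ =>
    integral_mul_second_derivative (finite_range y) (hD Ψ.2 σ) hφ
  choose c hc using h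
  refine ⟨fun μ => c μ.2.2 μ.1 μ.2.1, ?_⟩
  ext1 σ
  rw [kreinVec_apply, PiLp.sub_apply, PiLp.smul_apply, spinLaplacian_apply]
  refine (hc σ).trans (congrArg (kreinFun y (hz σ) (c σ)) ?_)
  rw [sub_smul]
  abel

include hz in
theorem kreinMean_eq (c : Idx N → ℂ) (Ψ : State N) (p : Fin 2) (j : Fin N) (σ : Config N) :
    (-1) ^ (p : ℕ) * kreinMean y (z - dotSpin α σ) (fun p j => c (p, j, σ)) (Ψ σ) p j =
      inner ℂ (defectVec α y (conj z) (p, j, σ)) Ψ - (gammaMat α y z).mulVec c (p, j, σ) := by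
  have e : inner ℂ (defectVec α y (conj z) (p, j, σ)) Ψ =
      (-1) ^ (p : ℕ) * conv (greenP p (z - dotSpin α σ)) (Ψ σ) (y j) := by
    rw [PiLp.inner_apply, Finset.sum_eq_single σ]
    · rw [defectVec_apply, if_pos rfl]
      exact inner_greenL (hz σ) (by simp) p (y j) (Ψ σ)
    · intro σ' _ h
      rw [defectVec_apply, if_neg h, inner_zero_left]
    · simp
  rw [e, sub_eq_add_neg (_ * _)]
  simp only [Matrix.mulVec, dotProduct, gammaMat_apply, Fintype.sum_prod_type, Fin.sum_univ_two,
    ite_mul, zero_mul, Finset.sum_ite_eq, Finset.mem_univ, if_true]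
  generalize z - (dotSpin α σ : ℂ) = w
  rw [← Finset.sum_add_distrib, ← Finset.sum_neg_distrib]
  fin_cases p
  · simp only [kreinMean, Fin.zero_eta, if_true, one_ne_zero, if_false, pow_zero, one_mul]
    refine congrArg₂ _ rfl (Finset.sum_congr rfl fun i _ => ?_)
    ring
  · simp only [kreinMean, Fin.mk_one, one_ne_zero, if_false, pow_one]
    rw [mul_add, Finset.mul_sum]
    refine congrArg₂ _ rfl (Finset.sum_congr rfl fun i _ => ?_)
    ring

/-- The charges of `R(z) Ψ + ∑ c_μ Φ^z_μ` are the `c_μ`, and its averages are given by the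
matrix `Γ(z)`. -/
theorem exists_boundary_kreinVec (hy : Function.Injective y) (c : Idx N → ℂ) (Ψ : State N) :
    ∃ L R, HasBoundaryValues y (kreinVec y hz c Ψ) L R ∧ charge L R = c ∧
      average L R = (fun μ => inner ℂ (defectVec α y (conj z) μ) Ψ) - (gammaMat α y z).mulVec c := by
  let m : Idx N → ℂ := fun μ =>
    kreinMean y (z - dotSpin α μ.2.2) (fun p j => c (p, j, μ.2.2)) (Ψ μ.2.2) μ.1 μ.2.1
  refine ⟨fun μ => m μ + c (1 - μ.1, μ.2) / 2, fun μ => m μ - c (1 - μ.1, μ.2) / 2, ?_, ?_, ?_⟩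
  · intro p j σ
    fin_cases p
    · have := hasTrace_kreinFun (hz σ) hy (fun p j => c (p, j, σ)) (Ψ σ) j
      rw [← kreinVec_apply] at this
      exact this
    · have := hasTrace_kreinFunDeriv (hz σ) hy (fun p j => c (p, j, σ)) (Ψ σ) j
      rw [← (wderiv_kreinFun y (hz σ) _ _).1, ← kreinVec_apply] at this
      exact this
  · ext ⟨p, j, σ⟩
    fin_cases p <;> simp [charge]
  · ext ⟨p, j, σ⟩
    rw [Pi.sub_apply, ← kreinMean_eq y hz]
    simp only [average]
    ring

end Krein

/-! ### Lagrangian subspaces of the space of boundary data -/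

section Lagrangian

variable {ι : Type*} [Fintype ι]

/-- The skew-Hermitian form `⟨f, q'⟩ - ⟨q, f'⟩` on pairs `(q, f)` of charges and averages. -/
def boundaryForm (a b : (ι → ℂ) × (ι → ℂ)) : ℂ := star a.2 ⬝ᵥ b.1 - star a.1 ⬝ᵥ b.2

/-- A subspace that equals its own orthogonal complement for `boundaryForm`. -/
def IsLagrangian (L : Submodule ℂ ((ι → ℂ) × (ι → ℂ))) : Prop :=
  ∀ a, a ∈ L ↔ ∀ b ∈ L, boundaryForm a b = 0

theorem star_boundaryForm (a b : (ι → ℂ) × (ι → ℂ)) :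
    star (boundaryForm a b) = -boundaryForm b a := by
  simp only [boundaryForm, star_sub, ← Matrix.star_dotProduct_star, star_star]
  exact (neg_sub _ _).symm

/-- The space of solutions `(q, f)` of `A q = B f`. -/
def boundarySpace (A B : Matrix ι ι ℂ) : Submodule ℂ ((ι → ℂ) × (ι → ℂ)) where
  carrier := {a | A.mulVec a.1 = B.mulVec a.2}
  zero_mem' := by simp
  add_mem' := fun {a b} ha hb => by
    simp only [mem_ofPred_eq, Prod.fst_add, Prod.snd_add, Matrix.mulVec_add] at *
    rw [ha, hb]
  smul_mem' := fun c a ha => by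
    simp only [mem_ofPred_eq, Prod.smul_fst, Prod.smul_snd, Matrix.mulVec_smul] at *
    rw [ha]

theorem mem_boundarySpace {A B : Matrix ι ι ℂ} {a : (ι → ℂ) × (ι → ℂ)} :
    a ∈ boundarySpace A B ↔ A.mulVec a.1 = B.mulVec a.2 := Iff.rfl

/-- The map `x ↦ (B* x, A* x)`. -/
def boundaryParam (A B : Matrix ι ι ℂ) : (ι → ℂ) →ₗ[ℂ] (ι → ℂ) × (ι → ℂ) :=
  B.conjTranspose.mulVecLin.prod A.conjTranspose.mulVecLin

theorem boundaryParam_apply (A B : Matrix ι ι ℂ) (x : ι → ℂ) :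
    boundaryParam A B x = (B.conjTranspose.mulVec x, A.conjTranspose.mulVec x) := rfl

theorem boundaryForm_boundaryParam (A B : Matrix ι ι ℂ) (a : (ι → ℂ) × (ι → ℂ)) (x : ι → ℂ) :
    boundaryForm a (boundaryParam A B x) = star (B.mulVec a.2 - A.mulVec a.1) ⬝ᵥ x := by
  simp only [boundaryForm, boundaryParam_apply, star_sub, Matrix.star_mulVec, sub_dotProduct,
    Matrix.dotProduct_mulVec]

theorem mem_boundarySpace_iff_forall {A B : Matrix ι ι ℂ} {a : (ι → ℂ) × (ι → ℂ)} :
    a ∈ boundarySpace A B ↔ ∀ b ∈ LinearMap.range (boundaryParam A B), boundaryForm a b = 0 := by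
  simp only [LinearMap.mem_range, forall_exists_index, forall_apply_eq_imp_iff,
    boundaryForm_boundaryParam]
  rw [mem_boundarySpace]
  constructor
  · intro h x
    simp [h]
  · intro h
    have := dotProduct_eq_zero _ h
    rw [star_eq_zero, sub_eq_zero] at this
    exact this.symm

theorem conjTranspose_fromCols_mulVec (A B : Matrix ι ι ℂ) (x : ι → ℂ) :
    (Matrix.fromCols A B).conjTranspose.mulVec x =
      Sum.elim (A.conjTranspose.mulVec x) (B.conjTranspose.mulVec x) := by
  rw [Matrix.conjTranspose_fromCols_eq_fromRows_conjTranspose, Matrix.fromRows_mulVec]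

open scoped ComplexOrder in
theorem injective_boundaryParam_iff (A B : Matrix ι ι ℂ) :
    Function.Injective (boundaryParam A B) ↔ (Matrix.fromCols A B).rank = Fintype.card ι := by
  have h : Function.Injective (boundaryParam A B) ↔
      Function.Injective (Matrix.fromCols A B).conjTranspose.mulVecLin := by
    rw [injective_iff_map_eq_zero, injective_iff_map_eq_zero]
    refine forall_congr' fun x => imp_congr_left ?_
    rw [boundaryParam_apply, Matrix.mulVecLin_apply, conjTranspose_fromCols_mulVec, Prod.mk_eq_zero,
      ← Sum.elim_zero_zero, and_comm]
    refine ⟨fun h => by rw [h.1, h.2], fun h => ⟨?_, ?_⟩⟩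
    · exact (Sum.elim_comp_inl _ _).symm.trans ((congrArg (· ∘ Sum.inl) h).trans
        (Sum.elim_comp_inl _ _))
    · exact (Sum.elim_comp_inr _ _).symm.trans ((congrArg (· ∘ Sum.inr) h).trans
        (Sum.elim_comp_inr _ _))
  rw [h, ← LinearMap.ker_eq_bot, ← Matrix.rank_conjTranspose, Matrix.rank,
    ← Submodule.finrank_eq_zero]
  have := LinearMap.finrank_range_add_finrank_ker
    (Matrix.fromCols A B).conjTranspose.mulVecLin
  rw [Module.finrank_pi] at this
  omega

/-- For admissible matrices the solutions of `A q = B f` are the pairs `(B* x, A* x)`. -/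
theorem boundarySpace_eq_range {A B : Matrix ι ι ℂ}
    (h : A * B.conjTranspose = B * A.conjTranspose)
    (hr : (Matrix.fromCols A B).rank = Fintype.card ι) :
    LinearMap.range (boundaryParam A B) = boundarySpace A B := by
  have hle : LinearMap.range (boundaryParam A B) ≤ boundarySpace A B := by
    rintro _ ⟨x, rfl⟩
    rw [mem_boundarySpace, boundaryParam_apply, Matrix.mulVec_mulVec, Matrix.mulVec_mulVec, h]
  refine Submodule.eq_of_le_of_finrank_le hle ?_
  have h1 := LinearMap.finrank_range_of_inj ((injective_boundaryParam_iff A B).mpr hr)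
  rw [Module.finrank_pi] at h1
  let M := (Matrix.fromCols A B).mulVecLin
  have h2 := LinearMap.finrank_range_add_finrank_ker M
  have h3 : Module.finrank ℂ (LinearMap.range M) = Fintype.card ι := hr
  rw [Module.finrank_pi, Fintype.card_sum, h3] at h2
  let e : ((ι → ℂ) × (ι → ℂ)) →ₗ[ℂ] (ι ⊕ ι → ℂ) :=
    { toFun := fun a => Sum.elim a.1 (-a.2)
      map_add' := fun a b => by ext (i | i) <;> simp [add_comm]
      map_smul' := fun c a => by ext (i | i) <;> simp }
  have he : Function.Injective e := fun a b hab => by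
    have h1 : a.1 = b.1 := funext fun i => congrFun hab (Sum.inl i)
    have h2 : -a.2 = -b.2 := funext fun i => congrFun hab (Sum.inr i)
    exact Prod.ext h1 (neg_injective h2)
  have h4 : Submodule.map e (boundarySpace A B) ≤ LinearMap.ker M := by
    rintro _ ⟨a, ha, rfl⟩
    rw [LinearMap.mem_ker]
    change (Matrix.fromCols A B).mulVec (Sum.elim a.1 (-a.2)) = 0
    rw [Matrix.fromCols_mulVec_sumElim, Matrix.mulVec_neg, mem_boundarySpace.mp ha]
    exact add_neg_cancel _
  have h5 := Submodule.finrank_mono h4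
  rw [← (Submodule.equivMapOfInjective e he _).finrank_eq] at h5
  omega

theorem isLagrangian_boundarySpace {A B : Matrix ι ι ℂ}
    (h : A * B.conjTranspose = B * A.conjTranspose)
    (hr : (Matrix.fromCols A B).rank = Fintype.card ι) : IsLagrangian (boundarySpace A B) := by
  intro a
  rw [mem_boundarySpace_iff_forall, boundarySpace_eq_range h hr]

theorem IsLagrangian.finrank_eq {L : Submodule ℂ ((ι → ℂ) × (ι → ℂ))} (hL : IsLagrangian L) :
    Module.finrank ℂ L = Fintype.card ι := by
  let e : ((ι → ℂ) × (ι → ℂ)) →ₗ[ℂ] EuclideanSpace ℂ (ι ⊕ ι) :=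
    { toFun := fun a => WithLp.toLp 2 (Sum.elim a.1 a.2)
      map_add' := fun a b => by ext (i | i) <;> simp
      map_smul' := fun c a => by ext (i | i) <;> simp }
  let e' : ((ι → ℂ) × (ι → ℂ)) →ₗ[ℂ] EuclideanSpace ℂ (ι ⊕ ι) :=
    { toFun := fun a => WithLp.toLp 2 (Sum.elim (-a.2) a.1)
      map_add' := fun a b => by ext (i | i) <;> simp [add_comm]
      map_smul' := fun c a => by ext (i | i) <;> simp }
  have he : Function.Injective e := fun a b hab => by
    have h1 : a.1 = b.1 := funext fun i => congrFun (congrArg WithLp.ofLp hab) (Sum.inl i)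
    have h2 : a.2 = b.2 := funext fun i => congrFun (congrArg WithLp.ofLp hab) (Sum.inr i)
    exact Prod.ext h1 h2
  have he' : Function.Injective e' := fun a b hab => by
    have h1 : -a.2 = -b.2 := funext fun i => congrFun (congrArg WithLp.ofLp hab) (Sum.inl i)
    have h2 : a.1 = b.1 := funext fun i => congrFun (congrArg WithLp.ofLp hab) (Sum.inr i)
    exact Prod.ext h2 (neg_injective h1)
  have hin : ∀ a b, inner ℂ (e b) (e' a) = boundaryForm b a := fun a b => by
    simp only [PiLp.inner_apply, Fintype.sum_sum_type, boundaryForm, dotProduct, e, e',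
      LinearMap.coe_mk, AddHom.coe_mk, Sum.elim_inl, Sum.elim_inr, RCLike.inner_apply]
    simp only [Pi.neg_apply, neg_mul, Finset.sum_neg_distrib, Pi.star_apply, RCLike.star_def]
    rw [neg_add_eq_sub]
    congr 1 <;> exact Finset.sum_congr rfl fun i _ => mul_comm _ _
  have hdim : Module.finrank ℂ ((ι → ℂ) × (ι → ℂ)) =
      Module.finrank ℂ (EuclideanSpace ℂ (ι ⊕ ι)) := by simp
  have hsurj : Function.Surjective e' := (LinearMap.injective_iff_surjective_of_finrank_eq_finrank
    hdim).mp he'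
  have key : L.map e' = (L.map e)ᗮ := by
    ext v
    obtain ⟨a, rfl⟩ := hsurj v
    rw [Submodule.mem_orthogonal]
    constructor
    · rintro ⟨a', ha', h⟩ _ ⟨b, hb, rfl⟩
      rw [← h, hin]
      exact (hL b).mp hb a' ha'
    · intro h
      refine ⟨a, (hL a).mpr fun b hb => ?_, rfl⟩
      have := h (e b) ⟨b, hb, rfl⟩
      rw [hin] at this
      rw [← neg_eq_zero, ← star_boundaryForm, this, star_zero]
  have h1 := Submodule.finrank_add_finrank_orthogonal (L.map e)
  rw [← key, ← (Submodule.equivMapOfInjective e he _).finrank_eq,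
    ← (Submodule.equivMapOfInjective e' he' _).finrank_eq, finrank_euclideanSpace, Fintype.card_sum] at h1
  omega

/-- Lagrangian subspaces are solution spaces of admissible boundary conditions. -/
theorem IsLagrangian.exists_eq_boundarySpace {L : Submodule ℂ ((ι → ℂ) × (ι → ℂ))}
    (hL : IsLagrangian L) : ∃ A B : Matrix ι ι ℂ, A * B.conjTranspose = B * A.conjTranspose ∧
      (Matrix.fromCols A B).rank = Fintype.card ι ∧ L = boundarySpace A B := by
  classical
  let e : (ι → ℂ) ≃ₗ[ℂ] L := LinearEquiv.ofFinrankEq _ _ (by rw [hL.finrank_eq, Module.finrank_pi])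
  let P : (ι → ℂ) →ₗ[ℂ] (ι → ℂ) × (ι → ℂ) := L.subtype.comp e.toLinearMap
  let A : Matrix ι ι ℂ := (LinearMap.toMatrix' ((LinearMap.snd ℂ _ _).comp P)).conjTranspose
  let B : Matrix ι ι ℂ := (LinearMap.toMatrix' ((LinearMap.fst ℂ _ _).comp P)).conjTranspose
  have hP : boundaryParam A B = P := by
    refine LinearMap.ext fun x => ?_
    rw [boundaryParam_apply, Matrix.conjTranspose_conjTranspose, Matrix.conjTranspose_conjTranspose,
      LinearMap.toMatrix'_mulVec, LinearMap.toMatrix'_mulVec]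
    rfl
  have hrange : LinearMap.range (boundaryParam A B) = L := by
    rw [hP, LinearMap.range_comp, LinearEquiv.range, Submodule.map_top, Submodule.range_subtype]
  have hLs : L = boundarySpace A B := by
    ext a
    rw [mem_boundarySpace_iff_forall, hrange]
    exact hL a
  refine ⟨A, B, ?_, ?_, hLs⟩
  · refine Matrix.ext_iff_mulVec.mpr fun x => ?_
    have : boundaryParam A B x ∈ boundarySpace A B := by
      rw [← hLs, ← hrange]
      exact LinearMap.mem_range_self _ x
    rw [mem_boundarySpace, boundaryParam_apply, Matrix.mulVec_mulVec, Matrix.mulVec_mulVec] at this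
    exact this
  · rw [← injective_boundaryParam_iff, hP]
    exact L.injective_subtype.comp e.injective

end Lagrangian

/-! ### Self-adjoint extensions and boundary data -/

section Triple

variable {E : Type*} [NormedAddCommGroup E] [InnerProductSpace ℂ E] [CompleteSpace E]
  {ι : Type*} [Fintype ι]

/-- `T` is the adjoint of the symmetric operator `S`, and the boundary map `β` of `T`, which
vanishes on the domain of `S`, is onto and satisfies Green's identity. -/
structure IsBoundaryMap (S T : E →ₗ.[ℂ] E) (β : T.domain →ₗ[ℂ] (ι → ℂ) × (ι → ℂ)) : Prop where
  dense : Dense (S.domain : Set E)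
  le : S ≤ T
  vanish : ∀ u : T.domain, (u : E) ∈ S.domain → β u = 0
  green : ∀ u v : T.domain,
    inner ℂ (T u) (v : E) - inner ℂ (u : E) (T v) = boundaryForm (β u) (β v)
  surjective : Function.Surjective β
  maximal : ∀ u v : E, (∀ φ : S.domain, inner ℂ u (S φ) = inner ℂ v (φ : E)) →
    ∃ h : u ∈ T.domain, T ⟨u, h⟩ = v

namespace IsBoundaryMap

variable {S T : E →ₗ.[ℂ] E} {β : T.domain →ₗ[ℂ] (ι → ℂ) × (ι → ℂ)} (hβ : IsBoundaryMap S T β)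
include hβ

theorem isSelfAdjoint_of_isLagrangian {K : E →ₗ.[ℂ] E} (hK : K ≤ T)
    {L : Submodule ℂ ((ι → ℂ) × (ι → ℂ))} (hL : IsLagrangian L)
    (hdom : ∀ u : T.domain, (u : E) ∈ K.domain ↔ β u ∈ L) : IsSelfAdjoint K ∧ S ≤ K := by
  have hKT : ∀ u : K.domain, K u = T ⟨u, hK.1 u.2⟩ := fun u => hK.2 rfl
  have hSK : S ≤ K := by
    refine ⟨fun u hu => ?_, fun u v huv => ?_⟩
    · rw [hdom ⟨u, hβ.le.1 hu⟩, hβ.vanish _ hu]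
      exact L.zero_mem
    · rw [hKT]
      exact hβ.le.2 huv
  have hd : Dense (K.domain : Set E) := hβ.dense.mono hSK.1
  refine ⟨?_, hSK⟩
  have hle : K ≤ K.adjoint := by
    refine LinearPMap.IsFormalAdjoint.le_adjoint hd fun u v => ?_
    rw [hKT, hKT, ← sub_eq_zero, hβ.green ⟨u, hK.1 u.2⟩ ⟨v, hK.1 v.2⟩]
    exact (hL _).mp ((hdom ⟨u, hK.1 u.2⟩).mp u.2) _ ((hdom ⟨v, hK.1 v.2⟩).mp v.2)
  rw [LinearPMap.isSelfAdjoint_def]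
  refine (LinearPMap.eq_of_le_of_domain_eq hle (le_antisymm hle.1 fun u hu => ?_)).symm
  have hf := LinearPMap.adjoint_isFormalAdjoint hd ⟨u, hu⟩
  obtain ⟨huT, huv⟩ := hβ.maximal u (K.adjoint ⟨u, hu⟩) fun φ => by
    have h1 := hf ⟨φ, hSK.1 φ.2⟩
    rw [← hSK.2 (x := φ) (y := ⟨φ, hSK.1 φ.2⟩) rfl] at h1
    exact h1.symm
  rw [hdom ⟨u, huT⟩, hL]
  intro b hb
  obtain ⟨x, rfl⟩ := hβ.surjective b
  have hx := (hdom x).mpr hb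
  rw [← hβ.green, huv, sub_eq_zero]
  have h1 := hf ⟨x, hx⟩
  rw [hKT] at h1
  exact h1

theorem exists_isLagrangian {K : E →ₗ.[ℂ] E} (hK : IsSelfAdjoint K) (hSK : S ≤ K) :
    K ≤ T ∧ ∃ L : Submodule ℂ ((ι → ℂ) × (ι → ℂ)), IsLagrangian L ∧
      ∀ u : T.domain, (u : E) ∈ K.domain ↔ β u ∈ L := by
  have hd := hK.dense_domain
  have hsym : K.IsFormalAdjoint K := by
    have h := LinearPMap.adjoint_isFormalAdjoint hd
    rwa [LinearPMap.isSelfAdjoint_def.mp hK] at h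
  have hmax : ∀ u : K.domain, ∃ h : (u : E) ∈ T.domain, T ⟨u, h⟩ = K u := fun u =>
    hβ.maximal u (K u) fun φ => by
      rw [hSK.2 (x := φ) (y := ⟨φ, hSK.1 φ.2⟩) rfl]
      exact (hsym u ⟨φ, hSK.1 φ.2⟩).symm
  have hKT : K ≤ T := by
    refine ⟨fun u hu => (hmax ⟨u, hu⟩).1, fun u v huv => ?_⟩
    obtain ⟨h, h'⟩ := hmax u
    rw [← h']
    congr 1
    exact Subtype.ext huv
  have hval : ∀ u : K.domain, T ⟨u, hKT.1 u.2⟩ = K u := fun u => (hKT.2 rfl).symm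
  have hmem : ∀ u : T.domain,
      (∀ k : K.domain, boundaryForm (β u) (β ⟨k, hKT.1 k.2⟩) = 0) → (u : E) ∈ K.domain := by
    intro u hu
    rw [← LinearPMap.isSelfAdjoint_def.mp hK]
    refine LinearPMap.mem_adjoint_domain_of_exists _ ⟨T u, fun k => ?_⟩
    have := hu k
    rw [← hβ.green, hval, sub_eq_zero] at this
    exact this
  have hiso : ∀ u v : K.domain,
      boundaryForm (β ⟨u, hKT.1 u.2⟩) (β ⟨v, hKT.1 v.2⟩) = 0 := fun u v => by
    rw [← hβ.green, hval, hval, sub_eq_zero]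
    exact hsym u v
  refine ⟨hKT, (K.domain.comap T.domain.subtype).map β, fun a => ⟨?_, fun h => ?_⟩,
    fun u => ⟨fun h => ⟨u, h, rfl⟩, ?_⟩⟩
  · rintro ⟨u, hu, rfl⟩ _ ⟨v, hv, rfl⟩
    exact hiso ⟨u, hu⟩ ⟨v, hv⟩
  · obtain ⟨u, rfl⟩ := hβ.surjective a
    exact ⟨u, hmem u fun k => h _ ⟨⟨k, hKT.1 k.2⟩, k.2, rfl⟩, rfl⟩
  · rintro ⟨x, hx, hxu⟩
    refine hmem u fun k => ?_
    rw [← hxu]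
    exact hiso ⟨x, hx⟩ k

end IsBoundaryMap

end Triple

/-! ### Test vectors and the minimal operator -/

/-- The vector `f ⊗ X_σ`. -/
def singleState {N : ℕ} (σ : Config N) (f : L2) : State N :=
  WithLp.toLp 2 fun σ' => if σ' = σ then f else 0

theorem singleState_apply {N : ℕ} (σ σ' : Config N) (f : L2) :
    singleState σ f σ' = if σ' = σ then f else 0 := rfl

theorem inner_singleState {N : ℕ} (Ψ : State N) (σ : Config N) (f : L2) :
    inner ℂ Ψ (singleState σ f) = inner ℂ (Ψ σ) f := by
  rw [PiLp.inner_apply, Finset.sum_eq_single σ]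
  · rw [singleState_apply, if_pos rfl]
  · intro σ' _ h
    rw [singleState_apply, if_neg h, inner_zero_right]
  · simp

theorem norm_singleState {N : ℕ} (σ : Config N) (f : L2) : ‖singleState σ f‖ = ‖f‖ := by
  have h : ‖singleState σ f‖ ^ 2 = ‖f‖ ^ 2 := by
    rw [PiLp.norm_sq_eq_of_L2, Finset.sum_eq_single σ]
    · rw [singleState_apply, if_pos rfl]
    · intro σ' _ h
      rw [singleState_apply, if_neg h, norm_zero, zero_pow two_ne_zero]
    · simp
  exact (pow_left_inj₀ (norm_nonneg _) (norm_nonneg _) two_ne_zero).mp h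

section Test

variable {Y : Set ℝ} {φ : ℝ → ℂ} (hφ : φ ∈ testFun Y)
include hφ

theorem testFun_deriv : deriv φ ∈ testFun Y :=
  ⟨(contDiff_infty_iff_deriv.mp hφ.1).2, hφ.2.1.deriv, tsupport_deriv_subset.trans hφ.2.2⟩

theorem testFun_conj : (fun x => conj (φ x)) ∈ testFun Y := by
  refine ⟨Complex.conjCLE.contDiff.comp hφ.1, hφ.2.1.comp_left (g := conj) (map_zero _), ?_⟩
  exact (closure_mono (Function.support_comp_subset (g := conj) (map_zero _) φ)).trans hφ.2.2

theorem testFun_memLp : MemLp φ 2 (volume : Measure ℝ) :=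
  hφ.1.continuous.memLp_of_hasCompactSupport hφ.2.1

theorem testFun_toL2_mem : toL2 φ ∈ testSpace Y :=
  ⟨φ, hφ.1, hφ.2.1, hφ.2.2, toL2_coeFn (testFun_memLp hφ)⟩

theorem wderiv_toL2 (hY : Y.Finite) : wderiv Y (toL2 φ) = toL2 (deriv φ) :=
  (isWeakDeriv_of_test Y hφ.1 hφ.2.1 (toL2_coeFn (testFun_memLp hφ))
    (toL2_coeFn (testFun_memLp (testFun_deriv hφ)))).wderiv_eq hY

theorem inner_toL2_conj (u : L2) :
    inner ℂ u (toL2 fun x => conj (φ x)) = conj (∫ x, u x * φ x) := by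
  rw [L2.inner_def, ← integral_conj]
  apply integral_congr_ae
  filter_upwards [toL2_coeFn (testFun_memLp (testFun_conj hφ))] with x hx
  rw [hx, RCLike.inner_apply, map_mul, mul_comm]

end Test

section Minimal

variable {N : ℕ} (α y : Fin N → ℝ)

theorem singleState_mem {V : Submodule ℂ L2} (σ : Config N) {f : L2} (hf : f ∈ V) :
    singleState σ f ∈ components N V := fun σ' => by
  rw [singleState_apply]
  split_ifs
  exacts [hf, V.zero_mem]

theorem minimalH_apply (Ψ : (minimalH α y).domain) (σ : Config N) :
    minimalH α y Ψ σ = -wderiv (range y) (wderiv (range y) ((Ψ : State N) σ)) +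
      (dotSpin α σ : ℂ) • (Ψ : State N) σ := rfl

theorem singleState_mem_minimalH (σ : Config N) {φ : ℝ → ℂ} (hφ : φ ∈ testFun (range y)) :
    singleState σ (toL2 φ) ∈ (minimalH α y).domain :=
  singleState_mem σ (testFun_toL2_mem hφ)

theorem minimalH_singleState (σ : Config N) {φ : ℝ → ℂ} (hφ : φ ∈ testFun (range y))
    (h : singleState σ (toL2 φ) ∈ (minimalH α y).domain) :
    minimalH α y ⟨singleState σ (toL2 φ), h⟩ =
      singleState σ (-toL2 (deriv (deriv φ)) + (dotSpin α σ : ℂ) • toL2 φ) := by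
  ext1 σ'
  rw [minimalH_apply]
  simp only [singleState_apply]
  split_ifs with hσ
  · subst hσ
    rw [wderiv_toL2 hφ (finite_range y), wderiv_toL2 (testFun_deriv hφ) (finite_range y)]
  · have h0 := (isWeakDeriv_zero (range y)).wderiv_eq (finite_range y)
    rw [h0, h0, neg_zero, smul_zero, add_zero]

theorem dense_minimalH_domain : Dense ((minimalH α y).domain : Set (State N)) := by
  rw [Submodule.dense_iff_topologicalClosure_eq_top, Submodule.topologicalClosure_eq_top_iff,
    Submodule.eq_bot_iff]
  intro Ψ hΨ
  ext1 σ
  refine distrib_injective (finite_range y) (LinearMap.ext fun φ => ?_)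
  have h1 := (Submodule.mem_orthogonal' _ _).mp hΨ _
    (singleState_mem_minimalH α y σ (testFun_conj φ.2))
  rw [inner_singleState, inner_toL2_conj φ.2] at h1
  rw [PiLp.zero_apply, map_zero, LinearMap.zero_apply, distrib_apply]
  exact (map_eq_zero _).mp h1

/-- The operator `-Δ + α·σ` on its maximal domain `H²(ℝ ∖ Y) ⊗ (ℂ²)^{⊗ N}`. -/
def maximalH : State N →ₗ.[ℂ] State N :=
  spinLaplacian α (finite_range y) (components N (H2 (range y))) le_rfl

theorem maximalH_apply (Ψ : (maximalH α y).domain) (σ : Config N) :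
    maximalH α y Ψ σ = -wderiv (range y) (wderiv (range y) ((Ψ : State N) σ)) +
      (dotSpin α σ : ℂ) • (Ψ : State N) σ := rfl

theorem minimalH_le_maximalH : minimalH α y ≤ maximalH α y :=
  ⟨fun _ h σ => testSpace_le_H2 _ (h σ), fun u v huv => by
    ext1 σ
    rw [minimalH_apply, maximalH_apply, huv]⟩

section Krein

variable {α} {z : ℂ} (hz : ∀ (σ : Config N) (r : ℝ), 0 ≤ r → z - dotSpin α σ ≠ r)

theorem kreinVec_mem_maximalH (c : Idx N → ℂ) (Ψ : State N) :
    kreinVec y hz c Ψ ∈ (maximalH α y).domain := kreinVec_mem y hz c Ψ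

theorem maximalH_kreinVec (c : Idx N → ℂ) (Ψ : State N)
    (h : kreinVec y hz c Ψ ∈ (maximalH α y).domain) :
    maximalH α y ⟨kreinVec y hz c Ψ, h⟩ = Ψ + z • kreinVec y hz c Ψ :=
  spinLaplacian_kreinVec y hz le_rfl c Ψ h

theorem exists_eq_kreinVec (Ψ : (maximalH α y).domain) : ∃ c g, (Ψ : State N) = kreinVec y hz c g :=
  (eq_kreinVec y hz le_rfl Ψ).imp fun _ h => ⟨_, h⟩

end Krein

/-- The adjoint of the minimal operator is contained in the maximal operator. -/
theorem exists_maximalH_eq {Ψ Θ : State N}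
    (h : ∀ φ : (minimalH α y).domain, inner ℂ Ψ (minimalH α y φ) = inner ℂ Θ (φ : State N)) :
    ∃ hΨ : Ψ ∈ (maximalH α y).domain, maximalH α y ⟨Ψ, hΨ⟩ = Θ := by
  have key : ∀ σ, Ψ σ ∈ H2 (range y) ∧ wderiv (range y) (wderiv (range y) (Ψ σ)) =
      (dotSpin α σ : ℂ) • Ψ σ - Θ σ := fun σ => by
    refine mem_H2_of_second_derivative fun φ hφ => ?_
    have hc := testFun_conj hφ
    have h1 := h ⟨_, singleState_mem_minimalH α y σ hc⟩
    have hd : deriv (deriv fun x => conj (φ x)) = fun x => conj (deriv (deriv φ) x) := by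
      rw [funext (deriv_conj_comp φ)]
      exact funext (deriv_conj_comp (deriv φ))
    rw [minimalH_singleState α y σ hc, inner_singleState, inner_singleState, inner_add_right,
      inner_neg_right, inner_smul_right, inner_toL2_conj hφ, inner_toL2_conj hφ, hd,
      inner_toL2_conj (testFun_deriv (testFun_deriv hφ))] at h1
    have h2 := congrArg conj h1
    simp only [map_add, map_neg, map_mul, Complex.conj_conj, Complex.conj_ofReal] at h2
    have h3 : ∫ x, ((dotSpin α σ : ℂ) • Ψ σ - Θ σ) x * φ x =
        dotSpin α σ * (∫ x, Ψ σ x * φ x) - ∫ x, Θ σ x * φ x := by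
      have := distrib_apply ((dotSpin α σ : ℂ) • Ψ σ - Θ σ) ⟨φ, hφ⟩
      rw [map_sub, map_smul] at this
      exact this.symm
    rw [h3]
    linear_combination -h2
  refine ⟨fun σ => (key σ).1, ?_⟩
  ext1 σ
  rw [maximalH_apply, (key σ).2]
  abel

theorem hasBoundaryValues_of_mem_minimalH {Ψ : State N} (h : Ψ ∈ (minimalH α y).domain) :
    HasBoundaryValues y Ψ 0 0 := by
  intro p j σ
  obtain ⟨φ, h1, h2, h3, h4⟩ := h σ
  have hφ : φ ∈ testFun (range y) := ⟨h1, h2, h3⟩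
  have key : ∀ (f : L2) (ψ : ℝ → ℂ), f =ᵐ[volume] ψ → tsupport ψ ⊆ (range y)ᶜ →
      HasLeftTrace f (y j) 0 ∧ HasRightTrace f (y j) 0 := fun f ψ hf hs => by
    have h0 : ψ =ᶠ[𝓝 (y j)] 0 :=
      notMem_tsupport_iff_eventuallyEq.mp fun hm => hs hm (mem_range_self j)
    have ht : Tendsto ψ (𝓝 (y j)) (𝓝 0) := tendsto_const_nhds.congr' h0.symm
    exact ⟨tendsto_trace_of_ae_eq hf (ht.mono_left nhdsWithin_le_nhds),
      tendsto_trace_of_ae_eq hf (ht.mono_left nhdsWithin_le_nhds)⟩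
  have hΨ : Ψ σ = toL2 φ := Lp.ext (h4.trans (toL2_coeFn (testFun_memLp hφ)).symm)
  rw [hΨ]
  fin_cases p
  · exact key _ φ (toL2_coeFn (testFun_memLp hφ)) h3
  · have hd := testFun_deriv hφ
    have := key _ (deriv φ) (toL2_coeFn (testFun_memLp hd)) hd.2.2
    rw [← wderiv_toL2 hφ (finite_range y)] at this
    exact this

end Minimal

/-! ### The boundary map of the maximal operator -/

section Boundary

variable {N : ℕ} (α y : Fin N → ℝ)

theorem sub_dotSpin_ne {z : ℂ} (hz : z.im ≠ 0) (σ : Config N) (r : ℝ) (_ : 0 ≤ r) :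
    z - dotSpin α σ ≠ r := fun h => hz (by simpa using congrArg Complex.im h)

theorem I_im_ne_zero : Complex.I.im ≠ 0 := by simp

theorem conj_I_im_ne_zero : (conj Complex.I).im ≠ 0 := by simp

theorem hasBoundaryValues_add {Ψ Φ : State N} (hΨ : Ψ ∈ components N (H2 (range y)))
    (hΦ : Φ ∈ components N (H2 (range y))) {L R L' R' : Idx N → ℂ}
    (hb : HasBoundaryValues y Ψ L R) (hb' : HasBoundaryValues y Φ L' R') :
    HasBoundaryValues y (Ψ + Φ) (L + L') (R + R') := fun p j σ => by
  rw [PiLp.add_apply, iterate_wderiv_add (finite_range y) (hΨ σ) (hΦ σ)]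
  exact ⟨tendsto_trace_add (hb p j σ).1 (hb' p j σ).1,
    tendsto_trace_add (hb p j σ).2 (hb' p j σ).2⟩

theorem hasBoundaryValues_smul (c : ℂ) {Ψ : State N} (hΨ : Ψ ∈ components N (H2 (range y)))
    {L R : Idx N → ℂ} (hb : HasBoundaryValues y Ψ L R) :
    HasBoundaryValues y (c • Ψ) (c • L) (c • R) := fun p j σ => by
  rw [PiLp.smul_apply, iterate_wderiv_smul (finite_range y) c (hΨ σ)]
  exact ⟨tendsto_trace_smul c (hb p j σ).1, tendsto_trace_smul c (hb p j σ).2⟩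

open scoped Classical in
/-- The charges and averages of a vector (and `0` if they do not exist). -/
def boundaryData (Ψ : State N) : (Idx N → ℂ) × (Idx N → ℂ) :=
  if h : ∃ L R, HasBoundaryValues y Ψ L R then
    (charge h.choose h.choose_spec.choose, average h.choose h.choose_spec.choose) else 0

variable {y} in
theorem boundaryData_eq {Ψ : State N} {L R : Idx N → ℂ} (h : HasBoundaryValues y Ψ L R) :
    boundaryData y Ψ = (charge L R, average L R) := by
  have h' : ∃ L R, HasBoundaryValues y Ψ L R := ⟨L, R, h⟩
  have hu := h'.choose_spec.choose_spec.unique h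
  rw [boundaryData, dif_pos h']
  exact Prod.ext (congrArg₂ charge hu.1 hu.2) (congrArg₂ average hu.1 hu.2)

variable (hy : Function.Injective y)
include hy

theorem exists_hasBoundaryValues {Ψ : State N} (h : Ψ ∈ (maximalH α y).domain) :
    ∃ L R, HasBoundaryValues y Ψ L R := by
  obtain ⟨c, g, hc⟩ := exists_eq_kreinVec y (sub_dotSpin_ne α I_im_ne_zero) ⟨Ψ, h⟩
  obtain ⟨L, R, hb, -⟩ := exists_boundary_kreinVec y (sub_dotSpin_ne α I_im_ne_zero) hy c g
  rw [← hc] at hb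
  exact ⟨L, R, hb⟩

/-- The linear map sending a vector of the maximal domain to its charges and averages. -/
def boundaryMap : (maximalH α y).domain →ₗ[ℂ] (Idx N → ℂ) × (Idx N → ℂ) where
  toFun Ψ := boundaryData y (Ψ : State N)
  map_add' Ψ Φ := by
    obtain ⟨L, R, h⟩ := exists_hasBoundaryValues α y hy Ψ.2
    obtain ⟨L', R', h'⟩ := exists_hasBoundaryValues α y hy Φ.2
    rw [boundaryData_eq h, boundaryData_eq h', Submodule.coe_add,
      boundaryData_eq (hasBoundaryValues_add y Ψ.2 Φ.2 h h'), charge_add, average_add]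
    rfl
  map_smul' c Ψ := by
    obtain ⟨L, R, h⟩ := exists_hasBoundaryValues α y hy Ψ.2
    rw [boundaryData_eq h, Submodule.coe_smul,
      boundaryData_eq (hasBoundaryValues_smul y c Ψ.2 h), charge_smul, average_smul]
    rfl

theorem boundaryMap_eq (Ψ : (maximalH α y).domain) {L R : Idx N → ℂ}
    (h : HasBoundaryValues y (Ψ : State N) L R) :
    boundaryMap α y hy Ψ = (charge L R, average L R) := boundaryData_eq h

variable {α} in
theorem boundaryMap_kreinVec {z : ℂ}
    (hz : ∀ (σ : Config N) (r : ℝ), 0 ≤ r → z - dotSpin α σ ≠ r) (c : Idx N → ℂ) (Ψ : State N)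
    (h : kreinVec y hz c Ψ ∈ (maximalH α y).domain) :
    boundaryMap α y hy ⟨kreinVec y hz c Ψ, h⟩ =
      (c, (fun μ => inner ℂ (defectVec α y (conj z) μ) Ψ) - (gammaMat α y z).mulVec c) := by
  obtain ⟨L, R, hb, hq, hf⟩ := exists_boundary_kreinVec y hz hy c Ψ
  exact (boundaryMap_eq α y hy ⟨_, h⟩ hb).trans (congrArg₂ Prod.mk hq hf)

variable {α} in
theorem eq_zero_of_kreinVec_eq_zero {z : ℂ}
    (hz : ∀ (σ : Config N) (r : ℝ), 0 ≤ r → z - dotSpin α σ ≠ r) {c : Idx N → ℂ} {Ψ : State N}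
    (h : kreinVec y hz c Ψ = 0) : c = 0 := by
  have h1 := boundaryMap_kreinVec y hy hz c Ψ (kreinVec_mem_maximalH y hz c Ψ)
  have h2 : (⟨kreinVec y hz c Ψ, kreinVec_mem_maximalH y hz c Ψ⟩ : (maximalH α y).domain) = 0 :=
    Subtype.ext h
  rw [h2, map_zero] at h1
  exact (congrArg Prod.fst h1).symm

variable {α} in
/-- The vectors `Φ^z_μ` are linearly independent, since their charges are. -/
theorem exists_inner_defectVec_eq {z : ℂ}
    (hz : ∀ (σ : Config N) (r : ℝ), 0 ≤ r → z - dotSpin α σ ≠ r) (b : Idx N → ℂ) :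
    ∃ Ψ : State N, ∀ μ, inner ℂ (defectVec α y z μ) Ψ = b μ := by
  let τ : State N →ₗ[ℂ] (Idx N → ℂ) := LinearMap.pi fun μ => innerₛₗ ℂ (defectVec α y z μ)
  suffices h : LinearMap.range τ = ⊤ by
    obtain ⟨Ψ, hΨ⟩ := LinearMap.range_eq_top.mp h b
    exact ⟨Ψ, fun μ => congrFun hΨ μ⟩
  by_contra hne
  obtain ⟨f, hf, hle⟩ := Submodule.exists_le_ker_of_lt_top _ (lt_top_iff_ne_top.mpr hne)
  set d : Idx N → ℂ := fun μ => f fun ν => if μ = ν then 1 else 0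
  have hf' : ∀ x, f x = ∑ μ, x μ * d μ := fun x => LinearMap.pi_apply_eq_sum_univ f x
  have hz0 : kreinVec y hz (fun μ => conj (d μ)) 0 = 0 := by
    rw [kreinVec_eq, map_zero, zero_add]
    refine ext_inner_right ℂ fun Ψ => ?_
    rw [sum_inner, inner_zero_left]
    have h0 : f (τ Ψ) = 0 := hle (LinearMap.mem_range_self τ Ψ)
    rw [hf'] at h0
    rw [← h0]
    refine Finset.sum_congr rfl fun μ _ => ?_
    rw [inner_smul_left, Complex.conj_conj, mul_comm]
    rfl
  have hc := eq_zero_of_kreinVec_eq_zero y hy hz hz0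
  refine hf (LinearMap.ext fun x => ?_)
  rw [hf', LinearMap.zero_apply]
  refine Finset.sum_eq_zero fun μ _ => ?_
  have := congrFun hc μ
  rw [Pi.zero_apply, map_eq_zero] at this
  rw [this, mul_zero]

/-- Green's identity. Writing the two vectors as `R(z) g + ∑ c_μ Φ^z_μ` with `z = i` and `z = -i`,
it follows from `R(z)* = R(z̄)` and `Γ(z)* = Γ(z̄)`. -/
theorem boundaryMap_green (u v : (maximalH α y).domain) :
    inner ℂ (maximalH α y u) (v : State N) - inner ℂ (u : State N) (maximalH α y v) =
      boundaryForm (boundaryMap α y hy u) (boundaryMap α y hy v) := by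
  have hz := sub_dotSpin_ne α I_im_ne_zero
  have hz' := sub_dotSpin_ne α conj_I_im_ne_zero
  obtain ⟨u, hu⟩ := u
  obtain ⟨v, hv⟩ := v
  obtain ⟨c, g, hc⟩ := exists_eq_kreinVec y hz ⟨u, hu⟩
  obtain ⟨c', g', hc'⟩ := exists_eq_kreinVec y hz' ⟨v, hv⟩
  simp only at hc hc'
  subst hc hc'
  rw [boundaryMap_kreinVec y hy, boundaryMap_kreinVec y hy, maximalH_kreinVec, maximalH_kreinVec,
    inner_add_left, inner_add_right, inner_smul_left, inner_smul_right, add_sub_add_right_eq_sub]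
  simp only [kreinVec_eq, inner_add_left, inner_add_right]
  rw [inner_freeR hz hz' rfl, add_sub_add_left_eq_sub, inner_sum, sum_inner]
  simp only [inner_smul_left, inner_smul_right, boundaryForm, star_sub, sub_dotProduct,
    dotProduct_sub, Matrix.star_mulVec]
  rw [conjTranspose_gammaMat α y _ hz, ← Matrix.dotProduct_mulVec, sub_sub_sub_cancel_right,
    Complex.conj_conj]
  congr 1
  refine Finset.sum_congr rfl fun μ _ => ?_
  rw [Pi.star_apply, RCLike.star_def, inner_conj_symm, mul_comm]

theorem isBoundaryMap : IsBoundaryMap (minimalH α y) (maximalH α y) (boundaryMap α y hy) where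
  dense := dense_minimalH_domain α y
  le := minimalH_le_maximalH α y
  vanish u hu := by
    rw [boundaryMap_eq α y hy u (hasBoundaryValues_of_mem_minimalH α y hu)]
    ext ⟨p, j, σ⟩
    · fin_cases p <;> simp [charge]
    · simp [average]
  green := boundaryMap_green α y hy
  surjective := fun a => by
    have hz := sub_dotSpin_ne α I_im_ne_zero
    obtain ⟨Ψ, hΨ⟩ := exists_inner_defectVec_eq y hy (sub_dotSpin_ne α conj_I_im_ne_zero)
      (a.2 + (gammaMat α y Complex.I).mulVec a.1)
    refine ⟨⟨kreinVec y hz a.1 Ψ, kreinVec_mem_maximalH y hz _ _⟩, ?_⟩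
    rw [boundaryMap_kreinVec y hy hz, funext hΨ, add_sub_cancel_right]
  maximal := fun _ _ h => exists_maximalH_eq α y h

end Boundary

/-! ### The continuous spectrum -/

/-- Wave packets `χ(ε x) e^{ikx}`, with `χ` supported in `[1, 5]`, are test functions on `ℝ ∖ Y` for
small `ε`; their norms violate any lower bound for `-Δ - k²` as `ε → 0`. -/
theorem exists_testFun_norm_lt {Y : Set ℝ} (hY : Y.Finite) (k C : ℝ) :
    ∃ φ ∈ testFun Y, C * ‖-toL2 (deriv (deriv φ)) - ((k ^ 2 : ℝ) : ℂ) • toL2 φ‖ < ‖toL2 φ‖ := by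
  let χ : ContDiffBump (3 : ℝ) := ⟨1, 2, one_pos, one_lt_two⟩
  let c : ℝ → ℂ := fun x => (χ x : ℂ)
  have c1 : ContDiff ℝ ∞ c := Complex.ofRealCLM.contDiff.comp χ.contDiff
  have c2 : HasCompactSupport c :=
    χ.hasCompactSupport.comp_left (g := fun r : ℝ => (r : ℂ)) (by simp)
  have c1' : ContDiff ℝ ∞ (deriv c) := (contDiff_infty_iff_deriv.mp c1).2
  have c1'' : ContDiff ℝ ∞ (deriv (deriv c)) := (contDiff_infty_iff_deriv.mp c1').2
  have hc3 : c 3 = 1 := by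
    have : χ 3 = 1 := χ.one_of_mem_closedBall (by simp [χ.rIn_pos.le])
    simp [c, this]
  have hcs : tsupport c ⊆ Icc 1 5 := by
    have h1 : tsupport c ⊆ tsupport χ :=
      closure_mono (Function.support_comp_subset (g := fun r : ℝ => (r : ℂ)) (by simp) χ)
    refine h1.trans ?_
    rw [χ.tsupport_eq, Real.closedBall_eq_Icc]
    exact Icc_subset_Icc (by norm_num [χ]) (by norm_num [χ])
  have hsc : ∀ {f : ℝ → ℂ}, ContDiff ℝ ∞ f → ∀ ε x : ℝ,
      HasDerivAt (fun x => f (ε * x)) ((ε : ℂ) * deriv f (ε * x)) x := fun {f} hf ε x => by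
    have h1 : HasDerivAt (fun x : ℝ => ε * x) ε x := by simpa using (hasDerivAt_id x).const_mul ε
    have h2 := (hf.differentiable (by simp) (ε * x)).hasDerivAt.scomp x h1
    rw [Complex.real_smul] at h2
    exact h2
  let e : ℝ → ℂ := fun x => Complex.exp (Complex.I * k * x)
  have he : ∀ x, HasDerivAt e (Complex.I * k * e x) x := hasDerivAt_exp_mul _
  have hen : ∀ x, ‖e x‖ = 1 := fun x => by
    simp only [e]
    rw [Complex.norm_exp]
    simp
  let φ : ℝ → ℝ → ℂ := fun ε x => c (ε * x) * e x
  let ψ : ℝ → ℝ → ℂ := fun ε x => ε * deriv (deriv c) x + 2 * Complex.I * k * deriv c x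
  have hdd : ∀ ε x, deriv (deriv (φ ε)) x = ε * ψ ε (ε * x) * e x - k ^ 2 * φ ε x := fun ε x => by
    have d1 : deriv (φ ε) = fun x => ε * deriv c (ε * x) * e x + c (ε * x) * (Complex.I * k * e x) :=
      funext fun x => ((hsc c1 ε x).mul (he x)).deriv
    rw [d1]
    refine HasDerivAt.deriv ((((((hsc c1' ε x).const_mul (ε : ℂ)).mul (he x))).add
      ((hsc c1 ε x).mul ((he x).const_mul _))).congr_deriv ?_)
    simp only [φ, ψ]
    linear_combination k ^ 2 * c (ε * x) * e x * Complex.I_sq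
  have hφ : ∀ ε > 0, (∀ a ∈ Y, ε * a < 1) → φ ε ∈ testFun Y := fun ε hε hs => by
    refine ⟨(c1.comp (contDiff_const.mul contDiff_id)).mul ?_, HasCompactSupport.mul_right
      (c2.comp_homeomorph (Homeomorph.mulLeft₀ ε hε.ne')), fun x hx ha => ?_⟩
    · exact ((contDiff_const (c := Complex.I * (k : ℂ))).mul Complex.ofRealCLM.contDiff).cexp
    · have h1 : x ∈ tsupport (fun x => c (ε * x)) := tsupport_mul_subset_left hx
      have h2 := tsupport_comp_subset_preimage c (continuous_const_mul ε) h1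
      exact absurd (hcs h2).1 (not_le.mpr (hs x ha))
  -- the norms in terms of the fixed profiles `c` and `ψ ε`
  have n1 : ∀ ε > 0, φ ε ∈ testFun Y → ‖toL2 (φ ε)‖ ^ 2 = ε⁻¹ * ∫ x, ‖c x‖ ^ 2 := fun ε hε h => by
    have h1 : ∫ x, ‖toL2 (φ ε) x‖ ^ 2 = ∫ x, ‖c (ε * x)‖ ^ 2 := by
      apply integral_congr_ae
      filter_upwards [toL2_coeFn (testFun_memLp h)] with x hx
      rw [hx, norm_mul, hen, mul_one]
    rw [norm_sq_eq_integral, h1, Measure.integral_comp_mul_left (fun x => ‖c x‖ ^ 2),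
      abs_of_pos (inv_pos.mpr hε), smul_eq_mul]
  have n2 : ∀ ε > 0, φ ε ∈ testFun Y →
      ‖-toL2 (deriv (deriv (φ ε))) - ((k ^ 2 : ℝ) : ℂ) • toL2 (φ ε)‖ ^ 2 =
        ε⁻¹ * (ε ^ 2 * ∫ x, ‖ψ ε x‖ ^ 2) := fun ε hε h => by
    have h1 : ∫ x, ‖(-toL2 (deriv (deriv (φ ε))) - ((k ^ 2 : ℝ) : ℂ) • toL2 (φ ε)) x‖ ^ 2 =
        ∫ x, ε ^ 2 * ‖ψ ε (ε * x)‖ ^ 2 := by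
      apply integral_congr_ae
      filter_upwards [toL2_coeFn (testFun_memLp h),
        toL2_coeFn (testFun_memLp (testFun_deriv (testFun_deriv h))),
        Lp.coeFn_sub (-toL2 (deriv (deriv (φ ε)))) (((k ^ 2 : ℝ) : ℂ) • toL2 (φ ε)),
        Lp.coeFn_neg (toL2 (deriv (deriv (φ ε)))),
        Lp.coeFn_smul (((k ^ 2 : ℝ) : ℂ)) (toL2 (φ ε))] with x h1 h2 h3 h4 h5
      rw [h3, Pi.sub_apply, h4, h5, Pi.neg_apply, Pi.smul_apply, h1, h2, hdd]
      have : -(ε * ψ ε (ε * x) * e x - k ^ 2 * φ ε x) - ((k ^ 2 : ℝ) : ℂ) • φ ε x =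
          -(ε * ψ ε (ε * x) * e x) := by
        rw [smul_eq_mul]
        push_cast
        ring
      rw [this, norm_neg, norm_mul, norm_mul, hen, mul_one, Complex.norm_real, mul_pow,
        Real.norm_eq_abs, sq_abs]
    rw [norm_sq_eq_integral, h1, integral_const_mul,
      Measure.integral_comp_mul_left (fun x => ‖ψ ε x‖ ^ 2), abs_of_pos (inv_pos.mpr hε),
      smul_eq_mul]
    ring
  have i1 : Integrable fun x => ‖c x‖ ^ 2 :=
    (memLp_two_iff_integrable_sq_norm c1.continuous.aestronglyMeasurable).mp
      (c1.continuous.memLp_of_hasCompactSupport c2)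
  have i2 : Integrable fun x => ‖deriv c x‖ ^ 2 :=
    (memLp_two_iff_integrable_sq_norm c1'.continuous.aestronglyMeasurable).mp
      (c1'.continuous.memLp_of_hasCompactSupport c2.deriv)
  have i3 : Integrable fun x => ‖deriv (deriv c) x‖ ^ 2 :=
    (memLp_two_iff_integrable_sq_norm c1''.continuous.aestronglyMeasurable).mp
      (c1''.continuous.memLp_of_hasCompactSupport c2.deriv.deriv)
  have i4 : Integrable fun x => 2 * ‖deriv (deriv c) x‖ ^ 2 + 8 * k ^ 2 * ‖deriv c x‖ ^ 2 :=
    (i3.const_mul _).add (i2.const_mul _)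
  set D := ∫ x, (2 * ‖deriv (deriv c) x‖ ^ 2 + 8 * k ^ 2 * ‖deriv c x‖ ^ 2)
  have hψ : ∀ ε, 0 < ε → ε < 1 → ∫ x, ‖ψ ε x‖ ^ 2 ≤ D := fun ε h0 h1 => by
    refine integral_mono_of_nonneg (Eventually.of_forall fun x => by positivity) i4
      (Eventually.of_forall fun x => ?_)
    have hn : ‖ψ ε x‖ ≤ ‖deriv (deriv c) x‖ + 2 * |k| * ‖deriv c x‖ := by
      refine (norm_add_le _ _).trans (add_le_add ?_ (le_of_eq ?_))
      · rw [norm_mul, Complex.norm_real, Real.norm_of_nonneg h0.le]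
        exact mul_le_of_le_one_left (norm_nonneg _) h1.le
      · simp
    refine (pow_le_pow_left₀ (norm_nonneg _) hn 2).trans ?_
    have := sq_nonneg (‖deriv (deriv c) x‖ - 2 * |k| * ‖deriv c x‖)
    have hk := sq_abs k
    have h8 : 8 * k ^ 2 * ‖deriv c x‖ ^ 2 = 8 * |k| ^ 2 * ‖deriv c x‖ ^ 2 := by rw [hk]
    simp only
    rw [h8]
    nlinarith
  have hpos : 0 < ∫ x, ‖c x‖ ^ 2 := by
    refine integral_pos_of_integrable_nonneg_nonzero (x := 3) (by
      exact c1.continuous.norm.pow 2) i1 (fun x => by positivity) ?_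
    rw [hc3]
    norm_num
  have hDC : ∀ᶠ ε : ℝ in 𝓝[>] 0, C ^ 2 * (ε ^ 2 * D) < ∫ x, ‖c x‖ ^ 2 := by
    have : Continuous fun ε : ℝ => C ^ 2 * (ε ^ 2 * D) := by fun_prop
    have ht := (this.tendsto 0).mono_left (nhdsWithin_le_nhds (s := Ioi 0))
    exact ht.eventually_lt_const (by simpa using hpos)
  have hsup : ∀ᶠ ε : ℝ in 𝓝[>] 0, ∀ a ∈ Y, ε * a < 1 := by
    refine (eventually_all_finite hY).mpr fun a _ => ?_
    have : Continuous fun ε : ℝ => ε * a := by fun_prop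
    have ht := (this.tendsto 0).mono_left (nhdsWithin_le_nhds (s := Ioi 0))
    exact ht.eventually_lt_const (by simp)
  obtain ⟨ε, h1, h2, h3, h4⟩ := (hDC.and (hsup.and ((eventually_lt_nhds zero_lt_one).filter_mono
    nhdsWithin_le_nhds |>.and self_mem_nhdsWithin))).exists
  have hε : 0 < ε := h4
  have hm := hφ ε hε h2
  refine ⟨φ ε, hm, lt_of_pow_lt_pow_left₀ 2 (norm_nonneg _) ?_⟩
  rw [mul_pow, n1 ε hε hm, n2 ε hε hm]
  have hD := hψ ε hε h3
  have hi := inv_pos.mpr hε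
  calc C ^ 2 * (ε⁻¹ * (ε ^ 2 * ∫ x, ‖ψ ε x‖ ^ 2))
      = ε⁻¹ * (C ^ 2 * (ε ^ 2 * ∫ x, ‖ψ ε x‖ ^ 2)) := by ring
    _ ≤ ε⁻¹ * (C ^ 2 * (ε ^ 2 * D)) := by gcongr
    _ < ε⁻¹ * ∫ x, ‖c x‖ ^ 2 := mul_lt_mul_of_pos_left h1 hi

/-- Wave packets of energy close to `r + α·σ`, supported off the points, lie in the domain of every
extension of the minimal operator. -/
theorem notMem_continuous_spectrum {N : ℕ} {α y : Fin N → ℝ} {K : State N →ₗ.[ℂ] State N}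
    (hK : minimalH α y ≤ K) {z : ℂ} (hz : z ∈ rho K) (σ : Config N) (r : ℝ) (hr : 0 ≤ r) :
    z - dotSpin α σ ≠ r := by
  intro h
  obtain ⟨R, -, hR⟩ := hz
  obtain ⟨φ, hφ, hlt⟩ := exists_testFun_norm_lt (finite_range y) (√r) ‖R‖
  have hm := singleState_mem_minimalH α y σ hφ
  have h1 := hR ⟨_, hK.1 hm⟩
  rw [← hK.2 (x := ⟨_, hm⟩) rfl, minimalH_singleState α y σ hφ] at h1
  have e : singleState σ (-toL2 (deriv (deriv φ)) + (dotSpin α σ : ℂ) • toL2 φ) -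
      z • singleState σ (toL2 φ) =
      singleState σ (-toL2 (deriv (deriv φ)) - ((√r ^ 2 : ℝ) : ℂ) • toL2 φ) := by
    ext1 σ'
    rw [PiLp.sub_apply, PiLp.smul_apply]
    simp only [singleState_apply]
    split_ifs
    · rw [Real.sq_sqrt hr, ← h, sub_smul]
      abel
    · simp
  rw [e] at h1
  have h2 := R.le_opNorm (singleState σ (-toL2 (deriv (deriv φ)) - ((√r ^ 2 : ℝ) : ℂ) • toL2 φ))
  rw [h1, norm_singleState, norm_singleState] at h2
  exact absurd hlt (not_lt.mpr h2)

/-! ### The free resolvent -/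

/-- The representation by Green's functions in the case of no poles. -/
theorem eq_convL_of_mem_H2 {w : ℂ} (hw : ∀ r : ℝ, 0 ≤ r → w ≠ r) {u : L2} (hu : u ∈ H2 ∅) :
    convL (isExpKernel_green hw) (-wderiv ∅ (wderiv ∅ u) - w • u) = u := by
  obtain ⟨c, hc⟩ := exists_eq_kreinFun (y := (Fin.elim0 : Fin 0 → ℝ)) hw (u := u)
    (v := wderiv ∅ (wderiv ∅ u)) fun φ hφ => by
      rw [range_eq_empty] at hφ
      exact integral_mul_second_derivative finite_empty hu hφ
  rw [kreinFun, Finset.univ_eq_empty, Finset.sum_empty, add_zero] at hc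
  exact hc.symm

theorem isResolventAt_freeR {N : ℕ} {α : Fin N → ℝ} {z : ℂ}
    (hz : ∀ (σ : Config N) (r : ℝ), 0 ≤ r → z - dotSpin α σ ≠ r) :
    IsResolventAt (freeH α) z (freeR hz) := by
  have happ : ∀ (u : (freeH α).domain) (σ : Config N), freeH α u σ =
      -wderiv ∅ (wderiv ∅ ((u : State N) σ)) + (dotSpin α σ : ℂ) • (u : State N) σ :=
    fun _ _ => rfl
  refine ⟨fun v => ?_, fun u => ?_⟩
  · have hd : ∀ σ, IsWeakDeriv ∅ (freeR hz v σ) (convL (isExpKernel_greenDeriv (hz σ)) (v σ)) ∧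
        IsWeakDeriv ∅ (convL (isExpKernel_greenDeriv (hz σ)) (v σ))
          (-v σ - (z - dotSpin α σ) • freeR hz v σ) := fun σ => by
      rw [freeR_apply]
      exact ⟨isWeakDeriv_conv_green (hz σ) (v σ), isWeakDeriv_conv_greenDeriv (hz σ) (v σ)⟩
    have hmem : freeR hz v ∈ (freeH α).domain := fun σ => ⟨_, _, (hd σ).1, (hd σ).2⟩
    refine ⟨hmem, ?_⟩
    ext1 σ
    rw [PiLp.sub_apply, PiLp.smul_apply, happ, (hd σ).1.wderiv_eq finite_empty,
      (hd σ).2.wderiv_eq finite_empty, sub_smul]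
    abel
  · ext1 σ
    rw [freeR_apply]
    refine (congrArg _ ?_).trans (eq_convL_of_mem_H2 (hz σ) (u.2 σ))
    rw [PiLp.sub_apply, PiLp.smul_apply, happ, sub_smul]
    abel

/-! ### The operators `H^{AB}` -/

section HamAB

variable {N : ℕ} (α y : Fin N → ℝ) (A B : Matrix (Idx N) (Idx N) ℂ)

theorem hamAB_le_maximalH : hamAB α y A B ≤ maximalH α y :=
  ⟨fun _ h => h.1, fun u v huv => by
    ext1 σ
    rw [maximalH_apply, ← huv]
    rfl⟩

theorem mem_hamAB_domain_iff (hy : Function.Injective y) (u : (maximalH α y).domain) :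
    (u : State N) ∈ (hamAB α y A B).domain ↔ boundaryMap α y hy u ∈ boundarySpace A B := by
  constructor
  · rintro ⟨-, L, R, hb, h⟩
    rw [boundaryMap_eq α y hy u hb]
    exact h
  · intro h
    obtain ⟨L, R, hb⟩ := exists_hasBoundaryValues α y hy u.2
    rw [boundaryMap_eq α y hy u hb] at h
    exact ⟨u.2, L, R, hb, h⟩

theorem admissible_iff : Admissible A B ↔ A * B.conjTranspose = B * A.conjTranspose ∧
    (Matrix.fromCols A B).rank = Fintype.card (Idx N) := by
  have h : Fintype.card (Idx N) = N * 2 ^ (N + 1) := by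
    simp only [Idx, Config, Fintype.card_prod, Fintype.card_fin, Fintype.card_pi,
      Fintype.card_units_int, Finset.prod_const, Finset.card_univ]
    ring
  rw [h, Admissible]

variable {α y A B} {z : ℂ} (hz : ∀ (σ : Config N) (r : ℝ), 0 ≤ r → z - dotSpin α σ ≠ r)
  (hy : Function.Injective y)
include hy

theorem kreinVec_mem_hamAB {c : Idx N → ℂ} {Ψ : State N}
    (h : (gammaAB α y A B z).mulVec c =
      B.mulVec fun μ => inner ℂ (defectVec α y (conj z) μ) Ψ) :
    kreinVec y hz c Ψ ∈ (hamAB α y A B).domain := by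
  refine (mem_hamAB_domain_iff α y A B hy ⟨_, kreinVec_mem_maximalH y hz c Ψ⟩).mpr ?_
  rw [boundaryMap_kreinVec y hy hz, mem_boundarySpace, Matrix.mulVec_sub, ← h, gammaAB,
    Matrix.add_mulVec, ← Matrix.mulVec_mulVec, add_sub_cancel_left]

theorem resolvent_kreinVec {R : State N →L[ℂ] State N} (hR : IsResolventAt (hamAB α y A B) z R)
    {c : Idx N → ℂ} {Ψ : State N}
    (h : (gammaAB α y A B z).mulVec c =
      B.mulVec fun μ => inner ℂ (defectVec α y (conj z) μ) Ψ) :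
    R Ψ = kreinVec y hz c Ψ := by
  have h1 := hR.2 ⟨_, kreinVec_mem_hamAB hz hy h⟩
  have h2 : hamAB α y A B ⟨_, kreinVec_mem_hamAB hz hy h⟩ = Ψ + z • kreinVec y hz c Ψ :=
    spinLaplacian_kreinVec y hz _ c Ψ _
  rw [h2] at h1
  simpa using h1

include hz in
theorem isUnit_gammaAB {R : State N →L[ℂ] State N} (hR : IsResolventAt (hamAB α y A B) z R) :
    IsUnit (gammaAB α y A B z).det := by
  rw [← Matrix.isUnit_iff_isUnit_det, ← Matrix.mulVec_injective_iff_isUnit]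
  refine (injective_iff_map_eq_zero (gammaAB α y A B z).mulVecLin).mpr fun c hc => ?_
  have h : (gammaAB α y A B z).mulVec c =
      B.mulVec fun μ => inner ℂ (defectVec α y (conj z) μ) (0 : State N) := by
    simp only [inner_zero_right]
    exact hc.trans (Matrix.mulVec_zero B).symm
  have := resolvent_kreinVec hz hy hR h
  rw [map_zero] at this
  exact eq_zero_of_kreinVec_eq_zero y hy hz this.symm

/-- Krein's formula for the resolvent. -/
theorem resolvent_eq {R : State N →L[ℂ] State N} (hR : IsResolventAt (hamAB α y A B) z R)
    (Ψ : State N) :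
    R Ψ = freeR hz Ψ + ∑ μ, ∑ μ', ∑ μ'', ((gammaAB α y A B z)⁻¹ μ μ' * B μ' μ'' *
      inner ℂ (defectVec α y (conj z) μ'') Ψ) • defectVec α y z μ := by
  set τ : Idx N → ℂ := fun μ => inner ℂ (defectVec α y (conj z) μ) Ψ with hτ
  have hu := isUnit_gammaAB hz hy hR
  have h : (gammaAB α y A B z).mulVec ((gammaAB α y A B z)⁻¹.mulVec (B.mulVec τ)) =
      B.mulVec τ := by
    rw [Matrix.mulVec_mulVec, Matrix.mul_nonsing_inv _ hu, Matrix.one_mulVec]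
  rw [resolvent_kreinVec hz hy hR h, kreinVec_eq]
  congr 1
  refine Finset.sum_congr rfl fun μ _ => ?_
  simp only [← Finset.sum_smul]
  congr 1
  simp only [Matrix.mulVec, dotProduct, Finset.mul_sum, mul_assoc, hτ]

end HamAB

end PointSpin

end

open PointSpin
theorem theorem1 (N : ℕ) (α y : Fin N → ℝ) (hy : Function.Injective y) :
    (∀ A B : Matrix (Idx N) (Idx N) ℂ, Admissible A B →
      IsSelfAdjoint (hamAB α y A B) ∧ minimalH α y ≤ hamAB α y A B ∧
      ∀ z ∈ rho (hamAB α y A B),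
        z ∈ rho (freeH α) ∧
        (∀ (σ : Config N) (r : ℝ), 0 ≤ r → z - dotSpin α σ ≠ r) ∧
        IsUnit (gammaAB α y A B z).det ∧
        ∀ Ψ : State N,
          resolventOp (hamAB α y A B) z Ψ = resolventOp (freeH α) z Ψ +
            ∑ μ, ∑ μ', ∑ μ'', ((gammaAB α y A B z)⁻¹ μ μ' * B μ' μ'' *
              inner ℂ (defectVec α y (conj z) μ'') Ψ) • defectVec α y z μ) ∧
    ∀ K : State N →ₗ.[ℂ] State N, IsSelfAdjoint K → minimalH α y ≤ K →
      ∃ A B : Matrix (Idx N) (Idx N) ℂ, Admissible A B ∧ K = hamAB α y A B := by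
  have hβ := isBoundaryMap α y hy
  refine ⟨fun A B hAB => ?_, fun K hK hle => ?_⟩
  · obtain ⟨hsym, hrank⟩ := (admissible_iff A B).mp hAB
    obtain ⟨hsa, hle⟩ := hβ.isSelfAdjoint_of_isLagrangian (hamAB_le_maximalH α y A B)
      (isLagrangian_boundarySpace hsym hrank) (mem_hamAB_domain_iff α y A B hy)
    refine ⟨hsa, hle, fun z hz => ?_⟩
    have hzσ := notMem_continuous_spectrum hle hz
    have hfree := isResolventAt_freeR hzσ
    have hR := resolventOp_spec hz
    have hfree' : z ∈ rho (freeH α) := ⟨_, hfree⟩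
    refine ⟨hfree', hzσ, isUnit_gammaAB hzσ hy hR, fun Ψ => ?_⟩
    rw [(resolventOp_spec hfree').unique hfree]
    exact resolvent_eq hzσ hy hR Ψ
  · obtain ⟨hKT, L, hL, hdom⟩ := hβ.exists_isLagrangian hK hle
    obtain ⟨A, B, hsym, hrank, rfl⟩ := hL.exists_eq_boundarySpace
    refine ⟨A, B, (admissible_iff A B).mpr ⟨hsym, hrank⟩, ?_⟩
    have hAB := hamAB_le_maximalH α y A B
    have hd : ∀ u, u ∈ K.domain ↔ u ∈ (hamAB α y A B).domain := fun u =>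
      ⟨fun h => (mem_hamAB_domain_iff α y A B hy ⟨u, hKT.1 h⟩).mpr ((hdom ⟨u, hKT.1 h⟩).mp h),
        fun h => (hdom ⟨u, hAB.1 h⟩).mpr ((mem_hamAB_domain_iff α y A B hy ⟨u, hAB.1 h⟩).mp h)⟩
    refine LinearPMap.eq_of_le_of_domain_eq ⟨fun u hu => (hd u).mp hu, fun u v huv => ?_⟩
      (SetLike.ext hd)
    rw [hKT.2 (x := u) (y := ⟨u, hKT.1 u.2⟩) rfl, hAB.2 (x := v) (y := ⟨u, hKT.1 u.2⟩) huv.symm]
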